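/- Notation. $\mathbb{R}_*=\mathbb{R}\setminus\{0\}$. All functions are real-valued. For $s\in(0,1)$ let $$\mathcal{L}_s[v](x)=-G_s\int_{\mathbb{R}}\frac{v(x+z)-v(x)}{|z|^{1+s}}\,dz,\qquad G_s=\frac{s\,\Gamma\!\left(\frac{1+s}{2}\right)}{2\pi^{\frac12+s}\,\Gamma\!\left(1-\frac s2\right)}.$$ The Fourier transform on $\mathcal{S}'(\mathbb{R})$ is normalized by $\mathcal{F}(v)(\xi)=\int_{\mathbb{R}}e^{-2i\pi x\xi}v(x)\,dx$ for $v\in L^1(\mathbb{R})$. The following spaces are used. - $C_b(\mathbb{R}_*)\cap C^1(\mathbb{R}_*)$: bounded $C^1$ functions on $\mathbb{R}_*$, with the topology of uniform convergence of $v$ on $\mathbb{R}_*$ and of $v'$ on compact subsets of $\mathbb{R}_*$. $C(\mathbb{R}_*)$ carries the topology of uniform convergence on compact subsets. - $H^1(\mathbb{R}_*)$: functions $v\in L^2(\mathbb{R})$ whose weak derivative on $\mathbb{R}_*$ (tested against $C_c^\infty(\mathbb{R}_*)$) is in $L^2$, with its usual norm. - $L^1_{loc}(\mathbb{R})\cap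 L^2_{loc}(\overline{\mathbb{R}}\setminus\{0\})$: functions that belong to $L^1((-R,R))$ and to $L^2(\mathbb{R}\setminus[-R,R])$ for all $R>0$, with the topology given by these (semi-)norms. - $L^1(\mathbb{R})\cap(BV(\mathbb{R}))_{w-\star}$: functions $v\in L^1(\mathbb{R})$ whose distributional derivative $\partial_xv$ belongs to $(C_0(\mathbb{R}))'$, with the smallest topology that makes continuous the inclusion into $L^1(\mathbb{R})$ (with its norm) and the map $\partial_x$ into $(C_0(\mathbb{R}))'$ (with its weak-$\star$ topology). **Lemma 4.1.** Let $\lambda\in(0,1)$. (i) In each of the four cases below, the integral that defines the operator converges absolutely (for every $x\in\mathbb{R}_*$ in a), for almost every $x\in\mathbb{R}$ in b), c), d)), and it defines a linear operator between the indicated spaces. The operators a) $\mathcal{L}_\lambda: C_b(\mathbb{R}_*)\cap C^1(\mathbb{R}_*)\to C(\mathbb{R}_*)$, b) $\mathcal{L}_\lambda: H^1(\mathbb{R}_*)\to L^1_{loc}(\mathbb{R})\cap L^2_{loc}(\overline{\mathbb{R}}\setminus\{0\})$, c) $\mathcal{L}_{\lambda/2}: H^1(\mathbb{R}_*)\to L^2(\mathbb{R})$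 are continuous, and the operator d) $\mathcal{L}_\lambda: L^1(\mathbb{R})\cap(BV(\mathbb{R}))_{w-\star}\to L^1(\mathbb{R})$ is sequentially continuous. (ii) For every $v\in H^1(\mathbb{R}_*)$, the functions $\mathcal{L}_\lambda[v]$ and $\xi\mapsto|\xi|^\lambda\mathcal{F}(v)(\xi)$ define tempered distributions, and $$\mathcal{L}_\lambda[v]=\mathcal{F}^{-1}\big(\xi\mapsto|\xi|^\lambda\mathcal{F}(v)(\xi)\big)\quad\text{in }\mathcal{S}'(\mathbb{R}).$$ (iii) For all $v,w\in H^1(\mathbb{R}_*)$, the three integrands below are integrable and $$\int_{\mathbb{R}}\mathcal{L}_\lambda[v]\,w=\int_{\mathbb{R}}v\,\mathcal{L}_\lambda[w]=\int_{\mathbb{R}}\mathcal{L}_{\lambda/2}[v]\,\mathcal{L}_{\lambda/2}[w].$$ (iv) If $v\in H^1(\mathbb{R}_*)$ is odd (resp. even), then $\mathcal{L}_\lambda[v]$ is odd (resp. even), in the almost everywhere sense. (v) Let $v\in C_b(\mathbb{R}_*)\cap C^1(\mathbb{R}_*)$ be odd and not identically zero, and let $x_*>0$. If $v(x_*)=\max_{(0,+\infty)}v$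 and $v(x_*)\ge0$, then $\mathcal{L}_\lambda[v](x_*)>0$. If $v(x_*)=\min_{(0,+\infty)}v$ and $v(x_*)\le0$, then $\mathcal{L}_\lambda[v](x_*)<0$. -/

import Mathlib

open MeasureTheory Set Filter Topology
open scoped ContDiff SchwartzMap FourierTransform BoundedContinuousFunction ZeroAtInfty

noncomputable section

/-! ### The operator -/

/-- The constant `G_s = s Γ((1+s)/2) / (2 π^(1/2+s) Γ(1-s/2))`. -/
def levyConst (s : ℝ) : ℝ :=
  s * Real.Gamma ((1 + s) / 2) / (2 * Real.pi ^ (1 / 2 + s) * Real.Gamma (1 - s / 2))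

/-- The integrand `z ↦ (v(x+z) - v(x)) / |z|^(1+s)`. -/
def levyIntegrand (s : ℝ) (v : ℝ → ℝ) (x z : ℝ) : ℝ :=
  (v (x + z) - v x) / |z| ^ (1 + s)

/-- The integral defining the operator at `x` converges absolutely. -/
def LevyConvergesAt (s : ℝ) (v : ℝ → ℝ) (x : ℝ) : Prop :=
  Integrable (levyIntegrand s v x) volume

/-- `L_s[v](x) = - G_s ∫ (v(x+z) - v(x)) / |z|^(1+s) dz`. -/
def levyOp (s : ℝ) (v : ℝ → ℝ) (x : ℝ) : ℝ :=
  -levyConst s * ∫ z, levyIntegrand s v x z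

/-! ### The punctured line and `C_b(ℝ∖{0}) ∩ C¹(ℝ∖{0})` -/

/-- The punctured line `ℝ∖{0}`. -/
abbrev Rstar : Type := ({0}ᶜ : Set ℝ)

/-- Extension by zero at the origin. -/
def extendZero (v : Rstar → ℝ) : ℝ → ℝ := Function.extend Subtype.val v 0

theorem extendZero_add (v w : Rstar → ℝ) :
    extendZero (v + w) = extendZero v + extendZero w := by
  simpa [extendZero] using Function.extend_add (Subtype.val : Rstar → ℝ) v w 0 0

theorem extendZero_smul (c : ℝ) (v : Rstar → ℝ) :
    extendZero (c • v) = c • extendZero v := by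
  simpa [extendZero] using Function.extend_smul c (Subtype.val : Rstar → ℝ) v 0

theorem extendZero_zero : extendZero 0 = 0 := by
  simpa using extendZero_smul 0 0

/-- `C_b(ℝ∖{0}) ∩ C¹(ℝ∖{0})`, as the space of pairs `(v, v')` with `v` bounded and continuous,
differentiable at each point of `ℝ∖{0}` with derivative `v'`, and `v'` continuous.
The first factor carries the topology of uniform convergence on `ℝ∖{0}`, the second one that of
uniform convergence on the compact subsets of `ℝ∖{0}`, so that the subspace topology is the
usual topology of the intersection. -/
def CbC1 : Submodule ℝ ((Rstar →ᵇ ℝ) × C(Rstar, ℝ)) where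
  carrier := {p | ∀ x : Rstar, HasDerivAt (extendZero p.1) (p.2 x) x}
  add_mem' := by
    intro p q hp hq x
    have h := (hp x).add (hq x)
    rw [← extendZero_add] at h
    exact h
  zero_mem' := by
    intro x
    have h : HasDerivAt (extendZero 0) 0 (x : ℝ) := by
      rw [extendZero_zero]; exact hasDerivAt_const _ _
    exact h
  smul_mem' := by
    intro c p hp x
    have h := (hp x).const_smul c
    rw [← extendZero_smul] at h
    exact h

/-- The function on `ℝ` (zero at the origin) underlying an element of the space. -/
def fnCbC1 (v : CbC1) : ℝ → ℝ := extendZero v.1.1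

/-! ### `H¹(ℝ∖{0})` -/

theorem integrable_Lp_mul {p : ENNReal} (hp : 1 ≤ p) (f : Lp ℝ p (volume : Measure ℝ))
    {φ : ℝ → ℝ} (hφ : Continuous φ) (hc : HasCompactSupport φ) :
    Integrable (fun x => f x * φ x) volume := by
  have h := ((Lp.memLp f).locallyIntegrable hp).integrable_smul_left_of_hasCompactSupport hφ hc
  refine h.congr (Eventually.of_forall fun x => ?_)
  simp [mul_comm]

/-- `g` is the weak derivative of `v` on `ℝ∖{0}`, i.e. against test functions in
`C_c^∞(ℝ∖{0})`. -/
def IsWeakDerivRstar (v g : ℝ → ℝ) : Prop :=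
  ∀ φ : ℝ → ℝ, ContDiff ℝ ∞ φ → HasCompactSupport φ → tsupport φ ⊆ {0}ᶜ →
    ∫ x, v x * deriv φ x = -∫ x, g x * φ x

/-- `H¹(ℝ∖{0})`, as the space of pairs `(v, v')` of `L²` functions such that `v'` is the weak
derivative of `v` on `ℝ∖{0}`. The norm is `(‖v‖² + ‖v'‖²)^(1/2)`, with `L²` norms. -/
def H1Rstar : Submodule ℝ
    (WithLp 2 (Lp ℝ 2 (volume : Measure ℝ) × Lp ℝ 2 (volume : Measure ℝ))) where
  carrier := {p | IsWeakDerivRstar p.fst p.snd}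
  add_mem' := by
    intro p q hp hq φ h1 h2 h3
    have hd : Continuous (deriv φ) := h1.continuous_deriv (by simp)
    have e1 : (fun x => (p + q).fst x * deriv φ x) =ᵐ[volume]
        fun x => p.fst x * deriv φ x + q.fst x * deriv φ x := by
      filter_upwards [Lp.coeFn_add p.fst q.fst] with x hx
      have hx' : (p + q).fst x = p.fst x + q.fst x := hx
      rw [hx', add_mul]
    have e2 : (fun x => (p + q).snd x * φ x) =ᵐ[volume]
        fun x => p.snd x * φ x + q.snd x * φ x := by
      filter_upwards [Lp.coeFn_add p.snd q.snd] with x hx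
      have hx' : (p + q).snd x = p.snd x + q.snd x := hx
      rw [hx', add_mul]
    rw [integral_congr_ae e1, integral_congr_ae e2,
      integral_add (integrable_Lp_mul one_le_two _ hd h2.deriv)
        (integrable_Lp_mul one_le_two _ hd h2.deriv),
      integral_add (integrable_Lp_mul one_le_two _ h1.continuous h2)
        (integrable_Lp_mul one_le_two _ h1.continuous h2), hp φ h1 h2 h3, hq φ h1 h2 h3]
    ring
  zero_mem' := by
    intro φ h1 h2 h3
    have e : ((0 : Lp ℝ 2 (volume : Measure ℝ)) : ℝ → ℝ) =ᵐ[volume] 0 := Lp.coeFn_zero _ _ _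
    have e1 : (fun x => (0 : Lp ℝ 2 (volume : Measure ℝ)) x * deriv φ x) =ᵐ[volume]
        fun _ => 0 := by
      filter_upwards [e] with x hx
      rw [hx, Pi.zero_apply, zero_mul]
    have e2 : (fun x => (0 : Lp ℝ 2 (volume : Measure ℝ)) x * φ x) =ᵐ[volume]
        fun _ => 0 := by
      filter_upwards [e] with x hx
      rw [hx, Pi.zero_apply, zero_mul]
    have e3 := integral_congr_ae e1
    have e4 := integral_congr_ae e2
    simp only [integral_zero] at e3 e4
    change ∫ x, (0 : Lp ℝ 2 (volume : Measure ℝ)) x * deriv φ x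
      = -∫ x, (0 : Lp ℝ 2 (volume : Measure ℝ)) x * φ x
    rw [e3, e4, neg_zero]
  smul_mem' := by
    intro c p hp φ h1 h2 h3
    have e1 : (fun x => (c • p).fst x * deriv φ x) =ᵐ[volume]
        fun x => c * (p.fst x * deriv φ x) := by
      filter_upwards [Lp.coeFn_smul c p.fst] with x hx
      have hx' : (c • p).fst x = c * p.fst x := hx
      rw [hx', mul_assoc]
    have e2 : (fun x => (c • p).snd x * φ x) =ᵐ[volume]
        fun x => c * (p.snd x * φ x) := by
      filter_upwards [Lp.coeFn_smul c p.snd] with x hx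
      have hx' : (c • p).snd x = c * p.snd x := hx
      rw [hx', mul_assoc]
    rw [integral_congr_ae e1, integral_congr_ae e2, integral_const_mul, integral_const_mul,
      hp φ h1 h2 h3]
    ring

/-- The function of class `L²(ℝ)` underlying an element of `H¹(ℝ∖{0})`. -/
def toL2H1 (v : H1Rstar) : Lp ℝ 2 (volume : Measure ℝ) := v.1.fst

/-- A (measurable) representative of an element of `H¹(ℝ∖{0})`. -/
def fnH1 (v : H1Rstar) : ℝ → ℝ := toL2H1 v

/-- An element of `H¹(ℝ∖{0})` as a complex valued function of class `L²(ℝ)`. -/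
def toL2CH1 (v : H1Rstar) : Lp ℂ 2 (volume : Measure ℝ) :=
  Complex.ofRealCLM.compLp (toL2H1 v)

/-! ### `L¹_loc(ℝ) ∩ L²_loc(ℝ̄∖{0})` -/

/-- `L¹_loc(ℝ) ∩ L²_loc(ℝ̄∖{0})`: classes of functions that belong to `L¹((-R,R))` and to
`L²(ℝ∖[-R,R])` for all `R > 0`. -/
def LocSpace : Submodule ℝ (ℝ →ₘ[(volume : Measure ℝ)] ℝ) where
  carrier := {f | ∀ R : Ioi (0 : ℝ), MemLp f 1 (volume.restrict (Ioo (-R : ℝ) R)) ∧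
    MemLp f 2 (volume.restrict (Icc (-R : ℝ) R)ᶜ)}
  add_mem' := by
    intro f g hf hg R
    have h := AEEqFun.coeFn_add f g
    exact ⟨((hf R).1.add (hg R).1).ae_eq (ae_restrict_of_ae h.symm),
      ((hf R).2.add (hg R).2).ae_eq (ae_restrict_of_ae h.symm)⟩
  zero_mem' := by
    intro R
    have h : ((0 : ℝ →ₘ[(volume : Measure ℝ)] ℝ) : ℝ → ℝ) =ᵐ[volume] 0 := AEEqFun.coeFn_zero
    exact ⟨MemLp.zero.ae_eq (ae_restrict_of_ae h.symm),
      MemLp.zero.ae_eq (ae_restrict_of_ae h.symm)⟩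
  smul_mem' := by
    intro c f hf R
    have h := AEEqFun.coeFn_smul c f
    exact ⟨((hf R).1.const_smul c).ae_eq (ae_restrict_of_ae h.symm),
      ((hf R).2.const_smul c).ae_eq (ae_restrict_of_ae h.symm)⟩

/-- Restriction to `(-R,R)`. -/
def LocSpace.restrictL1 (R : Ioi (0 : ℝ)) (f : LocSpace) :
    Lp ℝ 1 (volume.restrict (Ioo (-R : ℝ) R)) :=
  (f.2 R).1.toLp

/-- Restriction to `ℝ∖[-R,R]`. -/
def LocSpace.restrictL2 (R : Ioi (0 : ℝ)) (f : LocSpace) :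
    Lp ℝ 2 (volume.restrict (Icc (-R : ℝ) R)ᶜ) :=
  (f.2 R).2.toLp

/-- The usual (Fréchet) topology, given by the semi-norms of `L¹((-R,R))` and
`L²(ℝ∖[-R,R])`, `R > 0`. -/
instance LocSpace.instTopologicalSpace : TopologicalSpace LocSpace :=
  ⨅ R : Ioi (0 : ℝ), (TopologicalSpace.induced (LocSpace.restrictL1 R) inferInstance ⊓
    TopologicalSpace.induced (LocSpace.restrictL2 R) inferInstance)

/-! ### `L¹(ℝ) ∩ BV(ℝ)` with the weak-⋆ topology of `BV` -/

/-- The functional `m ∈ (C₀(ℝ))'` is the distributional derivative of `v` on `ℝ`. -/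
def IsMeasureDeriv (v : ℝ → ℝ) (m : WeakDual ℝ C₀(ℝ, ℝ)) : Prop :=
  ∀ φ : C₀(ℝ, ℝ), ContDiff ℝ ∞ φ → HasCompactSupport φ →
    m φ = -∫ x, v x * deriv φ x

/-- `L¹(ℝ) ∩ BV(ℝ)`, as the space of pairs `(v, ∂ₓv)` with `v ∈ L¹(ℝ)` and distributional
derivative `∂ₓv ∈ (C₀(ℝ))'`. The first factor carries the norm topology and the second one the
weak-⋆ topology, so that the subspace topology is the smallest one for which `v ↦ v` into
`L¹(ℝ)` and `v ↦ ∂ₓv` into `(C₀(ℝ))'` weak-⋆ are continuous. -/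
def L1BV : Submodule ℝ (Lp ℝ 1 (volume : Measure ℝ) × WeakDual ℝ C₀(ℝ, ℝ)) where
  carrier := {p | IsMeasureDeriv p.1 p.2}
  add_mem' := by
    intro p q hp hq φ h1 h2
    have hd : Continuous (deriv φ) := h1.continuous_deriv (by simp)
    have e1 : (fun x => (p + q).1 x * deriv φ x) =ᵐ[volume]
        fun x => p.1 x * deriv φ x + q.1 x * deriv φ x := by
      filter_upwards [Lp.coeFn_add p.1 q.1] with x hx
      have hx' : (p + q).1 x = p.1 x + q.1 x := hx
      rw [hx', add_mul]
    have e2 : (p + q).2 φ = p.2 φ + q.2 φ := rfl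
    rw [integral_congr_ae e1, e2, integral_add (integrable_Lp_mul le_rfl _ hd h2.deriv)
        (integrable_Lp_mul le_rfl _ hd h2.deriv), hp φ h1 h2, hq φ h1 h2]
    ring
  zero_mem' := by
    intro φ h1 h2
    have e : ((0 : Lp ℝ 1 (volume : Measure ℝ)) : ℝ → ℝ) =ᵐ[volume] 0 := Lp.coeFn_zero _ _ _
    have e1 : (fun x => (0 : Lp ℝ 1 (volume : Measure ℝ)) x * deriv φ x) =ᵐ[volume]
        fun _ => 0 := by
      filter_upwards [e] with x hx
      rw [hx, Pi.zero_apply, zero_mul]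
    have e3 := integral_congr_ae e1
    simp only [integral_zero] at e3
    change (0 : ℝ) = -∫ x, (0 : Lp ℝ 1 (volume : Measure ℝ)) x * deriv φ x
    rw [e3, neg_zero]
  smul_mem' := by
    intro c p hp φ h1 h2
    have e1 : (fun x => (c • p).1 x * deriv φ x) =ᵐ[volume]
        fun x => c * (p.1 x * deriv φ x) := by
      filter_upwards [Lp.coeFn_smul c p.1] with x hx
      have hx' : (c • p).1 x = c * p.1 x := hx
      rw [hx', mul_assoc]
    have e2 : (c • p).2 φ = c * p.2 φ := rfl
    rw [integral_congr_ae e1, e2, integral_const_mul, hp φ h1 h2]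
    ring

/-- A (measurable) representative of an element of `L¹(ℝ) ∩ BV(ℝ)`. -/
def fnL1BV (v : L1BV) : ℝ → ℝ := v.1.1

/-! ### Tempered distributions given by functions -/

/-- The tempered distribution `T` is the function `f`. -/
def IsTemperedFunction (T : 𝓢'(ℝ, ℂ)) (f : ℝ → ℂ) : Prop :=
  ∀ φ : 𝓢(ℝ, ℂ), Integrable (fun x => φ x * f x) volume ∧ T φ = ∫ x, φ x * f x

end

/-! ### The Lévy kernel -/

/-! The kernel `|z|^(-1-s)` is integrable at infinity, and at the origin it is tamed by any factor
`|z|^q` with `q > s`. Hence everything in (i) rests on a modulus of continuity: if the `L^p` norm of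
`v(· + z) - v` is at most `H(z)` and `H(z)/|z|^(1+s)` is integrable, Minkowski's integral inequality
gives both almost everywhere absolute convergence and an `L^p` bound for the operator
(`levyConvergesAt_and_eLpNorm_levyOp_le`).

A function of class H¹ on the punctured line is the primitive of its weak derivative plus a multiple
of the Heaviside function. Translating the primitive costs `|z|` in L². Translating the jump
produces the indicator of an interval of length `|z|` next to the origin: it costs `|z|^(1/2)` in
L², `|z|` in L¹, and nothing away from the origin once `|z|` is small. The exponent `1/2 > s/2`
gives (c), and the exponent `1 > s`, in L¹ near the origin and in L² away from it, gives (b). For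
(d) the modulus in L¹ is the minimum of `|z|` times the mass of the derivative and of twice the L¹
norm. A weak-⋆ convergent sequence has bounded masses by Banach-Steinhaus, so dominated convergence
concludes. Case (a) is dominated convergence with a bound that is locally uniform in the function
and the point.

For (ii) and (iii), the constant is the one for which `levyConst s * ∫ (1 - cos(2πzξ))/|z|^(1+s) dz
= |ξ|^s` (`levyConst_mul_integral_one_sub_cos`). Symmetrizing the double integral of `conj b(x)
(v(x+z) - v(x))/|z|^(1+s)` turns it into an integral of products of differences. Plancherel for each
`z` produces the factor `2(1 - cos(2πzξ))`, and Fubini gives the multiplier `|ξ|^s`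
(`integral_conj_mul_levyOp`). With `b` the conjugate of the transform of a Schwartz function this is
(ii). With `b = w`, which is bounded, it is (iii), after the splitting `|ξ|^s = |ξ|^(s/2)
|ξ|^(s/2)`.

Parity is the substitution `z ↦ -z`. For (v) the integral is folded onto the positive half-line,
where oddness pairs the kernel at `y - x₀` with the smaller one at `y + x₀` and makes the integrand
nonnegative, positive on a nonempty open set up to the point `x₀`. -/

theorem MeasureTheory.IntegrableOn.integrable_comp_abs {f : ℝ → ℝ} (hf : IntegrableOn f (Ioi 0)) :
    Integrable (fun x => f |x|) := by
  have h1 : IntegrableOn (fun x => f |x|) (Ioi 0) :=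
    hf.congr_fun (fun x hx => by rw [abs_of_pos hx]) measurableSet_Ioi
  have h2 : IntegrableOn (fun x => f |x|) (Iic 0) := by
    rw [← Measure.map_neg_eq_self (volume : Measure ℝ)]
    let m : MeasurableEmbedding fun x : ℝ => -x := (Homeomorph.neg ℝ).measurableEmbedding
    rw [m.integrableOn_map_iff]
    simp_rw [Function.comp_def, abs_neg, neg_preimage, neg_Iic, neg_zero]
    exact Iff.mpr integrableOn_Ici_iff_integrableOn_Ioi h1
  have h3 := h2.union h1
  rwa [Iic_union_Ioi, integrableOn_univ] at h3

/-- Near the origin the exponent is `q - 1 - s > -1`, and at infinity it is `-1 - s < -1`. The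
numerator is the typical modulus of continuity; it serves with `q = 1/2`, `1` and `2`. -/
theorem integrable_min_rpow_div {s q : ℝ} (hs : 0 < s) (hq : s < q) :
    Integrable (fun z : ℝ => min (|z| ^ q) 1 / |z| ^ (1 + s)) := by
  have key : IntegrableOn (fun z : ℝ => min (z ^ q) 1 / z ^ (1 + s)) (Ioi 0) := by
    rw [← Ioc_union_Ioi_eq_Ioi (zero_le_one' ℝ)]
    refine IntegrableOn.union ?_ ?_
    · have h : IntegrableOn (fun z : ℝ => z ^ (q - (1 + s))) (Ioc 0 1) := by
        have := intervalIntegral.intervalIntegrable_rpow' (a := 0) (b := 1) (r := q - (1 + s))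
          (by linarith)
        rwa [intervalIntegrable_iff_integrableOn_Ioc_of_le zero_le_one] at this
      refine h.congr_fun (fun z hz => ?_) measurableSet_Ioc
      have : z ^ q ≤ 1 := Real.rpow_le_one hz.1.le hz.2 (hs.trans hq).le
      simp only [min_eq_left this, Real.rpow_sub hz.1]
    · have h : IntegrableOn (fun z : ℝ => z ^ (-(1 + s))) (Ioi 1) :=
        integrableOn_Ioi_rpow_of_lt (by linarith) zero_lt_one
      refine h.congr_fun (fun z hz => ?_) measurableSet_Ioi
      have hz' : (1 : ℝ) < z := hz
      have : 1 ≤ z ^ q := Real.one_le_rpow hz'.le (hs.trans hq).le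
      simp only [min_eq_right this, Real.rpow_neg (zero_le_one.trans hz'.le), one_div]
  exact key.integrable_comp_abs

theorem levyConst_pos {s : ℝ} (hs0 : 0 < s) (hs1 : s < 2) : 0 < levyConst s := by
  unfold levyConst
  have h1 := Real.Gamma_pos_of_pos (s := (1 + s) / 2) (by linarith)
  have h2 := Real.Gamma_pos_of_pos (s := 1 - s / 2) (by linarith)
  have := Real.pi_pos
  positivity

theorem one_sub_cos_le (t : ℝ) : 1 - Real.cos t ≤ min (t ^ 2 / 2) 2 :=
  le_min (by linarith [Real.one_sub_sq_div_two_le_cos (x := t)])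
    (by linarith [Real.neg_one_le_cos t])

/-- The bound separates the variables: an integrable weight in `z` times a polynomial in `ξ`, so
that a Gaussian in `ξ` makes the product integrable on the plane. -/
theorem one_sub_cos_mul_le (z ξ : ℝ) :
    1 - Real.cos (2 * Real.pi * z * ξ) ≤
      min (|z| ^ (2 : ℝ)) 1 * (2 * Real.pi ^ 2 * ξ ^ 2 + 2) := by
  have h := one_sub_cos_le (2 * Real.pi * z * ξ)
  have hr : |z| ^ (2 : ℝ) = z ^ 2 := by
    rw [← Nat.cast_ofNat, Real.rpow_natCast, sq_abs]
  rw [hr]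
  have h1 := h.trans (min_le_left _ _)
  have h2 := h.trans (min_le_right _ _)
  rcases le_total (z ^ 2) 1 with hz | hz
  · rw [min_eq_left hz]
    nlinarith [sq_nonneg z]
  · rw [min_eq_right hz]
    nlinarith [sq_nonneg (Real.pi * ξ)]

theorem integrable_one_sub_cos_div {s : ℝ} (hs0 : 0 < s) (hs1 : s < 2) (ξ : ℝ) :
    Integrable (fun z : ℝ => (1 - Real.cos (2 * Real.pi * z * ξ)) / |z| ^ (1 + s)) := by
  refine ((integrable_min_rpow_div hs0 hs1).mul_const (2 * Real.pi ^ 2 * ξ ^ 2 + 2)).mono'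
    (Measurable.aestronglyMeasurable (by fun_prop)) (Eventually.of_forall fun z => ?_)
  have h0 : 0 ≤ 1 - Real.cos (2 * Real.pi * z * ξ) := by linarith [Real.cos_le_one (2 * Real.pi * z * ξ)]
  rw [Real.norm_of_nonneg (by positivity), div_mul_eq_mul_div]
  gcongr
  exact one_sub_cos_mul_le z ξ

/-- In this normalization the Gaussian `exp(-πξ²)` is its own Fourier transform; only the real part
is kept. -/
theorem integral_gaussian_mul_cos (z : ℝ) :
    ∫ ξ : ℝ, Real.exp (-Real.pi * ξ ^ 2) * Real.cos (2 * Real.pi * z * ξ) =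
      Real.exp (-Real.pi * z ^ 2) := by
  have h := fourierIntegral_gaussian (b := Real.pi) (by simpa using Real.pi_pos)
    (t := 2 * Real.pi * z)
  have h1 : (Real.pi : ℂ) / Real.pi = 1 := div_self (by exact_mod_cast Real.pi_ne_zero)
  rw [h1, Complex.one_cpow, one_mul] at h
  have h2 : -(2 * (Real.pi : ℂ) * z) ^ 2 / (4 * Real.pi) = ((-Real.pi * z ^ 2 : ℝ) : ℂ) := by
    push_cast
    field_simp
    ring
  rw [h2, ← Complex.ofReal_exp] at h
  have hre := congrArg Complex.re h
  rw [Complex.ofReal_re] at hre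
  rw [← hre]
  have hint : Integrable fun x : ℝ => Complex.exp (Complex.I * (2 * Real.pi * z) * x) *
      Complex.exp (-Real.pi * x ^ 2) := by
    have := integrable_cexp_quadratic (b := Real.pi) (by simpa using Real.pi_pos)
      (Complex.I * (2 * Real.pi * z)) 0
    refine this.congr (Eventually.of_forall fun x => ?_)
    simp only [← Complex.exp_add]
    congr 1
    ring
  have hr := integral_re hint
  simp only [RCLike.re_eq_complex_re] at hr
  rw [← hr]
  congr 1
  ext x
  have e1 : Complex.exp (-(Real.pi : ℂ) * (x : ℂ) ^ 2) = ((Real.exp (-Real.pi * x ^ 2) : ℝ) : ℂ) := by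
    push_cast
    rfl
  have e2 : Complex.I * (2 * (Real.pi : ℂ) * z) * x = ((2 * Real.pi * z * x : ℝ) : ℂ) * Complex.I := by
    push_cast
    ring
  rw [e1, e2, Complex.re_mul_ofReal, Complex.exp_ofReal_mul_I_re, mul_comm]

theorem integrable_exp_neg_pi_sq : Integrable fun ξ : ℝ => Real.exp (-Real.pi * ξ ^ 2) :=
  integrable_exp_neg_mul_sq Real.pi_pos

theorem integrable_gaussian_one_sub_cos {s : ℝ} (hs0 : 0 < s) (hs1 : s < 2) :
    Integrable (fun p : ℝ × ℝ => Real.exp (-Real.pi * p.2 ^ 2) *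
      ((1 - Real.cos (2 * Real.pi * p.1 * p.2)) / |p.1| ^ (1 + s))) (volume.prod volume) := by
  have hg : Integrable fun ξ : ℝ => (2 * Real.pi ^ 2 * ξ ^ 2 + 2) * Real.exp (-Real.pi * ξ ^ 2) := by
    have h1 := (integrable_rpow_mul_exp_neg_mul_sq Real.pi_pos
      (s := 2) (by norm_num)).const_mul (2 * Real.pi ^ 2)
    have h2 := integrable_exp_neg_pi_sq.const_mul 2
    refine (h1.add h2).congr (Eventually.of_forall fun ξ => ?_)
    simp only [Pi.add_apply, Real.rpow_two]
    ring
  refine ((integrable_min_rpow_div hs0 hs1).mul_prod hg).mono' (by fun_prop)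
    (Eventually.of_forall fun p => ?_)
  obtain ⟨z, ξ⟩ := p
  have h0 : 0 ≤ 1 - Real.cos (2 * Real.pi * z * ξ) := by
    linarith [Real.cos_le_one (2 * Real.pi * z * ξ)]
  simp only
  rw [Real.norm_of_nonneg (by positivity)]
  have h1 := one_sub_cos_mul_le z ξ
  calc _ ≤ Real.exp (-Real.pi * ξ ^ 2) *
        ((min (|z| ^ (2 : ℝ)) 1 * (2 * Real.pi ^ 2 * ξ ^ 2 + 2)) / |z| ^ (1 + s)) := by gcongr
    _ = _ := by ring

/-- On the half-line, integration by parts with the antiderivative `-z^(-s)/s` leaves a Gaussian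
moment, hence a Gamma value. The boundary terms vanish because `1 - exp(-πz²)` is `O(z²)` at the
origin, with `s < 2`, and bounded at infinity. -/
theorem integral_one_sub_gaussian_div {s : ℝ} (hs0 : 0 < s) (hs1 : s < 2) :
    ∫ z : ℝ, (1 - Real.exp (-Real.pi * z ^ 2)) / |z| ^ (1 + s) =
      2 / s * Real.pi ^ (s / 2) * Real.Gamma (1 - s / 2) := by
  have hpi := Real.pi_pos
  have e1 : ∫ z : ℝ, (1 - Real.exp (-Real.pi * z ^ 2)) / |z| ^ (1 + s) =
      2 * ∫ z in Ioi (0 : ℝ), (1 - Real.exp (-Real.pi * z ^ 2)) / z ^ (1 + s) := by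
    rw [← integral_comp_abs (f := fun z => (1 - Real.exp (-Real.pi * z ^ 2)) / z ^ (1 + s))]
    simp
  have hexp : ∀ z : ℝ, 1 - Real.exp (-Real.pi * z ^ 2) ≤ Real.pi * z ^ 2 := fun z => by
    have := Real.add_one_le_exp (-Real.pi * z ^ 2)
    linarith
  have hexp0 : ∀ z : ℝ, 0 ≤ 1 - Real.exp (-Real.pi * z ^ 2) := fun z => by
    have : Real.exp (-Real.pi * z ^ 2) ≤ 1 := Real.exp_le_one_iff.2 (by nlinarith [sq_nonneg z])
    linarith
  -- integration by parts
  have hparts : ∫ z in Ioi (0 : ℝ), (1 - Real.exp (-Real.pi * z ^ 2)) * z ^ (-(1 + s)) =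
      2 * Real.pi / s * ∫ z in Ioi (0 : ℝ), z ^ (1 - s) * Real.exp (-Real.pi * z ^ 2) := by
    have hu : ∀ z ∈ Ioi (0 : ℝ), HasDerivAt (fun z : ℝ => 1 - Real.exp (-Real.pi * z ^ 2))
        (2 * Real.pi * z * Real.exp (-Real.pi * z ^ 2)) z := by
      intro z _
      have := (((hasDerivAt_pow 2 z).const_mul (-Real.pi)).exp).const_sub 1
      convert! this using 1
      norm_num
      ring
    have hv : ∀ z ∈ Ioi (0 : ℝ), HasDerivAt (fun z : ℝ => -(1 / s) * z ^ (-s))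
        (z ^ (-(1 + s))) z := by
      intro z hz
      have := (Real.hasDerivAt_rpow_const (x := z) (p := -s) (Or.inl (ne_of_gt hz))).const_mul
        (-(1 / s))
      convert! this using 1
      rw [show -s - 1 = -(1 + s) by ring]
      field_simp
    have hint2 : IntegrableOn (fun z : ℝ => z ^ (1 - s) * Real.exp (-Real.pi * z ^ 2)) (Ioi 0) :=
      integrableOn_rpow_mul_exp_neg_mul_sq hpi (by linarith)
    have hmul : ∀ z ∈ Ioi (0 : ℝ), 2 * Real.pi * z * Real.exp (-Real.pi * z ^ 2) *
        (-(1 / s) * z ^ (-s)) = -(2 * Real.pi / s) *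
          (z ^ (1 - s) * Real.exp (-Real.pi * z ^ 2)) := by
      intro z hz
      rw [Real.rpow_sub hz, Real.rpow_one, Real.rpow_neg (le_of_lt hz)]
      field_simp
    have huv' : IntegrableOn ((fun z : ℝ => 1 - Real.exp (-Real.pi * z ^ 2)) *
        fun z => z ^ (-(1 + s))) (Ioi 0) := by
      have h := (integrable_min_rpow_div hs0 hs1).const_mul (Real.pi + 1)
      refine (h.integrableOn (s := Ioi 0)).mono' (by
        refine Measurable.aestronglyMeasurable ?_
        fun_prop) ?_
      filter_upwards [self_mem_ae_restrict measurableSet_Ioi] with z hz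
      have hz' : (0 : ℝ) < z := hz
      simp only [Pi.mul_apply]
      rw [Real.norm_of_nonneg (mul_nonneg (hexp0 z) (by positivity)), Real.rpow_neg hz'.le,
        ← div_eq_mul_inv, abs_of_pos hz', ← mul_div_assoc]
      gcongr
      rw [Real.rpow_two]
      have h1 : 1 - Real.exp (-Real.pi * z ^ 2) ≤ 1 := by linarith [Real.exp_pos (-Real.pi * z ^ 2)]
      rcases le_total (z ^ 2) 1 with hz | hz
      · rw [min_eq_left hz]
        nlinarith [hexp z, sq_nonneg z]
      · rw [min_eq_right hz]
        linarith
    have hu'v : IntegrableOn ((fun z : ℝ => 2 * Real.pi * z * Real.exp (-Real.pi * z ^ 2)) *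
        fun z => -(1 / s) * z ^ (-s)) (Ioi 0) :=
      IntegrableOn.congr_fun (hint2.const_mul (-(2 * Real.pi / s)))
        (fun z hz => (hmul z hz).symm) measurableSet_Ioi
    have hlim : ∀ z : ℝ, 0 < z → ‖(1 - Real.exp (-Real.pi * z ^ 2)) * (-(1 / s) * z ^ (-s))‖ ≤
        1 / s * (Real.pi * z ^ (2 - s)) := by
      intro z hz
      have : z ^ (2 - s) = z ^ 2 * z ^ (-s) := by
        rw [sub_eq_add_neg, Real.rpow_add hz, Real.rpow_two]
      rw [norm_mul, norm_mul, Real.norm_of_nonneg (hexp0 z), norm_neg,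
        Real.norm_of_nonneg (by positivity), Real.norm_of_nonneg (by positivity), this]
      have := mul_le_mul_of_nonneg_right (hexp z) (by positivity : 0 ≤ 1 / s * z ^ (-s))
      nlinarith
    have ha : Tendsto ((fun z : ℝ => 1 - Real.exp (-Real.pi * z ^ 2)) *
        fun z => -(1 / s) * z ^ (-s)) (𝓝[>] 0) (𝓝 0) := by
      have h : Tendsto (fun z : ℝ => 1 / s * (Real.pi * z ^ (2 - s))) (𝓝[>] 0) (𝓝 0) := by
        have hc : ContinuousAt (fun z : ℝ => 1 / s * (Real.pi * z ^ (2 - s))) 0 := by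
          have := Real.continuousAt_rpow_const 0 (2 - s) (Or.inr (by linarith))
          fun_prop
        have := hc.tendsto.mono_left (nhdsWithin_le_nhds (s := Ioi 0))
        simpa [Real.zero_rpow (by linarith : 2 - s ≠ 0)] using this
      refine squeeze_zero_norm' ?_ h
      filter_upwards [self_mem_nhdsWithin] with z hz
      exact hlim z hz
    have hb : Tendsto ((fun z : ℝ => 1 - Real.exp (-Real.pi * z ^ 2)) *
        fun z => -(1 / s) * z ^ (-s)) atTop (𝓝 0) := by
      have h : Tendsto (fun z : ℝ => 1 / s * z ^ (-s)) atTop (𝓝 0) := by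
        simpa using (tendsto_rpow_neg_atTop hs0).const_mul (1 / s)
      refine squeeze_zero_norm' ?_ h
      filter_upwards [eventually_gt_atTop 0] with z hz
      simp only [Pi.mul_apply]
      rw [norm_mul, norm_mul, Real.norm_of_nonneg (hexp0 z), norm_neg,
        Real.norm_of_nonneg (by positivity), Real.norm_of_nonneg (by positivity)]
      have h1 : 1 - Real.exp (-Real.pi * z ^ 2) ≤ 1 := by linarith [Real.exp_pos (-Real.pi * z ^ 2)]
      have := mul_le_mul_of_nonneg_right h1 (by positivity : 0 ≤ 1 / s * z ^ (-s))
      linarith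
    have := integral_Ioi_mul_deriv_eq_deriv_mul hu hv huv' hu'v ha hb
    rw [this, setIntegral_congr_fun measurableSet_Ioi hmul, integral_const_mul]
    ring
  have e2 : ∫ z in Ioi (0 : ℝ), (1 - Real.exp (-Real.pi * z ^ 2)) / z ^ (1 + s) =
      ∫ z in Ioi (0 : ℝ), (1 - Real.exp (-Real.pi * z ^ 2)) * z ^ (-(1 + s)) := by
    refine setIntegral_congr_fun measurableSet_Ioi fun z hz => ?_
    simp only [Real.rpow_neg (le_of_lt (mem_Ioi.1 hz)), div_eq_mul_inv]
  have e3 : ∫ z in Ioi (0 : ℝ), z ^ (1 - s) * Real.exp (-Real.pi * z ^ 2) =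
      Real.pi ^ (-(2 - s) / 2) * (1 / 2) * Real.Gamma (1 - s / 2) := by
    have := integral_rpow_mul_exp_neg_mul_rpow (p := 2) (q := 1 - s) (b := Real.pi) two_pos
      (by linarith) hpi
    simp only [Real.rpow_two] at this
    rw [this]
    ring_nf
  rw [e1, e2, hparts, e3]
  have : Real.pi ^ (s / 2) = Real.pi * Real.pi ^ (-(2 - s) / 2) := by
    rw [← Real.rpow_one_add' hpi.le (by linarith)]
    ring_nf
  rw [this]
  field_simp

/-- Rescaling `z` by `ξ` shows that the integral is `C |ξ|^s`. To find `C`, both sides are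
integrated against `exp(-πξ²)`: after exchanging the integrals, one side is
`integral_one_sub_gaussian_div` and the other is `C` times a Gaussian moment. Their quotient is the
inverse of `levyConst s`. -/
theorem levyConst_mul_integral_one_sub_cos {s : ℝ} (hs0 : 0 < s) (hs1 : s < 2) (ξ : ℝ) :
    levyConst s * ∫ z : ℝ, (1 - Real.cos (2 * Real.pi * z * ξ)) / |z| ^ (1 + s) = |ξ| ^ s := by
  have hpi := Real.pi_pos
  set C := ∫ z : ℝ, (1 - Real.cos (2 * Real.pi * z)) / |z| ^ (1 + s) with hC
  have hscale : ∀ ξ : ℝ, ∫ z : ℝ, (1 - Real.cos (2 * Real.pi * z * ξ)) / |z| ^ (1 + s) =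
      |ξ| ^ s * C := by
    intro ξ
    rcases eq_or_ne ξ 0 with rfl | hξ
    · simp [Real.zero_rpow hs0.ne']
    have hξ' : 0 < |ξ| := abs_pos.2 hξ
    have h := Measure.integral_comp_mul_right
      (fun z : ℝ => (1 - Real.cos (2 * Real.pi * z)) / |z| ^ (1 + s)) ξ
    have e : ∀ z : ℝ, (1 - Real.cos (2 * Real.pi * z * ξ)) / |z| ^ (1 + s) =
        |ξ| ^ (1 + s) * ((1 - Real.cos (2 * Real.pi * (z * ξ))) / |z * ξ| ^ (1 + s)) := by
      intro z
      rw [abs_mul, Real.mul_rpow (abs_nonneg _) (abs_nonneg _), mul_assoc (2 * Real.pi)]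
      have : |ξ| ^ (1 + s) ≠ 0 := (Real.rpow_pos_of_pos hξ' _).ne'
      field_simp
    simp_rw [e]
    rw [integral_const_mul, h, smul_eq_mul, ← hC, abs_inv, Real.rpow_add hξ', Real.rpow_one]
    field_simp
  have hfub := integral_integral_swap (f := fun z ξ : ℝ => Real.exp (-Real.pi * ξ ^ 2) *
      ((1 - Real.cos (2 * Real.pi * z * ξ)) / |z| ^ (1 + s)))
      (integrable_gaussian_one_sub_cos hs0 hs1)
  have hl : ∀ z : ℝ, ∫ ξ : ℝ, Real.exp (-Real.pi * ξ ^ 2) *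
      ((1 - Real.cos (2 * Real.pi * z * ξ)) / |z| ^ (1 + s)) =
      (1 - Real.exp (-Real.pi * z ^ 2)) / |z| ^ (1 + s) := by
    intro z
    have hcos : Integrable fun ξ : ℝ => Real.exp (-Real.pi * ξ ^ 2) *
        Real.cos (2 * Real.pi * z * ξ) := by
      refine integrable_exp_neg_pi_sq.mono' (by fun_prop) (Eventually.of_forall fun ξ => ?_)
      rw [norm_mul, Real.norm_of_nonneg (Real.exp_pos _).le, Real.norm_eq_abs]
      exact mul_le_of_le_one_right (Real.exp_pos _).le (Real.abs_cos_le_one _)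
    have : ∀ ξ : ℝ, Real.exp (-Real.pi * ξ ^ 2) *
      ((1 - Real.cos (2 * Real.pi * z * ξ)) / |z| ^ (1 + s)) =
      (Real.exp (-Real.pi * ξ ^ 2) - Real.exp (-Real.pi * ξ ^ 2) *
        Real.cos (2 * Real.pi * z * ξ)) / |z| ^ (1 + s) := fun ξ => by ring
    simp_rw [this]
    rw [integral_div, integral_sub integrable_exp_neg_pi_sq hcos, integral_gaussian_mul_cos,
      integral_gaussian]
    rw [div_self hpi.ne', Real.sqrt_one]
  have hr : ∀ ξ : ℝ, ∫ z : ℝ, Real.exp (-Real.pi * ξ ^ 2) *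
      ((1 - Real.cos (2 * Real.pi * z * ξ)) / |z| ^ (1 + s)) =
      C * (|ξ| ^ s * Real.exp (-Real.pi * |ξ| ^ 2)) := by
    intro ξ
    rw [integral_const_mul, hscale, sq_abs]
    ring
  simp_rw [hl, hr] at hfub
  rw [integral_one_sub_gaussian_div hs0 hs1, integral_const_mul,
    integral_comp_abs (f := fun x => x ^ s * Real.exp (-Real.pi * x ^ 2))] at hfub
  have hG := integral_rpow_mul_exp_neg_mul_rpow (p := 2) (q := s) (b := Real.pi) two_pos
      (by linarith) hpi
  simp only [Real.rpow_two] at hG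
  rw [hG] at hfub
  have hconst : levyConst s * C = 1 := by
    unfold levyConst
    have h1 := Real.Gamma_pos_of_pos (s := (1 + s) / 2) (by linarith)
    have h2 := Real.Gamma_pos_of_pos (s := 1 - s / 2) (by linarith)
    have hp : Real.pi ^ (-(s + 1) / 2) * Real.pi ^ (1 / 2 + s) = Real.pi ^ (s / 2) := by
      rw [← Real.rpow_add hpi]
      ring_nf
    rw [add_comm s 1] at hfub
    rw [add_comm s 1] at hp
    have hA := Real.rpow_pos_of_pos hpi (-(1 + s) / 2)
    have hB := Real.rpow_pos_of_pos hpi (1 / 2 + s)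
    rw [← hp] at hfub
    have hfub' : C * Real.Gamma ((1 + s) / 2) * s =
        2 * Real.pi ^ (1 / 2 + s) * Real.Gamma (1 - s / 2) := by
      have aux : ∀ a b p q : ℝ, 0 < p → 2 / s * (p * q) * b = C * (2 * (p * (1 / 2) * a)) →
          C * a * s = 2 * q * b := by
        intro a b p q hp h
        field_simp at h
        linarith
      exact aux _ _ _ _ hA hfub
    rw [div_mul_eq_mul_div, div_eq_one_iff_eq (by positivity)]
    linarith
  rw [hscale, mul_left_comm, hconst, mul_one]

/-! ### Minkowski's integral inequality and bounds for the operator -/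

/-- Hölder's inequality against the constant function one. -/
theorem lintegral_rpow_le_of_finite {β : Type*} [MeasurableSpace β] {ν : Measure β}
    [IsFiniteMeasure ν] {f : β → ENNReal} (hf : Measurable f) {p : ℝ} (hp : 1 ≤ p) :
    (∫⁻ z, f z ∂ν) ^ p ≤ ν univ ^ (p - 1) * ∫⁻ z, f z ^ p ∂ν := by
  have hp0 : 0 < p := zero_lt_one.trans_le hp
  rcases hp.eq_or_lt with rfl | hp1
  · simp
  have hc : p.HolderConjugate (p / (p - 1)) := Real.HolderConjugate.conjExponent hp1
  have h := ENNReal.lintegral_mul_le_Lp_mul_Lq ν hc hf.aemeasurable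
    (aemeasurable_const (b := (1 : ENNReal)))
  simp only [Pi.mul_apply, mul_one, ENNReal.one_rpow, lintegral_one] at h
  calc (∫⁻ z, f z ∂ν) ^ p
      ≤ ((∫⁻ z, f z ^ p ∂ν) ^ (1 / p) * ν univ ^ (1 / (p / (p - 1)))) ^ p := by gcongr
    _ = ν univ ^ (p - 1) * ∫⁻ z, f z ^ p ∂ν := by
        rw [ENNReal.mul_rpow_of_nonneg _ _ hp0.le, ← ENNReal.rpow_mul, ← ENNReal.rpow_mul,
          one_div_mul_cancel hp0.ne', ENNReal.rpow_one, mul_comm]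
        congr 2
        field_simp

/-- Minkowski's inequality without duality: the inner integral is that of `F/h` for the finite
measure `h dν`. The finite-measure power inequality and Tonelli then reduce the claim to `hb`, which
says that `F/h` has `p`-th moment at most one for each `z`. Division requires `h` to be nonzero and
finite almost everywhere. -/
theorem lintegral_lintegral_rpow_le {α β : Type*} [MeasurableSpace α] [MeasurableSpace β]
    {μ : Measure α} {ν : Measure β} [SFinite μ] [SFinite ν] {F : α → β → ENNReal}
    (hF : Measurable (Function.uncurry F)) {h : β → ENNReal} (hh : Measurable h)
    (hh0 : ∀ᵐ z ∂ν, h z ≠ 0) (hhi : ∫⁻ z, h z ∂ν ≠ ⊤) {p : ℝ} (hp : 1 ≤ p)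
    (hb : ∀ z, ∫⁻ x, F x z ^ p ∂μ ≤ h z ^ p) :
    ∫⁻ x, (∫⁻ z, F x z ∂ν) ^ p ∂μ ≤ (∫⁻ z, h z ∂ν) ^ p := by
  have hp0 : 0 < p := zero_lt_one.trans_le hp
  have hht : ∀ᵐ z ∂ν, h z < ⊤ := ae_lt_top hh hhi
  have huniv : (ν.withDensity h) univ = ∫⁻ z, h z ∂ν := by simp
  have : IsFiniteMeasure (ν.withDensity h) := ⟨by rw [huniv]; exact hhi.lt_top⟩
  have hq : Measurable (Function.uncurry fun x z => F x z / h z) :=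
    hF.div (hh.comp measurable_snd)
  have hFx : ∀ x, Measurable (F x) := fun x => hF.of_uncurry_left
  have hqx : ∀ x, Measurable (fun z => F x z / h z) := fun x => (hFx x).div hh
  have e : ∀ x, ∫⁻ z, F x z ∂ν = ∫⁻ z, F x z / h z ∂(ν.withDensity h) := by
    intro x
    rw [lintegral_withDensity_eq_lintegral_mul _ hh (hqx x)]
    refine lintegral_congr_ae ?_
    filter_upwards [hh0, hht] with z h0 ht
    exact (ENNReal.mul_div_cancel h0 ht.ne).symm
  calc ∫⁻ x, (∫⁻ z, F x z ∂ν) ^ p ∂μ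
      ≤ ∫⁻ x, (ν.withDensity h) univ ^ (p - 1) *
          ∫⁻ z, (F x z / h z) ^ p ∂(ν.withDensity h) ∂μ := by
        gcongr with x
        rw [e x]
        exact lintegral_rpow_le_of_finite (hqx x) hp
    _ = (ν.withDensity h) univ ^ (p - 1) *
          ∫⁻ z, ∫⁻ x, (F x z / h z) ^ p ∂μ ∂(ν.withDensity h) := by
        have hm : Measurable (Function.uncurry fun x z => (F x z / h z) ^ p) := hq.pow_const p
        have hm' : Measurable fun x => ∫⁻ z, (F x z / h z) ^ p ∂(ν.withDensity h) :=
          hm.lintegral_prod_right'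
        rw [lintegral_const_mul _ hm', lintegral_lintegral_swap hm.aemeasurable]
    _ ≤ (ν.withDensity h) univ ^ (p - 1) * ∫⁻ _, 1 ∂(ν.withDensity h) := by
        refine mul_le_mul_right (lintegral_mono_ae ?_) _
        have h0' := (withDensity_absolutelyContinuous ν h).ae_le hh0
        have ht' := (withDensity_absolutelyContinuous ν h).ae_le hht
        filter_upwards [h0', ht'] with z h0 ht
        have hp' : h z ^ p ≠ 0 := by simp [h0, ht.ne, hp0]
        have hpt : h z ^ p ≠ ⊤ := ENNReal.rpow_ne_top_of_nonneg hp0.le ht.ne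
        simp_rw [ENNReal.div_rpow_of_nonneg _ _ hp0.le, div_eq_mul_inv]
        rw [lintegral_mul_const' _ _ (ENNReal.inv_ne_top.2 hp')]
        calc _ ≤ h z ^ p * (h z ^ p)⁻¹ := by gcongr; exact hb z
          _ = 1 := ENNReal.mul_inv_cancel hp' hpt
    _ = (∫⁻ z, h z ∂ν) ^ p := by
        rw [lintegral_one, huniv, mul_comm]
        nth_rewrite 1 [← ENNReal.rpow_one (∫⁻ z, h z ∂ν)]
        rw [← ENNReal.rpow_add_of_nonneg _ _ zero_le_one (by linarith)]
        ring_nf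

theorem measurable_levyIntegrand (s : ℝ) {v : ℝ → ℝ} (hv : Measurable v) :
    Measurable (Function.uncurry (levyIntegrand s v)) := by
  unfold levyIntegrand Function.uncurry
  exact ((hv.comp (measurable_fst.add measurable_snd)).sub (hv.comp measurable_fst)).div
    ((measurable_snd.norm).pow_const _)

theorem stronglyMeasurable_levyOp (s : ℝ) {v : ℝ → ℝ} (hv : Measurable v) :
    StronglyMeasurable (levyOp s v) :=
  ((measurable_levyIntegrand s hv).stronglyMeasurable.integral_prod_right).const_mul _

/-- Minkowski's inequality in `z`, with `H(z)/|z|^(1+s)` as the weight, which is why `H` is positive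
off the origin. Finiteness of the `L^p` norm of the integral of the modulus makes that integral
finite almost everywhere, which is absolute convergence. -/
theorem levyConvergesAt_and_eLpNorm_levyOp_le {s : ℝ} {v : ℝ → ℝ} (hv : Measurable v)
    {μ : Measure ℝ} [SFinite μ] {p : ENNReal} (hp1 : 1 ≤ p) (hp : p ≠ ⊤) {H : ℝ → ℝ}
    (hH : ∀ z, z ≠ 0 → 0 < H z) (hHm : Measurable H)
    (hHi : Integrable fun z => H z / |z| ^ (1 + s))
    (hb : ∀ z, eLpNorm (fun x => v (x + z) - v x) p μ ≤ ENNReal.ofReal (H z)) :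
    (∀ᵐ x ∂μ, LevyConvergesAt s v x) ∧
      eLpNorm (levyOp s v) p μ ≤ ENNReal.ofReal (|levyConst s| * ∫ z, H z / |z| ^ (1 + s)) := by
  have hp0 : p ≠ 0 := (zero_lt_one.trans_le hp1).ne'
  have hpr : 1 ≤ p.toReal := by
    rw [← ENNReal.toReal_one]
    exact ENNReal.toReal_mono hp hp1
  have hpr0 : 0 < p.toReal := zero_lt_one.trans_le hpr
  have hne : ∀ᵐ z : ℝ, z ≠ 0 := by simp [ae_iff]
  set F : ℝ → ℝ → ENNReal := fun x z => ‖levyIntegrand s v x z‖ₑ with hFdef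
  have hF : Measurable (Function.uncurry F) := (measurable_levyIntegrand s hv).enorm
  set h : ℝ → ENNReal := fun z => ENNReal.ofReal (H z / |z| ^ (1 + s)) with hh
  have hhm : Measurable h := by
    refine ENNReal.measurable_ofReal.comp (hHm.div ?_)
    exact (measurable_norm (α := ℝ)).pow_const _
  have hpos : ∀ z, z ≠ 0 → 0 < H z / |z| ^ (1 + s) := fun z hz =>
    div_pos (hH z hz) (Real.rpow_pos_of_pos (abs_pos.2 hz) _)
  have hhint : ∫⁻ z, h z = ENNReal.ofReal (∫ z, H z / |z| ^ (1 + s)) := by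
    rw [ofReal_integral_eq_lintegral_ofReal hHi]
    filter_upwards [hne] with z hz using (hpos z hz).le
  have hbF : ∀ z, ∫⁻ x, F x z ^ p.toReal ∂μ ≤ h z ^ p.toReal := by
    intro z
    rcases eq_or_ne z 0 with rfl | hz
    · simp [F, levyIntegrand, ENNReal.zero_rpow_of_pos hpr0]
    have hk : 0 < |z| ^ (1 + s) := Real.rpow_pos_of_pos (abs_pos.2 hz) _
    have h1 : eLpNorm (fun x => levyIntegrand s v x z) p μ ≤ h z := by
      have : (fun x => levyIntegrand s v x z) =
          (|z| ^ (1 + s))⁻¹ • fun x => v (x + z) - v x := by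
        ext x
        simp [levyIntegrand, div_eq_inv_mul]
      have hz' : h z = ENNReal.ofReal ((|z| ^ (1 + s))⁻¹ * H z) := by simp [hh, div_eq_inv_mul]
      rw [this, eLpNorm_const_smul, hz', ENNReal.ofReal_mul (by positivity),
        Real.enorm_of_nonneg (by positivity)]
      gcongr
      exact hb z
    rw [eLpNorm_eq_lintegral_rpow_enorm_toReal hp0 hp] at h1
    calc _ = ((∫⁻ x, F x z ^ p.toReal ∂μ) ^ (1 / p.toReal)) ^ p.toReal := by
          rw [← ENNReal.rpow_mul, one_div_mul_cancel hpr0.ne', ENNReal.rpow_one]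
      _ ≤ _ := by gcongr
  have hmain := lintegral_lintegral_rpow_le (μ := μ) (ν := volume) hF hhm
    (by filter_upwards [hne] with z hz using (ENNReal.ofReal_pos.2 (hpos z hz)).ne')
    (by rw [hhint]; exact ENNReal.ofReal_ne_top) hpr hbF
  have hNm : Measurable fun x => ∫⁻ z, F x z := hF.lintegral_prod_right'
  constructor
  · have h1 : ∀ᵐ x ∂μ, (∫⁻ z, F x z) ^ p.toReal < ⊤ := by
      refine ae_lt_top (hNm.pow_const _) (hmain.trans_lt ?_).ne
      rw [hhint]
      exact ENNReal.rpow_lt_top_of_nonneg hpr0.le ENNReal.ofReal_ne_top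
    filter_upwards [h1] with x hx
    refine ⟨(measurable_levyIntegrand s hv).of_uncurry_left.aestronglyMeasurable, ?_⟩
    exact (ENNReal.rpow_lt_top_iff_of_pos hpr0).1 hx
  · have hle : ∀ x, ‖levyOp s v x‖ₑ ≤ ENNReal.ofReal |levyConst s| * ∫⁻ z, F x z := by
      intro x
      rw [levyOp, enorm_mul, enorm_neg, Real.enorm_eq_ofReal_abs]
      gcongr
      exact enorm_integral_le_lintegral_enorm _
    rw [eLpNorm_eq_lintegral_rpow_enorm_toReal hp0 hp, ENNReal.ofReal_mul (abs_nonneg _), ← hhint]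
    calc (∫⁻ x, ‖levyOp s v x‖ₑ ^ p.toReal ∂μ) ^ (1 / p.toReal)
        ≤ (∫⁻ x, (ENNReal.ofReal |levyConst s| * ∫⁻ z, F x z) ^ p.toReal ∂μ) ^ (1 / p.toReal) := by
          gcongr with x
          exact hle x
      _ = (ENNReal.ofReal |levyConst s| ^ p.toReal *
            ∫⁻ x, (∫⁻ z, F x z) ^ p.toReal ∂μ) ^ (1 / p.toReal) := by
          simp_rw [ENNReal.mul_rpow_of_nonneg _ _ hpr0.le]
          rw [lintegral_const_mul _ (hNm.pow_const _)]
      _ ≤ (ENNReal.ofReal |levyConst s| ^ p.toReal * (∫⁻ z, h z) ^ p.toReal) ^ (1 / p.toReal) := by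
          gcongr
      _ = _ := by
          rw [← ENNReal.mul_rpow_of_nonneg _ _ hpr0.le, ← ENNReal.rpow_mul,
            mul_one_div_cancel hpr0.ne', ENNReal.rpow_one]

/-! ### Elementary properties of the operator -/

/-- Only almost every `x` is allowed, since the single value `v x` enters the integrand for all `z`.
-/
theorem levyIntegrand_congr_ae {s : ℝ} {v w : ℝ → ℝ} (h : v =ᵐ[volume] w) :
    ∀ᵐ x, levyIntegrand s v x =ᵐ[volume] levyIntegrand s w x := by
  filter_upwards [h] with x hx
  have h2 : ∀ᵐ z, v (x + z) = w (x + z) :=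
    (measurePreserving_add_left volume x).quasiMeasurePreserving.ae h
  filter_upwards [h2] with z hz
  simp only [levyIntegrand, hx, hz]

theorem levyOp_congr_ae {s : ℝ} {v w : ℝ → ℝ} (h : v =ᵐ[volume] w) :
    levyOp s v =ᵐ[volume] levyOp s w := by
  filter_upwards [levyIntegrand_congr_ae (s := s) h] with x hx
  simp only [levyOp, integral_congr_ae hx]

theorem levyConvergesAt_congr_ae {s : ℝ} {v w : ℝ → ℝ} (h : v =ᵐ[volume] w)
    (hv : ∀ᵐ x, LevyConvergesAt s v x) : ∀ᵐ x, LevyConvergesAt s w x := by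
  filter_upwards [levyIntegrand_congr_ae (s := s) h, hv] with x hx h1
  exact h1.congr hx

theorem levyIntegrand_add (s : ℝ) (v w : ℝ → ℝ) (x : ℝ) :
    levyIntegrand s (v + w) x = levyIntegrand s v x + levyIntegrand s w x := by
  ext z
  simp only [levyIntegrand, Pi.add_apply]
  ring

theorem levyIntegrand_smul (s c : ℝ) (v : ℝ → ℝ) (x : ℝ) :
    levyIntegrand s (c • v) x = c • levyIntegrand s v x := by
  ext z
  simp only [levyIntegrand, Pi.smul_apply, smul_eq_mul]
  ring

theorem levyOp_add {s : ℝ} {v w : ℝ → ℝ} {x : ℝ} (hv : LevyConvergesAt s v x)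
    (hw : LevyConvergesAt s w x) : levyOp s (v + w) x = levyOp s v x + levyOp s w x := by
  have := integral_add hv hw
  simp only [levyOp, levyIntegrand_add, Pi.add_apply, this]
  ring

theorem levyOp_smul (s c : ℝ) (v : ℝ → ℝ) (x : ℝ) : levyOp s (c • v) x = c * levyOp s v x := by
  simp only [levyOp, levyIntegrand_smul, Pi.smul_apply, smul_eq_mul, integral_const_mul]
  ring

theorem levyOp_comp_neg (s : ℝ) (v : ℝ → ℝ) (x : ℝ) :
    levyOp s (fun y => v (-y)) x = levyOp s v (-x) := by
  unfold levyOp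
  congr 1
  rw [← integral_neg_eq_self]
  congr 1
  ext z
  simp only [levyIntegrand, abs_neg]
  congr 3
  ring

/-! ### Translates of integrable functions of bounded variation -/

/-- The natural test function is the sign of `f`. Cut off to a ball and mollified, it becomes smooth
with compact support, keeps values in `[-1, 1]` and converges almost everywhere to the cut-off sign.
Dominated convergence gives the bound on the ball, and the balls exhaust the line. -/
theorem integral_abs_le_of_forall_contDiff {f : ℝ → ℝ} (hf : Integrable f) {C : ℝ}
    (h : ∀ φ : ℝ → ℝ, ContDiff ℝ ∞ φ → HasCompactSupport φ → (∀ x, |φ x| ≤ 1) →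
      ∫ x, f x * φ x ≤ C) : ∫ x, |f x| ≤ C := by
  have hball : ∀ n : ℕ, ∫ x in Metric.closedBall (0 : ℝ) n, |f x| ≤ C := by
    intro n
    obtain ⟨g, hgm, hgf⟩ := hf.aestronglyMeasurable
    set σ : ℝ → ℝ := (Metric.closedBall (0 : ℝ) n).indicator fun x => SignType.sign (g x) with hσ
    have hσ1 : ∀ x, |σ x| ≤ 1 := by
      intro x
      by_cases hx : x ∈ Metric.closedBall (0 : ℝ) n
      · rw [hσ, indicator_of_mem hx]
        rcases lt_trichotomy (g x) 0 with h | h | h <;> simp [h]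
      · rw [hσ, indicator_of_notMem hx]
        simp
    have hσm : Measurable σ := by
      refine Measurable.indicator ?_ Metric.isClosed_closedBall.measurableSet
      have : (fun x => ((SignType.sign (g x) : SignType) : ℝ)) =
          fun x => if 0 < g x then (1 : ℝ) else if g x < 0 then -1 else 0 := by
        ext x
        rcases lt_trichotomy (g x) 0 with h | h | h <;> simp [h, h.le]
      rw [this]
      exact Measurable.ite (measurableSet_lt measurable_const hgm.measurable) measurable_const
        (Measurable.ite (measurableSet_lt hgm.measurable measurable_const) measurable_const
          measurable_const)
    have hσl : LocallyIntegrable σ := by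
      refine (locallyIntegrable_const (1 : ℝ)).mono hσm.aestronglyMeasurable
        (Eventually.of_forall fun x => ?_)
      simpa using hσ1 x
    have hσc : HasCompactSupport σ :=
      HasCompactSupport.intro (isCompact_closedBall (0 : ℝ) n) fun x hx =>
        indicator_of_notMem hx _
    -- The outer radius is exactly twice the inner one: a bounded ratio is what almost everywhere
    -- convergence of the mollifications requires.
    let b : ℕ → ContDiffBump (0 : ℝ) := fun k =>
      ⟨1 / (k + 1), 2 / (k + 1), by positivity, by gcongr; norm_num⟩
    have hb : Tendsto (fun k => (b k).rOut) atTop (𝓝 0) := by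
      have := (tendsto_one_div_add_atTop_nhds_zero_nat (𝕜 := ℝ)).const_mul 2
      rw [mul_zero] at this
      refine this.congr fun k => ?_
      simp only [b]
      ring
    have hconv := ContDiffBump.ae_convolution_tendsto_right_of_locallyIntegrable (K := 2)
      hb (Eventually.of_forall fun k => le_of_eq (by simp only [b]; ring)) hσl
    set φ : ℕ → ℝ → ℝ := fun k =>
      convolution ((b k).normed volume) σ (ContinuousLinearMap.lsmul ℝ ℝ) volume with hφ
    have hφ1 : ∀ k x, |φ k x| ≤ 1 := by
      intro k x
      rw [hφ]
      simp only [convolution_def, ContinuousLinearMap.lsmul_apply, smul_eq_mul]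
      rw [← Real.norm_eq_abs]
      calc _ ≤ ∫ t, (b k).normed volume t := by
            refine norm_integral_le_of_norm_le (b k).integrable_normed
              (Eventually.of_forall fun t => ?_)
            rw [norm_mul, Real.norm_of_nonneg ((b k).nonneg_normed t)]
            exact mul_le_of_le_one_right ((b k).nonneg_normed t) (hσ1 _)
        _ = 1 := (b k).integral_normed
    have hlim : Tendsto (fun k => ∫ x, f x * φ k x) atTop (𝓝 (∫ x, f x * σ x)) := by
      refine tendsto_integral_of_dominated_convergence (fun x => |f x|) (fun k => ?_) hf.abs
        (fun k => Eventually.of_forall fun x => ?_) ?_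
      · refine hf.aestronglyMeasurable.mul (Continuous.aestronglyMeasurable ?_)
        exact ((b k).hasCompactSupport_normed.contDiff_convolution_left (n := 0) _
          ((b k).contDiff_normed) hσl).continuous
      · rw [norm_mul, Real.norm_eq_abs, Real.norm_eq_abs]
        exact mul_le_of_le_one_right (abs_nonneg _) (hφ1 k x)
      · filter_upwards [hconv] with x hx using hx.const_mul _
    have hle : ∫ x, f x * σ x ≤ C := by
      refine le_of_tendsto' hlim fun k => h _ ?_ ?_ (hφ1 k)
      · exact (b k).hasCompactSupport_normed.contDiff_convolution_left _
          ((b k).contDiff_normed) hσl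
      · exact (b k).hasCompactSupport_normed.convolution _ hσc
    refine le_trans (le_of_eq ?_) hle
    rw [← integral_indicator Metric.isClosed_closedBall.measurableSet]
    refine integral_congr_ae ?_
    filter_upwards [hgf] with x hx
    by_cases hxb : x ∈ Metric.closedBall (0 : ℝ) n
    · rw [hσ, indicator_of_mem hxb, indicator_of_mem hxb, ← hx]
      rcases lt_trichotomy (f x) 0 with h | h | h <;> simp [h, abs_of_neg, abs_of_pos]
    · rw [hσ, indicator_of_notMem hxb, indicator_of_notMem hxb, mul_zero]
  have hlim := tendsto_setIntegral_of_monotone (μ := volume) (f := fun x => |f x|)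
    (s := fun n : ℕ => Metric.closedBall (0 : ℝ) n)
    (fun n => Metric.isClosed_closedBall.measurableSet)
    (fun m n hmn => Metric.closedBall_subset_closedBall (by exact_mod_cast hmn))
    hf.abs.integrableOn
  rw [Metric.iUnion_closedBall_nat, setIntegral_univ] at hlim
  exact le_of_tendsto' hlim hball

theorem contDiff_infty_intervalIntegral {φ : ℝ → ℝ} (hφ : ContDiff ℝ ∞ φ) (a : ℝ) :
    ContDiff ℝ ∞ fun x => ∫ t in a..x, φ t := by
  have hd : deriv (fun x => ∫ t in a..x, φ t) = φ := by
    ext x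
    exact hφ.continuous.deriv_integral _ _ _
  refine contDiff_infty_iff_deriv.2 ⟨fun x => ?_, by rwa [hd]⟩
  exact (intervalIntegral.differentiable_integral_of_continuous hφ.continuous) x

/-- By duality, the translation is moved to the test function. The difference `φ(x - z) - φ(x)` is
the derivative of `ψ(x)`, the integral of `φ` from `x` to `x - z`, which is compactly supported and
bounded by `|z|`. The pairing is therefore minus the value of `m` at `ψ`. -/
theorem IsMeasureDeriv.integral_abs_translate_sub_le {f : ℝ → ℝ} (hf : Integrable f)
    {m : WeakDual ℝ C₀(ℝ, ℝ)} (hm : IsMeasureDeriv f m) (z : ℝ) :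
    ∫ x, |f (x + z) - f x| ≤ |z| * ‖WeakDual.toStrongDual m‖ := by
  refine integral_abs_le_of_forall_contDiff ((hf.comp_add_right z).sub hf) ?_
  intro φ hφ hφc hφ1
  -- The difference of two primitives shows smoothness; the integral from `x` to `x - z` shows the
  -- size and the support.
  set ψ : ℝ → ℝ := fun x => (∫ t in (0 : ℝ)..(x - z), φ t) - ∫ t in (0 : ℝ)..x, φ t with hψ
  have hint : ∀ a b : ℝ, IntervalIntegrable φ volume a b := fun a b =>
    hφ.continuous.intervalIntegrable a b
  have hψ' : ∀ x, ψ x = ∫ t in x..(x - z), φ t := fun x =>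
    intervalIntegral.integral_interval_sub_left (hint _ _) (hint _ _)
  have hψs : ContDiff ℝ ∞ ψ :=
    ((contDiff_infty_intervalIntegral hφ 0).comp (contDiff_id.sub contDiff_const)).sub
      (contDiff_infty_intervalIntegral hφ 0)
  have hψd : ∀ x, deriv ψ x = φ (x - z) - φ x := by
    intro x
    have h1 : ∀ y, HasDerivAt (fun x => ∫ t in (0 : ℝ)..x, φ t) (φ y) y := fun y =>
      hφ.continuous.integral_hasStrictDerivAt 0 y |>.hasDerivAt
    have h2 := (h1 (x - z)).comp_sub_const x z
    exact (h2.sub (h1 x)).deriv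
  have hψc : HasCompactSupport ψ := by
    obtain ⟨R, hR⟩ := hφc.isCompact.isBounded.subset_closedBall 0
    refine HasCompactSupport.intro (isCompact_closedBall (0 : ℝ) (R + |z|)) fun x hx => ?_
    rw [hψ']
    refine (intervalIntegral.integral_congr (g := fun _ => 0) fun t ht => ?_).trans (by simp)
    refine image_eq_zero_of_notMem_tsupport fun htφ => hx ?_
    have h1 := hR htφ
    rw [mem_closedBall_zero_iff, Real.norm_eq_abs] at h1 ⊢
    have h2 : |t - x| ≤ |x - z - x| := abs_sub_left_of_mem_uIcc ht
    have h3 : |x - z - x| = |z| := by rw [show x - z - x = -z by ring, abs_neg]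
    have h4 : |x| ≤ |t| + |t - x| := by
      have := abs_sub_abs_le_abs_sub x t
      rw [abs_sub_comm x t] at this
      linarith
    linarith
  have hψb : ∀ x, |ψ x| ≤ |z| := by
    intro x
    rw [hψ', ← Real.norm_eq_abs]
    refine (intervalIntegral.norm_integral_le_of_norm_le_const (C := 1)
      fun t _ => hφ1 t).trans (le_of_eq ?_)
    rw [one_mul, show x - z - x = -z by ring, abs_neg]
  let Ψ : C₀(ℝ, ℝ) := ⟨⟨ψ, hψs.continuous⟩, hψc.is_zero_at_infty⟩
  have hΨ : ‖Ψ‖ ≤ |z| := by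
    rw [← ZeroAtInftyContinuousMap.norm_toBCF_eq_norm]
    exact (BoundedContinuousFunction.norm_le (abs_nonneg z)).2 hψb
  have hfφ : ∀ c : ℝ, Integrable fun x => f x * φ (x - c) := by
    intro c
    refine hf.mul_bdd (c := 1) ?_ (Eventually.of_forall fun x => hφ1 _)
    exact (hφ.continuous.comp (continuous_id.sub continuous_const)).aestronglyMeasurable
  have e1 : ∫ x, (f (x + z) - f x) * φ x = ∫ x, f x * (φ (x - z) - φ x) := by
    have h0 := hfφ 0
    simp only [sub_zero] at h0
    have h1 : Integrable fun x => f (x + z) * φ x := by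
      have := (hfφ z).comp_add_right z
      simpa using this
    simp_rw [sub_mul, mul_sub]
    rw [integral_sub h1 h0, integral_sub (hfφ z) h0]
    congr 1
    rw [← integral_add_right_eq_self (fun x => f x * φ (x - z)) z]
    simp
  have e2 : m Ψ = -∫ x, f x * (φ (x - z) - φ x) := by
    rw [hm Ψ hψs hψc]
    congr 2
    ext x
    rw [← hψd]
    rfl
  refine e1.trans_le ?_
  calc ∫ x, f x * (φ (x - z) - φ x) = -(m Ψ) := by rw [e2, neg_neg]
    _ ≤ ‖WeakDual.toStrongDual m Ψ‖ := by
      rw [← norm_neg]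
      exact Real.le_norm_self _
    _ ≤ ‖WeakDual.toStrongDual m‖ * ‖Ψ‖ := ContinuousLinearMap.le_opNorm _ _
    _ ≤ ‖WeakDual.toStrongDual m‖ * |z| := by gcongr
    _ = _ := mul_comm _ _

/-! ### The operator on `L¹ ∩ BV` -/

theorem measurable_fnL1BV (v : L1BV) : Measurable (fnL1BV v) := (Lp.stronglyMeasurable _).measurable

theorem integrable_fnL1BV (v : L1BV) : Integrable (fnL1BV v) := L1.integrable_coeFn _

/-- The first bound acts for small `z`, the second for large `z`. `M` and `ε` are free upper bounds,
so that one `M` can serve a whole bounded sequence and both can be taken positive. -/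
theorem eLpNorm_translate_sub_fnL1BV_le (v : L1BV) {M ε : ℝ}
    (hM : ‖WeakDual.toStrongDual v.1.2‖ ≤ M) (hε : 2 * ‖v.1.1‖ ≤ ε) (z : ℝ) :
    eLpNorm (fun x => fnL1BV v (x + z) - fnL1BV v x) 1 volume ≤
      ENNReal.ofReal (min (M * |z|) ε) := by
  have hf := integrable_fnL1BV v
  have hd : Integrable fun x => fnL1BV v (x + z) - fnL1BV v x := (hf.comp_add_right z).sub hf
  rw [eLpNorm_one_eq_lintegral_enorm, ← ofReal_integral_norm_eq_lintegral_enorm hd]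
  refine ENNReal.ofReal_le_ofReal (le_min ?_ ?_)
  · refine (IsMeasureDeriv.integral_abs_translate_sub_le hf v.2 z).trans ?_
    rw [mul_comm]
    gcongr
  · have h1 : ∫ x, ‖fnL1BV v x‖ = ‖v.1.1‖ := (L1.norm_eq_integral_norm _).symm
    calc ∫ x, ‖fnL1BV v (x + z) - fnL1BV v x‖
        ≤ ∫ x, (‖fnL1BV v (x + z)‖ + ‖fnL1BV v x‖) :=
          integral_mono hd.norm ((hf.comp_add_right z).norm.add hf.norm) fun x => norm_sub_le _ _
      _ = 2 * ‖v.1.1‖ := by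
          rw [integral_add (hf.comp_add_right z).norm hf.norm,
            integral_add_right_eq_self (fun x => ‖fnL1BV v x‖) z, h1, two_mul]
      _ ≤ ε := hε

theorem integrable_min_mul_div {s : ℝ} (hs0 : 0 < s) (hs1 : s < 1) {M ε : ℝ} (hM : 0 < M)
    (hε : 0 < ε) : Integrable fun z : ℝ => min (M * |z|) ε / |z| ^ (1 + s) := by
  refine ((integrable_min_rpow_div hs0 hs1).const_mul (max M ε)).mono'
    (Measurable.aestronglyMeasurable (by fun_prop)) (Eventually.of_forall fun z => ?_)
  rw [Real.norm_of_nonneg (by positivity), ← mul_div_assoc, Real.rpow_one]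
  gcongr
  rw [mul_min_of_nonneg _ _ (hM.le.trans (le_max_left M ε)), mul_one]
  exact min_le_min (by gcongr; exact le_max_left _ _) (le_max_right _ _)

theorem levyOp_fnL1BV {s : ℝ} (hs0 : 0 < s) (hs1 : s < 1) (v : L1BV) {M ε : ℝ} (hM0 : 0 < M)
    (hM : ‖WeakDual.toStrongDual v.1.2‖ ≤ M) (hε0 : 0 < ε) (hε : 2 * ‖v.1.1‖ ≤ ε) :
    (∀ᵐ x, LevyConvergesAt s (fnL1BV v) x) ∧
      eLpNorm (levyOp s (fnL1BV v)) 1 volume ≤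
        ENNReal.ofReal (|levyConst s| * ∫ z, min (M * |z|) ε / |z| ^ (1 + s)) :=
  levyConvergesAt_and_eLpNorm_levyOp_le (measurable_fnL1BV v) le_rfl ENNReal.one_ne_top
    (fun z hz => lt_min (mul_pos hM0 (abs_pos.2 hz)) hε0) (by fun_prop)
    (integrable_min_mul_div hs0 hs1 hM0 hε0) (eLpNorm_translate_sub_fnL1BV_le v hM hε)

theorem levyConvergesAt_fnL1BV {s : ℝ} (hs0 : 0 < s) (hs1 : s < 1) (v : L1BV) :
    ∀ᵐ x, LevyConvergesAt s (fnL1BV v) x :=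
  -- The added ones keep both constants positive when the norms vanish.
  (levyOp_fnL1BV hs0 hs1 v (M := ‖WeakDual.toStrongDual v.1.2‖ + 1) (ε := 2 * ‖v.1.1‖ + 1)
    (by positivity) (by linarith) (by positivity) (by linarith)).1

theorem memLp_levyOp_fnL1BV {s : ℝ} (hs0 : 0 < s) (hs1 : s < 1) (v : L1BV) :
    MemLp (levyOp s (fnL1BV v)) 1 volume :=
  ⟨(stronglyMeasurable_levyOp s (measurable_fnL1BV v)).aestronglyMeasurable,
    (levyOp_fnL1BV hs0 hs1 v (M := ‖WeakDual.toStrongDual v.1.2‖ + 1) (ε := 2 * ‖v.1.1‖ + 1)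
    (by positivity) (by linarith) (by positivity) (by linarith)).2.trans_lt ENNReal.ofReal_lt_top⟩

/-- The operator on `L¹(ℝ) ∩ BV(ℝ)`, with values in `L¹(ℝ)`. -/
noncomputable def levyL1BV {s : ℝ} (hs0 : 0 < s) (hs1 : s < 1) :
    L1BV →ₗ[ℝ] Lp ℝ 1 (volume : Measure ℝ) where
  toFun v := (memLp_levyOp_fnL1BV hs0 hs1 v).toLp
  map_add' v w := by
    rw [← MemLp.toLp_add]
    refine MemLp.toLp_congr _ _ ?_
    have h : fnL1BV (v + w) =ᵐ[volume] fnL1BV v + fnL1BV w := Lp.coeFn_add v.1.1 w.1.1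
    filter_upwards [levyOp_congr_ae (s := s) h, levyConvergesAt_fnL1BV hs0 hs1 v,
      levyConvergesAt_fnL1BV hs0 hs1 w] with x hx hv hw
    rw [hx, levyOp_add hv hw, Pi.add_apply]
  map_smul' c v := by
    rw [RingHom.id_apply, ← MemLp.toLp_const_smul]
    refine MemLp.toLp_congr _ _ ?_
    have h : fnL1BV (c • v) =ᵐ[volume] c • fnL1BV v := Lp.coeFn_smul c v.1.1
    filter_upwards [levyOp_congr_ae (s := s) h] with x hx
    rw [hx, levyOp_smul, Pi.smul_apply, smul_eq_mul]

theorem coeFn_levyL1BV {s : ℝ} (hs0 : 0 < s) (hs1 : s < 1) (v : L1BV) :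
    levyL1BV hs0 hs1 v =ᵐ[volume] levyOp s (fnL1BV v) :=
  MemLp.coeFn_toLp (memLp_levyOp_fnL1BV hs0 hs1 v)

theorem norm_levyL1BV_le {s : ℝ} (hs0 : 0 < s) (hs1 : s < 1) (v : L1BV) {M ε : ℝ} (hM0 : 0 < M)
    (hM : ‖WeakDual.toStrongDual v.1.2‖ ≤ M) (hε0 : 0 < ε) (hε : 2 * ‖v.1.1‖ ≤ ε) :
    ‖levyL1BV hs0 hs1 v‖ ≤ |levyConst s| * ∫ z, min (M * |z|) ε / |z| ^ (1 + s) := by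
  refine (Lp.norm_toLp _ (memLp_levyOp_fnL1BV hs0 hs1 v)).trans_le ?_
  refine ENNReal.toReal_le_of_le_ofReal ?_ (levyOp_fnL1BV hs0 hs1 v hM0 hM hε0 hε).2
  exact mul_nonneg (abs_nonneg _) (integral_nonneg fun z => by positivity)

/-- Off the origin the integrand is at most `ε n / |z|^(1+s)`, hence tends to zero. It is dominated
by the same expression with an upper bound of the sequence `ε` in place of `ε n`. -/
theorem tendsto_integral_min_mul_div {s : ℝ} (hs0 : 0 < s) (hs1 : s < 1) {M : ℝ} (hM : 0 < M)
    {ε : ℕ → ℝ} (hε0 : ∀ n, 0 < ε n) (hε : Tendsto ε atTop (𝓝 0)) :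
    Tendsto (fun n => ∫ z : ℝ, min (M * |z|) (ε n) / |z| ^ (1 + s)) atTop (𝓝 0) := by
  have h0 : (0 : ℝ) = ∫ _ : ℝ, (0 : ℝ) := by simp
  rw [h0]
  obtain ⟨E, hE⟩ := hε.bddAbove_range
  have hE' : ∀ n, ε n ≤ E := fun n => hE (mem_range_self n)
  refine tendsto_integral_of_dominated_convergence (fun z => min (M * |z|) E / |z| ^ (1 + s))
    (fun n => Measurable.aestronglyMeasurable (by fun_prop))
    (integrable_min_mul_div hs0 hs1 hM ((hε0 0).trans_le (hE' 0)))
    (fun n => Eventually.of_forall fun z => ?_) (Eventually.of_forall fun z => ?_)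
  · have := hε0 n
    rw [Real.norm_of_nonneg (by positivity)]
    gcongr
    exact hE' n
  · have h1 : Tendsto (fun n => ε n / |z| ^ (1 + s)) atTop (𝓝 0) := by
      simpa using hε.div_const (|z| ^ (1 + s))
    refine squeeze_zero (fun n => ?_) (fun n => ?_) h1
    · have := hε0 n
      positivity
    · gcongr
      exact min_le_right _ _

/-- A weak-⋆ convergent sequence is norm bounded by Banach-Steinhaus; this is where sequences,
rather than nets, are used. Along the differences `M` stays fixed while the L¹ norm tends to zero.
-/
theorem seqContinuous_levyL1BV {s : ℝ} (hs0 : 0 < s) (hs1 : s < 1) :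
    SeqContinuous (levyL1BV hs0 hs1) := by
  intro u v huv
  have hc : Tendsto (fun n => (u n + (-1 : ℝ) • v).1) atTop (𝓝 0) := by
    have h := (continuous_subtype_val.tendsto v).comp huv
    have h2 := h.add_const ((-1 : ℝ) • v.1)
    have h3 : v.1 + (-1 : ℝ) • v.1 = 0 := by
      refine Prod.ext ?_ (ContinuousLinearMap.ext fun φ => ?_)
      · change v.1.1 + (-1 : ℝ) • v.1.1 = 0
        module
      · change v.1.2 φ + (-1 : ℝ) * v.1.2 φ = 0
        ring
    rw [h3] at h2
    exact h2
  have hc1 : Tendsto (fun n => ‖(u n + (-1 : ℝ) • v).1.1‖) atTop (𝓝 0) := by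
    have := ((continuous_fst.tendsto _).comp hc).norm
    simpa using this
  have hc2 := (continuous_snd.tendsto _).comp hc
  obtain ⟨M, hM⟩ : ∃ M, ∀ n, ‖WeakDual.toStrongDual (u n + (-1 : ℝ) • v).1.2‖ ≤ M := by
    refine banach_steinhaus fun φ => ?_
    have h1 : Tendsto (fun n => (u n + (-1 : ℝ) • v).1.2 φ) atTop (𝓝 0) :=
      ((WeakDual.eval_continuous φ).tendsto _).comp hc2
    obtain ⟨C, hC⟩ := h1.norm.bddAbove_range
    exact ⟨C, fun n => hC (mem_range_self n)⟩
  have hM' : ∀ n, ‖WeakDual.toStrongDual (u n + (-1 : ℝ) • v).1.2‖ ≤ |M| + 1 := fun n =>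
    (hM n).trans ((le_abs_self M).trans (by linarith))
  -- The term `1/(n+1)` keeps the second constant positive and still tends to zero.
  have hε : Tendsto (fun n : ℕ => 2 * ‖(u n + (-1 : ℝ) • v).1.1‖ + 1 / ((n : ℝ) + 1)) atTop (𝓝 0) := by
    simpa using (hc1.const_mul 2).add tendsto_one_div_add_atTop_nhds_zero_nat
  have hlim := (tendsto_integral_min_mul_div hs0 hs1 (M := |M| + 1) (by positivity)
    (fun n => by positivity) hε).const_mul |levyConst s|
  rw [mul_zero] at hlim
  refine tendsto_iff_norm_sub_tendsto_zero.2 (squeeze_zero (fun n => norm_nonneg _)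
    (fun n => ?_) hlim)
  simp only [Function.comp_apply]
  have e : levyL1BV hs0 hs1 (u n) - levyL1BV hs0 hs1 v =
      levyL1BV hs0 hs1 (u n + (-1 : ℝ) • v) := by
    rw [map_add, map_smul, neg_one_smul, sub_eq_add_neg]
  rw [e]
  have hn : 0 < 1 / ((n : ℝ) + 1) := by positivity
  exact norm_levyL1BV_le hs0 hs1 _ (by positivity) (hM' n) (by positivity) (by linarith)

/-! ### Functions of class `H¹` on the punctured line -/

/-- A locally integrable function whose weak derivative vanishes on an open interval is constant
there. -/
theorem exists_ae_eq_const_of_integral_mul_deriv_eq_zero {u : ℝ → ℝ} (hu : LocallyIntegrable u)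
    {U : Set ℝ} (hU : IsOpen U) (hUc : U.OrdConnected) (hUn : U.Nonempty)
    (h : ∀ φ : ℝ → ℝ, ContDiff ℝ ∞ φ → HasCompactSupport φ → tsupport φ ⊆ U →
      ∫ x, u x * deriv φ x = 0) :
    ∃ c, ∀ᵐ x, x ∈ U → u x = c := by
  obtain ⟨x₀, hx₀⟩ := hUn
  obtain ⟨r, hr, hrU⟩ := Metric.nhds_basis_closedBall.mem_iff.1 (hU.mem_nhds hx₀)
  -- A bump of integral one supported in `U`; the constant is the mean of `u` against it.
  let b : ContDiffBump x₀ := ⟨r / 2, r, by positivity, by linarith⟩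
  set ρ : ℝ → ℝ := b.normed volume with hρ
  have hρs : ContDiff ℝ ∞ ρ := b.contDiff_normed
  have hρc : HasCompactSupport ρ := b.hasCompactSupport_normed
  have hρU : tsupport ρ ⊆ U := by
    rw [hρ, b.tsupport_normed_eq]
    exact hrU
  have hρ1 : ∫ x, ρ x = 1 := b.integral_normed
  have hmul : ∀ φ : ℝ → ℝ, Continuous φ → HasCompactSupport φ → Integrable fun x => φ x * u x :=
    fun φ h1 h2 => hu.integrable_smul_left_of_hasCompactSupport h1 h2
  refine ⟨∫ x, ρ x * u x, ?_⟩
  set c := ∫ x, ρ x * u x with hc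
  have hloc : LocallyIntegrableOn (fun x => u x - c) U :=
    (hu.sub (locallyIntegrable_const c)).locallyIntegrableOn U
  have key := hU.ae_eq_zero_of_integral_contDiff_smul_eq_zero (f := fun x => u x - c) hloc ?_
  · filter_upwards [key] with x hx hxU
    linarith [hx hxU]
  intro φ hφ hφc hφU
  set I := ∫ x, φ x with hI
  -- Subtracting `(∫ φ) ρ` makes the integral zero, so that `η` is the derivative of a compactly
  -- supported function. Testing with that function gives `∫ φ u = c ∫ φ`.
  set η : ℝ → ℝ := fun x => φ x - I * ρ x with hη
  have hηs : ContDiff ℝ ∞ η := hφ.sub (contDiff_const.mul hρs)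
  have hφi : Integrable φ := hφ.continuous.integrable_of_hasCompactSupport hφc
  have hρi : Integrable ρ := hρs.continuous.integrable_of_hasCompactSupport hρc
  have hη0 : ∫ x, η x = 0 := by
    rw [hη, integral_sub hφi (hρi.const_mul I), integral_const_mul, hρ1]
    ring
  set K := tsupport φ ∪ tsupport ρ with hK
  have hKc : IsCompact K := hφc.isCompact.union hρc.isCompact
  have hKn : K.Nonempty := ⟨x₀, Or.inr (by
    rw [hρ, b.tsupport_normed_eq]
    exact Metric.mem_closedBall_self hr.le)⟩
  have hKU : K ⊆ U := union_subset hφU hρU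
  have hηK : ∀ x, x ∉ K → η x = 0 := by
    intro x hx
    rw [hK, mem_union, not_or] at hx
    simp [hη, image_eq_zero_of_notMem_tsupport hx.1, image_eq_zero_of_notMem_tsupport hx.2]
  set a := sInf K with ha
  set d := sSup K with hd
  have haK : a ∈ K := hKc.sInf_mem hKn
  have hdK : d ∈ K := hKc.sSup_mem hKn
  have hKI : K ⊆ Icc a d := fun x hx =>
    ⟨csInf_le hKc.bddBelow hx, le_csSup hKc.bddAbove hx⟩
  -- The primitive of `η` need not vanish between the points of `K`, so the whole hull of `K` must
  -- lie in `U`; this is where connectedness enters.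
  have hIU : Icc a d ⊆ U := hUc.out (hKU haK) (hKU hdK)
  set ψ : ℝ → ℝ := fun x => ∫ t in a..x, η t with hψ
  have hψs : ContDiff ℝ ∞ ψ := contDiff_infty_intervalIntegral hηs a
  have hψd : deriv ψ = η := by
    ext x
    exact hηs.continuous.deriv_integral _ _ _
  have hψ0 : ∀ x, x ∉ Icc a d → ψ x = 0 := by
    intro x hx
    rcases lt_or_ge x a with hxa | hxa
    · have hne : ∀ᵐ t : ℝ, t ≠ a := by simp [ae_iff]
      refine (intervalIntegral.integral_congr_ae (g := fun _ => 0) ?_).trans (by simp)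
      filter_upwards [hne] with t hta ht
      refine hηK t fun htK => ?_
      rw [uIoc_of_ge hxa.le] at ht
      exact absurd (hKI htK).1 (not_le.2 (lt_of_le_of_ne ht.2 hta))
    · have hxd : d < x := by
        by_contra hcon
        exact hx ⟨hxa, not_lt.1 hcon⟩
      rw [hψ]
      simp only
      rw [intervalIntegral.integral_of_le hxa, ← integral_Icc_eq_integral_Ioc,
        setIntegral_eq_integral_of_forall_compl_eq_zero, hη0]
      intro t ht
      exact hηK t fun htK => ht ⟨(hKI htK).1, (hKI htK).2.trans hxd.le⟩
  have hψc : HasCompactSupport ψ := HasCompactSupport.intro isCompact_Icc hψ0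
  have hψU : tsupport ψ ⊆ U := by
    refine Subset.trans (closure_minimal ?_ isClosed_Icc) hIU
    intro x hx
    by_contra hcon
    exact hx (hψ0 x hcon)
  have h0 := h ψ hψs hψc hψU
  rw [hψd] at h0
  have h1 : ∫ x, (φ x * u x - I * (ρ x * u x)) = 0 := by
    rw [← h0]
    congr 1
    ext x
    simp only [hη]
    ring
  rw [integral_sub (hmul φ hφ.continuous hφc) ((hmul ρ hρs.continuous hρc).const_mul I),
    integral_const_mul, ← hc] at h1
  simp only [smul_eq_mul, mul_sub]
  rw [integral_sub (hmul φ hφ.continuous hφc) (hφi.mul_const c), integral_mul_const, ← hI]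
  exact h1

/-- Integration by parts for absolutely continuous functions: by Lebesgue differentiation, the
primitive has derivative `g` almost everywhere. -/
theorem integral_primitive_mul_deriv {g φ : ℝ → ℝ} (hg : LocallyIntegrable g)
    (hφ : ContDiff ℝ ∞ φ) (hφc : HasCompactSupport φ) :
    ∫ x, (∫ t in (0 : ℝ)..x, g t) * deriv φ x = -∫ x, g x * φ x := by
  obtain ⟨R, hR⟩ := hφc.isCompact.isBounded.subset_closedBall 0
  -- One more than `|R|` puts `b` and `-b` outside the support of `φ`, so the boundary terms vanish.
  set b := |R| + 1 with hb
  have hb0 : 0 < b := by positivity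
  have hsupp : ∀ x, x ∉ Ioc (-b) b → x ∉ tsupport φ := by
    intro x hx hxφ
    have h1 := hR hxφ
    rw [mem_closedBall_zero_iff, Real.norm_eq_abs] at h1
    have h2 := abs_le.1 (h1.trans (le_abs_self R))
    exact hx ⟨by linarith, by linarith⟩
  have hgi : ∀ x y : ℝ, IntervalIntegrable g volume x y := fun x y =>
    intervalIntegrable_iff.mpr ((hg.integrableOn_isCompact isCompact_uIcc).mono_set uIoc_subset_uIcc)
  have hac : AbsolutelyContinuousOnInterval (fun x => ∫ t in (0 : ℝ)..x, g t) (-b) b :=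
    (hgi _ _).absolutelyContinuousOnInterval_intervalIntegral
      (by rw [uIcc_of_le (by linarith)]; constructor <;> linarith)
  have hφac : AbsolutelyContinuousOnInterval φ (-b) b :=
    ContDiffOn.absolutelyContinuousOnInterval (hφ.of_le (by simp)).contDiffOn
  have hparts := hac.integral_mul_deriv_eq_deriv_mul hφac
  have hφb : φ b = 0 := image_eq_zero_of_notMem_tsupport fun h => by
    have h1 := hR h
    rw [mem_closedBall_zero_iff, Real.norm_eq_abs] at h1
    have := h1.trans (le_abs_self R)
    have := le_abs_self b
    linarith
  have hφb' : φ (-b) = 0 := image_eq_zero_of_notMem_tsupport (hsupp _ fun h => lt_irrefl _ h.1)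
  rw [hφb, hφb', mul_zero, mul_zero, sub_zero, zero_sub] at hparts
  have hle : -b ≤ b := by linarith
  have e1 : ∫ x in (-b)..b, (∫ t in (0 : ℝ)..x, g t) * deriv φ x =
      ∫ x, (∫ t in (0 : ℝ)..x, g t) * deriv φ x := by
    rw [intervalIntegral.integral_of_le hle]
    refine setIntegral_eq_integral_of_forall_compl_eq_zero fun x hx => ?_
    have : x ∉ tsupport (deriv φ) := fun h => hsupp x hx (tsupport_deriv_subset h)
    rw [image_eq_zero_of_notMem_tsupport this, mul_zero]
  have e2 : ∫ x in (-b)..b, deriv (fun x => ∫ t in (0 : ℝ)..x, g t) x * φ x = ∫ x, g x * φ x := by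
    have : ∫ x in (-b)..b, deriv (fun x => ∫ t in (0 : ℝ)..x, g t) x * φ x =
        ∫ x in (-b)..b, g x * φ x := by
      refine intervalIntegral.integral_congr_ae ?_
      filter_upwards [LocallyIntegrable.ae_hasDerivAt_integral hg] with x hx _
      rw [(hx 0).deriv]
    rw [this, intervalIntegral.integral_of_le hle]
    refine setIntegral_eq_integral_of_forall_compl_eq_zero fun x hx => ?_
    rw [image_eq_zero_of_notMem_tsupport (hsupp x hx), mul_zero]
  rw [← e1, hparts, e2]

/-- Minus the primitive of `g`, the function has zero weak derivative on each half-line, so it is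
constant on each. The two constants are unrelated, because no test function sees the origin. -/
theorem IsWeakDerivRstar.exists_ae_eq {f g : ℝ → ℝ} (hf : LocallyIntegrable f)
    (hg : LocallyIntegrable g) (h : IsWeakDerivRstar f g) :
    ∃ c₁ c₂ : ℝ, ∀ᵐ x, f x = (if 0 < x then c₁ else c₂) + ∫ t in (0 : ℝ)..x, g t := by
  have hgi : ∀ x y : ℝ, IntervalIntegrable g volume x y := fun x y =>
    intervalIntegrable_iff.mpr ((hg.integrableOn_isCompact isCompact_uIcc).mono_set uIoc_subset_uIcc)
  have hGc : Continuous fun x => ∫ t in (0 : ℝ)..x, g t :=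
    intervalIntegral.continuous_primitive hgi 0
  have hu : LocallyIntegrable fun x => f x - ∫ t in (0 : ℝ)..x, g t :=
    hf.sub hGc.locallyIntegrable
  have key : ∀ U : Set ℝ, U ⊆ {0}ᶜ → ∀ φ : ℝ → ℝ, ContDiff ℝ ∞ φ → HasCompactSupport φ →
      tsupport φ ⊆ U → ∫ x, (f x - ∫ t in (0 : ℝ)..x, g t) * deriv φ x = 0 := by
    intro U hU φ h1 h2 h3
    have hd : Continuous (deriv φ) := h1.continuous_deriv (by simp)
    have i1 : Integrable fun x => f x * deriv φ x :=
      (hf.integrable_smul_left_of_hasCompactSupport hd h2.deriv).congr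
        (Eventually.of_forall fun x => by simp [mul_comm])
    have i2 : Integrable fun x => (∫ t in (0 : ℝ)..x, g t) * deriv φ x :=
      (hGc.mul hd).integrable_of_hasCompactSupport h2.deriv.mul_left
    simp_rw [sub_mul]
    rw [integral_sub i1 i2, h φ h1 h2 (h3.trans hU), integral_primitive_mul_deriv hg h1 h2,
      sub_self]
  obtain ⟨c₁, h₁⟩ := exists_ae_eq_const_of_integral_mul_deriv_eq_zero hu isOpen_Ioi
    ordConnected_Ioi ⟨1, mem_Ioi.2 zero_lt_one⟩ (key (Ioi 0) fun x hx => ne_of_gt hx)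
  obtain ⟨c₂, h₂⟩ := exists_ae_eq_const_of_integral_mul_deriv_eq_zero hu isOpen_Iio
    ordConnected_Iio ⟨-1, mem_Iio.2 neg_one_lt_zero⟩ (key (Iio 0) fun x hx => ne_of_lt hx)
  have hne : ∀ᵐ x : ℝ, x ≠ 0 := by simp [ae_iff]
  refine ⟨c₁, c₂, ?_⟩
  filter_upwards [h₁, h₂, hne] with x hx1 hx2 hx0
  rcases lt_or_gt_of_ne hx0 with hx | hx
  · rw [if_neg hx.not_gt, ← hx2 hx, sub_add_cancel]
  · rw [if_pos hx, ← hx1 hx, sub_add_cancel]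

/-- The integral is `z` times the mean of `g(x + z t)` over `t` in the unit interval. Cauchy-Schwarz
in `t`, then translation invariance in `x`, conclude. -/
theorem eLpNorm_integral_translate_le {g : ℝ → ℝ} (hg : Measurable g) (z : ℝ) :
    eLpNorm (fun x => ∫ t in x..(x + z), g t) 2 volume ≤ ENNReal.ofReal |z| * eLpNorm g 2 volume := by
  have hm : Measurable (Function.uncurry fun x t : ℝ => ‖g (x + z * t)‖ₑ) :=
    (hg.comp (by fun_prop : Measurable fun p : ℝ × ℝ => p.1 + z * p.2)).enorm
  have hle : ∀ x, ‖∫ t in x..(x + z), g t‖ₑ ≤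
      ENNReal.ofReal |z| * ∫⁻ t in Ioc (0 : ℝ) 1, ‖g (x + z * t)‖ₑ := by
    intro x
    have h1 := intervalIntegral.smul_integral_comp_add_mul (a := 0) (b := 1) (f := g) z x
    simp only [mul_zero, add_zero, mul_one] at h1
    rw [← h1, smul_eq_mul, enorm_mul, Real.enorm_eq_ofReal_abs z,
      intervalIntegral.integral_of_le zero_le_one]
    gcongr
    exact enorm_integral_le_lintegral_enorm _
  have h2 : ∫⁻ x, (∫⁻ t in Ioc (0 : ℝ) 1, ‖g (x + z * t)‖ₑ) ^ (2 : ℝ) ≤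
      ∫⁻ x, ‖g x‖ₑ ^ (2 : ℝ) := by
    calc _ ≤ ∫⁻ x, ∫⁻ t in Ioc (0 : ℝ) 1, ‖g (x + z * t)‖ₑ ^ (2 : ℝ) := by
          refine lintegral_mono fun x => ?_
          refine (lintegral_rpow_le_of_finite hm.of_uncurry_left one_le_two).trans ?_
          simp
      _ = ∫⁻ t in Ioc (0 : ℝ) 1, ∫⁻ x, ‖g (x + z * t)‖ₑ ^ (2 : ℝ) :=
          lintegral_lintegral_swap (hm.pow_const (2 : ℝ)).aemeasurable
      _ = ∫⁻ t in Ioc (0 : ℝ) 1, ∫⁻ x, ‖g x‖ₑ ^ (2 : ℝ) := by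
          refine lintegral_congr fun t => ?_
          exact lintegral_add_right_eq_self (fun x => ‖g x‖ₑ ^ (2 : ℝ)) (z * t)
      _ = _ := by simp
  rw [eLpNorm_eq_lintegral_rpow_enorm_toReal two_ne_zero ENNReal.ofNat_ne_top,
    eLpNorm_eq_lintegral_rpow_enorm_toReal two_ne_zero ENNReal.ofNat_ne_top]
  simp only [ENNReal.toReal_ofNat]
  calc (∫⁻ x, ‖∫ t in x..(x + z), g t‖ₑ ^ (2 : ℝ)) ^ (1 / (2 : ℝ))
      ≤ (∫⁻ x, (ENNReal.ofReal |z| * ∫⁻ t in Ioc (0 : ℝ) 1, ‖g (x + z * t)‖ₑ) ^ (2 : ℝ)) ^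
          (1 / (2 : ℝ)) := by
        gcongr with x
        exact hle x
    _ = (ENNReal.ofReal |z| ^ (2 : ℝ) *
          ∫⁻ x, (∫⁻ t in Ioc (0 : ℝ) 1, ‖g (x + z * t)‖ₑ) ^ (2 : ℝ)) ^ (1 / (2 : ℝ)) := by
        simp_rw [ENNReal.mul_rpow_of_nonneg _ _ zero_le_two]
        rw [lintegral_const_mul' _ _ (by simp)]
    _ ≤ (ENNReal.ofReal |z| ^ (2 : ℝ) * ∫⁻ x, ‖g x‖ₑ ^ (2 : ℝ)) ^ (1 / (2 : ℝ)) := by gcongr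
    _ = _ := by
        rw [ENNReal.mul_rpow_of_nonneg _ _ (by positivity), ← ENNReal.rpow_mul]
        norm_num

/-- A function of class `H¹` on an interval of length one is bounded by its norm, here at an
end point of the interval. -/
theorem abs_le_of_ae_eq_add_integral {f g : ℝ → ℝ} (hf : Measurable f) (hg : Measurable g)
    {A B : ℝ} (hA : 0 ≤ A) (hB : 0 ≤ B) (hfA : eLpNorm f 2 volume ≤ ENNReal.ofReal A)
    (hgB : eLpNorm g 2 volume ≤ ENNReal.ofReal B) {x σ c : ℝ} (hσ : |σ| = 1)
    (h : ∀ᵐ y, y ∈ uIoc x (x + σ) → f y = c + ∫ t in x..y, g t) : |c| ≤ A + B := by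
  set S := uIoc x (x + σ) with hS
  have hSm : MeasurableSet S := measurableSet_uIoc
  -- Unit length makes the L¹ norm on `S` at most the L² norm, with constant one.
  have hSv : volume S = 1 := by
    rw [hS, Real.volume_uIoc, add_sub_cancel_left, hσ, ENNReal.ofReal_one]
  have hg1 : eLpNorm g 1 (volume.restrict S) ≤ ENNReal.ofReal B := by
    have := eLpNorm_le_eLpNorm_mul_rpow_measure_univ (μ := volume.restrict S) one_le_two
      hg.aestronglyMeasurable
    rw [Measure.restrict_apply_univ, hSv, ENNReal.one_rpow, mul_one] at this
    exact this.trans ((eLpNorm_mono_measure _ Measure.restrict_le_self).trans hgB)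
  have hG : ∀ y ∈ S, ‖∫ t in x..y, g t‖ ≤ B := by
    intro y hy
    rw [← ENNReal.ofReal_le_ofReal_iff hB, ofReal_norm]
    calc ‖∫ t in x..y, g t‖ₑ = ‖∫ t in uIoc x y, g t‖ₑ := by
          rw [← ofReal_norm, ← ofReal_norm, intervalIntegral.norm_integral_eq_norm_integral_uIoc]
      _ ≤ ∫⁻ t in uIoc x y, ‖g t‖ₑ := enorm_integral_le_lintegral_enorm _
      _ ≤ ∫⁻ t in S, ‖g t‖ₑ := by
          refine lintegral_mono_set ?_
          exact uIoc_subset_uIoc_of_uIcc_subset_uIcc (uIcc_subset_uIcc_left (uIoc_subset_uIcc hy))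
      _ ≤ ENNReal.ofReal B := by rwa [← eLpNorm_one_eq_lintegral_enorm]
  have hc : ∀ᵐ y ∂(volume.restrict S), |c| ≤ ‖f y‖ + B := by
    filter_upwards [ae_restrict_of_ae h, self_mem_ae_restrict hSm] with y hy hyS
    have h1 := hG y hyS
    have h2 : c = f y - ∫ t in x..y, g t := by rw [hy hyS, add_sub_cancel_right]
    calc |c| = ‖f y - ∫ t in x..y, g t‖ := by rw [← h2, Real.norm_eq_abs]
      _ ≤ ‖f y‖ + ‖∫ t in x..y, g t‖ := norm_sub_le _ _
      _ ≤ _ := by gcongr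
  have hf1 : eLpNorm f 1 (volume.restrict S) ≤ ENNReal.ofReal A := by
    have := eLpNorm_le_eLpNorm_mul_rpow_measure_univ (μ := volume.restrict S) one_le_two
      hf.aestronglyMeasurable
    rw [Measure.restrict_apply_univ, hSv, ENNReal.one_rpow, mul_one] at this
    exact this.trans ((eLpNorm_mono_measure _ Measure.restrict_le_self).trans hfA)
  rw [← ENNReal.ofReal_le_ofReal_iff (add_nonneg hA hB), ENNReal.ofReal_add hA hB]
  calc ENNReal.ofReal |c| = ∫⁻ _ in S, ENNReal.ofReal |c| := by
        rw [setLIntegral_const, hSv, mul_one]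
    _ ≤ ∫⁻ y in S, (‖f y‖ₑ + ENNReal.ofReal B) := by
        refine lintegral_mono_ae ?_
        filter_upwards [hc] with y hy
        rw [← ofReal_norm, ← ENNReal.ofReal_add (norm_nonneg _) hB]
        exact ENNReal.ofReal_le_ofReal hy
    _ = (∫⁻ y in S, ‖f y‖ₑ) + ENNReal.ofReal B := by
        rw [lintegral_add_right _ measurable_const, setLIntegral_const, hSv, mul_one]
    _ ≤ _ := by
        gcongr
        rwa [← eLpNorm_one_eq_lintegral_enorm]

/-! ### Translates of functions of class `H¹` on the punctured line -/

/-- A measurable representative of the weak derivative of an element of `H¹(ℝ∖{0})`. -/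
noncomputable def derivH1 (v : H1Rstar) : ℝ → ℝ := v.1.snd

theorem measurable_fnH1 (v : H1Rstar) : Measurable (fnH1 v) := (Lp.stronglyMeasurable _).measurable

theorem measurable_derivH1 (v : H1Rstar) : Measurable (derivH1 v) :=
  (Lp.stronglyMeasurable _).measurable

theorem memLp_fnH1 (v : H1Rstar) : MemLp (fnH1 v) 2 volume := Lp.memLp _

theorem eLpNorm_fnH1_le (v : H1Rstar) : eLpNorm (fnH1 v) 2 volume ≤ ENNReal.ofReal ‖v‖ := by
  rw [fnH1, ← Lp.enorm_def, ← ofReal_norm]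
  exact ENNReal.ofReal_le_ofReal (WithLp.norm_fst_le _ v.1)

theorem eLpNorm_derivH1_le (v : H1Rstar) : eLpNorm (derivH1 v) 2 volume ≤ ENNReal.ofReal ‖v‖ := by
  rw [derivH1, ← Lp.enorm_def, ← ofReal_norm]
  exact ENNReal.ofReal_le_ofReal (WithLp.norm_snd_le _ v.1)

theorem locallyIntegrable_fnH1 (v : H1Rstar) : LocallyIntegrable (fnH1 v) :=
  (memLp_fnH1 v).locallyIntegrable one_le_two

theorem locallyIntegrable_derivH1 (v : H1Rstar) : LocallyIntegrable (derivH1 v) :=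
  (Lp.memLp v.1.snd).locallyIntegrable one_le_two

theorem intervalIntegrable_derivH1 (v : H1Rstar) (x y : ℝ) :
    IntervalIntegrable (derivH1 v) volume x y :=
  intervalIntegrable_iff.mpr
    (((locallyIntegrable_derivH1 v).integrableOn_isCompact isCompact_uIcc).mono_set uIoc_subset_uIcc)

/-- The representative is bounded by comparison with its mean on a unit interval that starts at `x`
and points away from the origin. The jump is the difference of the two one-sided values at the
origin, hence twice that bound. -/
theorem exists_fnH1_ae_eq (v : H1Rstar) : ∃ c₁ c₂ : ℝ,
    (∀ᵐ x, fnH1 v x = (if 0 < x then c₁ else c₂) + ∫ t in (0 : ℝ)..x, derivH1 v t) ∧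
    (∀ x, |(if 0 < x then c₁ else c₂) + ∫ t in (0 : ℝ)..x, derivH1 v t| ≤ 2 * ‖v‖) ∧
    |c₁ - c₂| ≤ 4 * ‖v‖ := by
  obtain ⟨c₁, c₂, h⟩ := IsWeakDerivRstar.exists_ae_eq (locallyIntegrable_fnH1 v)
    (locallyIntegrable_derivH1 v) v.2
  have h0 := intervalIntegrable_derivH1 v
  have hpos : ∀ x, 0 ≤ x → |c₁ + ∫ t in (0 : ℝ)..x, derivH1 v t| ≤ 2 * ‖v‖ := by
    intro x hx
    rw [two_mul]
    -- To the right of `x ≥ 0` the interval stays on one side of the origin, so a single constant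
    -- applies; on the other side the interval goes to the left.
    refine abs_le_of_ae_eq_add_integral (σ := 1) (x := x) (measurable_fnH1 v)
      (measurable_derivH1 v) (norm_nonneg v) (norm_nonneg v) (eLpNorm_fnH1_le v)
      (eLpNorm_derivH1_le v) abs_one ?_
    filter_upwards [h] with y hy hyS
    rw [uIoc_of_le (by linarith)] at hyS
    rw [hy, if_pos (hx.trans_lt hyS.1), add_assoc,
      intervalIntegral.integral_add_adjacent_intervals (h0 _ _) (h0 _ _)]
  have hneg : ∀ x, x ≤ 0 → |c₂ + ∫ t in (0 : ℝ)..x, derivH1 v t| ≤ 2 * ‖v‖ := by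
    intro x hx
    rw [two_mul]
    refine abs_le_of_ae_eq_add_integral (σ := -1) (x := x) (measurable_fnH1 v)
      (measurable_derivH1 v) (norm_nonneg v) (norm_nonneg v) (eLpNorm_fnH1_le v)
      (eLpNorm_derivH1_le v) (by simp) ?_
    filter_upwards [h] with y hy hyS
    rw [uIoc_of_ge (by linarith)] at hyS
    rw [hy, if_neg (hyS.2.trans hx).not_gt, add_assoc,
      intervalIntegral.integral_add_adjacent_intervals (h0 _ _) (h0 _ _)]
  refine ⟨c₁, c₂, h, fun x => ?_, ?_⟩
  · split_ifs with hx
    · exact hpos x hx.le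
    · exact hneg x (not_lt.1 hx)
  · have h1 := hpos 0 le_rfl
    have h2 := hneg 0 le_rfl
    simp only [intervalIntegral.integral_same, add_zero] at h1 h2
    have := abs_sub c₁ c₂
    linarith

theorem ae_abs_fnH1_le (v : H1Rstar) : ∀ᵐ x, |fnH1 v x| ≤ 2 * ‖v‖ := by
  obtain ⟨c₁, c₂, h, hb, -⟩ := exists_fnH1_ae_eq v
  filter_upwards [h] with x hx
  rw [hx]
  exact hb x

/-- The difference `H(x + z) - H(x)`, where `H` is the Heaviside function. -/
noncomputable def jumpFn (z x : ℝ) : ℝ := (if 0 < x + z then 1 else 0) - (if 0 < x then 1 else 0)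

theorem measurable_jumpFn (z : ℝ) : Measurable (jumpFn z) :=
  (Measurable.ite (measurableSet_lt measurable_const (measurable_id.add_const z))
    measurable_const measurable_const).sub
    (Measurable.ite (measurableSet_lt measurable_const measurable_id)
    measurable_const measurable_const)

theorem norm_jumpFn_le (z x : ℝ) : ‖jumpFn z x‖ ≤ ‖(uIcc (-z) 0).indicator (fun _ => (1 : ℝ)) x‖ := by
  unfold jumpFn
  by_cases hx : x ∈ uIcc (-z) 0
  · rw [indicator_of_mem hx]
    split_ifs <;> simp
  · have : (0 < x + z ↔ 0 < x) := by
      rw [mem_uIcc] at hx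
      push Not at hx
      constructor
      · intro h
        by_contra hc
        have := hx.1 (by linarith)
        linarith
      · intro h
        by_contra hc
        have := hx.2 h.le
        linarith
    simp [this]

theorem eLpNorm_jumpFn_le (z : ℝ) {p : ENNReal} (hp0 : p ≠ 0) (hp : p ≠ ⊤) :
    eLpNorm (jumpFn z) p volume ≤ ENNReal.ofReal |z| ^ (1 / p.toReal) := by
  refine (eLpNorm_mono (norm_jumpFn_le z)).trans ?_
  rw [eLpNorm_indicator_const measurableSet_uIcc hp0 hp, Real.volume_interval]
  simp

/-- `J` is the jump at the origin and does not depend on `z`. The two terms have different orders in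
`z`, so they are estimated separately in each norm. -/
theorem exists_translate_sub_fnH1_ae_eq (v : H1Rstar) : ∃ J : ℝ, |J| ≤ 4 * ‖v‖ ∧ ∀ z : ℝ,
    (fun x => fnH1 v (x + z) - fnH1 v x) =ᵐ[volume]
      (fun x => ∫ t in x..(x + z), derivH1 v t) + fun x => J * jumpFn z x := by
  obtain ⟨c₁, c₂, h, -, hJ⟩ := exists_fnH1_ae_eq v
  refine ⟨c₁ - c₂, hJ, fun z => ?_⟩
  have h0 := intervalIntegrable_derivH1 v
  have hz : ∀ᵐ x, fnH1 v (x + z) = (if 0 < x + z then c₁ else c₂) +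
      ∫ t in (0 : ℝ)..(x + z), derivH1 v t :=
    (measurePreserving_add_right volume z).quasiMeasurePreserving.ae h
  filter_upwards [h, hz] with x hx hxz
  rw [Pi.add_apply, hx, hxz, ← intervalIntegral.integral_interval_sub_left (h0 0 (x + z)) (h0 0 x)]
  unfold jumpFn
  split_ifs <;> ring

theorem eLpNorm_comp_add_right {f : ℝ → ℝ} (hf : Measurable f) (p : ENNReal) (z : ℝ) :
    eLpNorm (fun x => f (x + z)) p volume = eLpNorm f p volume :=
  eLpNorm_comp_measurePreserving hf.aestronglyMeasurable (measurePreserving_add_right volume z)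

theorem eLpNorm_translate_sub_fnH1_le_two (v : H1Rstar) (z : ℝ) :
    eLpNorm (fun x => fnH1 v (x + z) - fnH1 v x) 2 volume ≤ ENNReal.ofReal (2 * ‖v‖) := by
  have hm := measurable_fnH1 v
  refine (eLpNorm_sub_le (f := fun x => fnH1 v (x + z)) (g := fnH1 v)
    (hm.comp (measurable_add_const z)).aestronglyMeasurable hm.aestronglyMeasurable
    one_le_two).trans ?_
  rw [eLpNorm_comp_add_right hm, two_mul, ENNReal.ofReal_add (norm_nonneg v) (norm_nonneg v)]
  exact add_le_add (eLpNorm_fnH1_le v) (eLpNorm_fnH1_le v)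

theorem eLpNorm_integral_derivH1_le (v : H1Rstar) (z : ℝ) :
    eLpNorm (fun x => ∫ t in x..(x + z), derivH1 v t) 2 volume ≤ ENNReal.ofReal (|z| * ‖v‖) := by
  refine (eLpNorm_integral_translate_le (measurable_derivH1 v) z).trans ?_
  rw [ENNReal.ofReal_mul (abs_nonneg z)]
  gcongr
  exact eLpNorm_derivH1_le v

theorem aestronglyMeasurable_integral_derivH1 (v : H1Rstar) (z : ℝ) :
    AEStronglyMeasurable (fun x => ∫ t in x..(x + z), derivH1 v t) volume := by
  have hc := intervalIntegral.continuous_primitive (intervalIntegrable_derivH1 v) 0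
  have h0 := intervalIntegrable_derivH1 v
  have : (fun x => ∫ t in x..(x + z), derivH1 v t) =
      fun x => (∫ t in (0 : ℝ)..(x + z), derivH1 v t) - ∫ t in (0 : ℝ)..x, derivH1 v t := by
    ext x
    rw [intervalIntegral.integral_interval_sub_left (h0 _ _) (h0 _ _)]
  rw [this]
  exact ((hc.comp (continuous_add_const z)).sub hc).aestronglyMeasurable

/-- `L²` modulus of continuity on the line. -/
theorem eLpNorm_translate_sub_fnH1_le (v : H1Rstar) (z : ℝ) :
    eLpNorm (fun x => fnH1 v (x + z) - fnH1 v x) 2 volume ≤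
      ENNReal.ofReal (5 * ‖v‖ * min (|z| ^ (1 / 2 : ℝ)) 1) := by
  -- For small `z` the regular part contributes `|z| ≤ |z|^(1/2)` and the jump `4 |z|^(1/2)`, hence
  -- the constant 5.
  rcases le_total |z| 1 with hz | hz
  · obtain ⟨J, hJ, h⟩ := exists_translate_sub_fnH1_ae_eq v
    have hz1 : |z| ^ (1 / 2 : ℝ) ≤ 1 := Real.rpow_le_one (abs_nonneg z) hz (by norm_num)
    have hz2 : |z| ≤ |z| ^ (1 / 2 : ℝ) :=
      Real.self_le_rpow_of_le_one (abs_nonneg z) hz (by norm_num)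
    rw [eLpNorm_congr_ae (h z), min_eq_left hz1]
    refine (eLpNorm_add_le (aestronglyMeasurable_integral_derivH1 v z)
      ((measurable_jumpFn z).const_mul J).aestronglyMeasurable one_le_two).trans ?_
    have h2 : eLpNorm (fun x => J * jumpFn z x) 2 volume ≤
        ENNReal.ofReal (4 * ‖v‖ * |z| ^ (1 / 2 : ℝ)) := by
      change eLpNorm (J • jumpFn z) 2 volume ≤ _
      rw [eLpNorm_const_smul, Real.enorm_eq_ofReal_abs, ENNReal.ofReal_mul (by positivity)]
      refine mul_le_mul' (ENNReal.ofReal_le_ofReal hJ)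
        ((eLpNorm_jumpFn_le z two_ne_zero ENNReal.ofNat_ne_top).trans ?_)
      rw [ENNReal.ofReal_rpow_of_nonneg (abs_nonneg z) (by simp)]
      simp
    refine (add_le_add (eLpNorm_integral_derivH1_le v z) h2).trans ?_
    rw [← ENNReal.ofReal_add (by positivity) (by positivity)]
    refine ENNReal.ofReal_le_ofReal ?_
    have := mul_le_mul_of_nonneg_right hz2 (norm_nonneg v)
    linarith
  · have hz1 : 1 ≤ |z| ^ (1 / 2 : ℝ) := Real.one_le_rpow hz (by norm_num)
    rw [min_eq_right hz1]
    refine (eLpNorm_translate_sub_fnH1_le_two v z).trans (ENNReal.ofReal_le_ofReal ?_)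
    linarith [norm_nonneg v]

/-- `L¹` modulus of continuity on bounded intervals. -/
theorem eLpNorm_one_translate_sub_fnH1_le (v : H1Rstar) {R : ℝ} (hR : 0 < R) (z : ℝ) :
    eLpNorm (fun x => fnH1 v (x + z) - fnH1 v x) 1 (volume.restrict (Ioo (-R) R)) ≤
      ENNReal.ofReal ((2 * (2 * R) ^ (1 / 2 : ℝ) + 4) * ‖v‖ * min (|z| ^ (1 : ℝ)) 1) := by
  -- Cauchy-Schwarz on an interval of length `2 * R`.
  have hL : ∀ {f : ℝ → ℝ} {C : ℝ}, AEStronglyMeasurable f volume →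
      eLpNorm f 2 volume ≤ ENNReal.ofReal C →
      eLpNorm f 1 (volume.restrict (Ioo (-R) R)) ≤
        ENNReal.ofReal ((2 * R) ^ (1 / 2 : ℝ) * C) := by
    intro f C hf hC
    have := eLpNorm_le_eLpNorm_mul_rpow_measure_univ (μ := volume.restrict (Ioo (-R) R)) one_le_two
      hf.restrict
    refine this.trans ?_
    rw [Measure.restrict_apply_univ, Real.volume_Ioo, mul_comm, sub_neg_eq_add, ← two_mul]
    rw [ENNReal.ofReal_mul (p := (2 * R) ^ (1 / 2 : ℝ)) (by positivity), ← ENNReal.ofReal_rpow_of_nonneg (by positivity)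
      (by positivity)]
    refine mul_le_mul' (le_of_eq ?_) ((eLpNorm_mono_measure _ Measure.restrict_le_self).trans hC)
    norm_num
  have hm := measurable_fnH1 v
  rw [Real.rpow_one]
  rcases le_total |z| 1 with hz | hz
  · obtain ⟨J, hJ, h⟩ := exists_translate_sub_fnH1_ae_eq v
    rw [eLpNorm_congr_ae (ae_restrict_of_ae (h z)), min_eq_left hz]
    have ha := aestronglyMeasurable_integral_derivH1 v z
    refine (eLpNorm_add_le ha.restrict
      ((measurable_jumpFn z).const_mul J).aestronglyMeasurable le_rfl).trans ?_
    have h2 : eLpNorm (fun x => J * jumpFn z x) 1 (volume.restrict (Ioo (-R) R)) ≤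
        ENNReal.ofReal (4 * ‖v‖ * |z|) := by
      refine (eLpNorm_mono_measure _ Measure.restrict_le_self).trans ?_
      change eLpNorm (J • jumpFn z) 1 volume ≤ _
      rw [eLpNorm_const_smul, Real.enorm_eq_ofReal_abs, ENNReal.ofReal_mul (by positivity)]
      refine mul_le_mul' (ENNReal.ofReal_le_ofReal hJ)
        ((eLpNorm_jumpFn_le z one_ne_zero ENNReal.one_ne_top).trans ?_)
      simp
    refine (add_le_add (hL ha (eLpNorm_integral_derivH1_le v z)) h2).trans ?_
    rw [← ENNReal.ofReal_add (by positivity) (by positivity)]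
    refine ENNReal.ofReal_le_ofReal ?_
    have : 0 ≤ (2 * R) ^ (1 / 2 : ℝ) * (|z| * ‖v‖) := by positivity
    linarith
  · rw [min_eq_right hz]
    refine (hL ((hm.comp (measurable_add_const z)).sub hm).aestronglyMeasurable
      (eLpNorm_translate_sub_fnH1_le_two v z)).trans (ENNReal.ofReal_le_ofReal ?_)
    linarith [norm_nonneg v]

/-- `L²` modulus of continuity away from the origin. -/
theorem eLpNorm_two_translate_sub_fnH1_le (v : H1Rstar) {R : ℝ} (hR : 0 < R) (z : ℝ) :
    eLpNorm (fun x => fnH1 v (x + z) - fnH1 v x) 2 (volume.restrict (Icc (-R) R)ᶜ) ≤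
      ENNReal.ofReal ((3 + R + 2 / R) * ‖v‖ * min (|z| ^ (1 : ℝ)) 1) := by
  have hv := norm_nonneg v
  rw [Real.rpow_one]
  -- The threshold is `R`: a shorter translation of a point outside `[-R, R]` does not cross the
  -- origin, so the jump term vanishes. Beyond it the trivial bound `2 * ‖v‖` suffices, and the term
  -- `2 / R` of the constant absorbs it.
  rcases le_total |z| R with hz | hz
  · obtain ⟨J, hJ, h⟩ := exists_translate_sub_fnH1_ae_eq v
    have h' : (fun x => fnH1 v (x + z) - fnH1 v x) =ᵐ[volume.restrict (Icc (-R) R)ᶜ]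
        fun x => ∫ t in x..(x + z), derivH1 v t := by
      filter_upwards [ae_restrict_of_ae (h z),
        self_mem_ae_restrict (measurableSet_Icc (a := -R) (b := R)).compl] with x hx hxR
      rw [hx, Pi.add_apply]
      have hz' := abs_le.1 hz
      have : (0 < x + z ↔ 0 < x) := by
        rw [mem_compl_iff, mem_Icc, not_and_or, not_le, not_le] at hxR
        rcases hxR with hxR | hxR
        · constructor <;> intro h <;> linarith
        · constructor <;> intro h <;> linarith
      simp [jumpFn, this]
    rw [eLpNorm_congr_ae h']
    refine (eLpNorm_mono_measure _ Measure.restrict_le_self).trans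
      ((eLpNorm_integral_derivH1_le v z).trans (ENNReal.ofReal_le_ofReal ?_))
    have h1 : |z| ≤ (3 + R + 2 / R) * min |z| 1 := by
      have h2 : 0 < 2 / R := by positivity
      rcases le_total |z| 1 with hz1 | hz1
      · rw [min_eq_left hz1]
        nlinarith [abs_nonneg z]
      · rw [min_eq_right hz1]
        linarith
    nlinarith
  · refine (eLpNorm_mono_measure _ Measure.restrict_le_self).trans
      ((eLpNorm_translate_sub_fnH1_le_two v z).trans (ENNReal.ofReal_le_ofReal ?_))
    have h1 : 2 ≤ (3 + R + 2 / R) * min |z| 1 := by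
      have h2 : 0 < 2 / R := by positivity
      rcases le_total |z| 1 with hz1 | hz1
      · rw [min_eq_left hz1]
        have h3 : 2 / R * |z| ≥ 2 := by
          rw [ge_iff_le, div_mul_eq_mul_div, le_div_iff₀ hR]
          linarith
        nlinarith [abs_nonneg z]
      · rw [min_eq_right hz1]
        linarith
    nlinarith

/-! ### The operator on `H¹` of the punctured line -/

theorem levyOp_zero (s : ℝ) : levyOp s 0 = 0 := by
  ext x
  simp [levyOp, levyIntegrand]

theorem levyConvergesAt_zero (s x : ℝ) : LevyConvergesAt s 0 x := by
  have : levyIntegrand s 0 x = fun _ => 0 := by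
    ext z
    simp [levyIntegrand]
  simp [LevyConvergesAt, this]

theorem fnH1_add (v w : H1Rstar) : fnH1 (v + w) =ᵐ[volume] fnH1 v + fnH1 w :=
  Lp.coeFn_add v.1.fst w.1.fst

theorem fnH1_smul (c : ℝ) (v : H1Rstar) : fnH1 (c • v) =ᵐ[volume] c • fnH1 v :=
  Lp.coeFn_smul c v.1.fst

theorem fnH1_zero : fnH1 0 =ᵐ[volume] 0 := Lp.coeFn_zero _ _ _

/-- The modulus of continuity is linear in `‖v‖`, hence so is the bound, and for a linear operator
this is continuity. -/
theorem levyOp_fnH1_of_translate_le {s q : ℝ} (hs : 0 < s) (hq : s < q) {S : Set ℝ} {p : ENNReal}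
    (hp1 : 1 ≤ p) (hp : p ≠ ⊤) {C : ℝ} (hC : 0 < C) {v : H1Rstar}
    (h : ∀ z, eLpNorm (fun x => fnH1 v (x + z) - fnH1 v x) p (volume.restrict S) ≤
      ENNReal.ofReal (C * ‖v‖ * min (|z| ^ q) 1)) :
    (∀ᵐ x ∂(volume.restrict S), LevyConvergesAt s (fnH1 v) x) ∧
      eLpNorm (levyOp s (fnH1 v)) p (volume.restrict S) ≤ ENNReal.ofReal
        (|levyConst s| * (C * ∫ z : ℝ, min (|z| ^ q) 1 / |z| ^ (1 + s)) * ‖v‖) := by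
  -- The weight in Minkowski's inequality must be positive, which fails for `v = 0`.
  rcases eq_or_ne v 0 with rfl | hv
  · constructor
    · exact ae_restrict_of_ae (levyConvergesAt_congr_ae fnH1_zero.symm
        (Eventually.of_forall fun x => levyConvergesAt_zero s x))
    · rw [eLpNorm_congr_ae (ae_restrict_of_ae (levyOp_congr_ae fnH1_zero)), levyOp_zero]
      simp
  · have hv0 : 0 < ‖v‖ := norm_pos_iff.2 hv
    have hi : ∀ z : ℝ, C * ‖v‖ * min (|z| ^ q) 1 / |z| ^ (1 + s) =
        C * ‖v‖ * (min (|z| ^ q) 1 / |z| ^ (1 + s)) := fun z => mul_div_assoc _ _ _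
    have := levyConvergesAt_and_eLpNorm_levyOp_le (s := s) (measurable_fnH1 v) hp1 hp
      (H := fun z => C * ‖v‖ * min (|z| ^ q) 1)
      (fun z hz => by
        have := Real.rpow_pos_of_pos (abs_pos.2 hz) q
        positivity)
      (by fun_prop) (by simpa only [hi] using (integrable_min_rpow_div hs hq).const_mul _) h
    refine ⟨this.1, this.2.trans_eq ?_⟩
    simp_rw [hi]
    rw [integral_const_mul]
    ring_nf

/-- The jump limits the L² modulus on the whole line to the exponent `1/2`, which exceeds `s/2`
because `s < 1`. -/
theorem levyOp_half_fnH1 {s : ℝ} (hs0 : 0 < s) (hs1 : s < 1) : ∃ K : ℝ, ∀ v : H1Rstar,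
    (∀ᵐ x, LevyConvergesAt (s / 2) (fnH1 v) x) ∧
      eLpNorm (levyOp (s / 2) (fnH1 v)) 2 volume ≤ ENNReal.ofReal (K * ‖v‖) := by
  refine ⟨|levyConst (s / 2)| *
    (5 * ∫ z : ℝ, min (|z| ^ (1 / 2 : ℝ)) 1 / |z| ^ (1 + s / 2)), fun v => ?_⟩
  have := levyOp_fnH1_of_translate_le (s := s / 2) (q := 1 / 2) (S := univ) (p := 2) (C := 5)
    (v := v) (by linarith) (by linarith) one_le_two ENNReal.ofNat_ne_top (by norm_num)
    (fun z => by simpa only [Measure.restrict_univ] using eLpNorm_translate_sub_fnH1_le v z)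
  rwa [Measure.restrict_univ] at this

/-- In L¹ the jump costs `|z|`, which suffices for all `s < 1`; the exponent `1/2` available in L²
would not. -/
theorem levyOp_fnH1_Ioo {s : ℝ} (hs0 : 0 < s) (hs1 : s < 1) {R : ℝ} (hR : 0 < R) :
    ∃ K : ℝ, ∀ v : H1Rstar, (∀ᵐ x ∂(volume.restrict (Ioo (-R) R)), LevyConvergesAt s (fnH1 v) x) ∧
      eLpNorm (levyOp s (fnH1 v)) 1 (volume.restrict (Ioo (-R) R)) ≤
        ENNReal.ofReal (K * ‖v‖) :=
  ⟨_, fun v => levyOp_fnH1_of_translate_le hs0 hs1 le_rfl ENNReal.one_ne_top (by positivity)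
    (eLpNorm_one_translate_sub_fnH1_le v hR)⟩

theorem levyOp_fnH1_compl_Icc {s : ℝ} (hs0 : 0 < s) (hs1 : s < 1) {R : ℝ} (hR : 0 < R) :
    ∃ K : ℝ, ∀ v : H1Rstar,
      (∀ᵐ x ∂(volume.restrict (Icc (-R) R)ᶜ), LevyConvergesAt s (fnH1 v) x) ∧
      eLpNorm (levyOp s (fnH1 v)) 2 (volume.restrict (Icc (-R) R)ᶜ) ≤ ENNReal.ofReal (K * ‖v‖) :=
  ⟨_, fun v => levyOp_fnH1_of_translate_le hs0 hs1 one_le_two ENNReal.ofNat_ne_top (by positivity)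
    (eLpNorm_two_translate_sub_fnH1_le v hR)⟩

theorem levyConvergesAt_fnH1 {s : ℝ} (hs0 : 0 < s) (hs1 : s < 1) (v : H1Rstar) :
    ∀ᵐ x, LevyConvergesAt s (fnH1 v) x := by
  have h : ∀ᵐ x, ∀ n : ℕ, x ∈ Ioo (-((n : ℝ) + 1)) (n + 1) → LevyConvergesAt s (fnH1 v) x := by
    refine ae_all_iff.2 fun n => ?_
    obtain ⟨K, hK⟩ := levyOp_fnH1_Ioo hs0 hs1 (R := (n : ℝ) + 1) (by positivity)
    exact (ae_restrict_iff' measurableSet_Ioo).1 (hK v).1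
  filter_upwards [h] with x hx
  obtain ⟨n, hn⟩ := exists_nat_gt |x|
  have := abs_lt.1 (hn.trans (lt_add_one (n : ℝ)))
  exact hx n this

theorem stronglyMeasurable_levyOp_fnH1 (s : ℝ) (v : H1Rstar) :
    StronglyMeasurable (levyOp s (fnH1 v)) := stronglyMeasurable_levyOp s (measurable_fnH1 v)

theorem levyOp_fnH1_add {s : ℝ} {v w : H1Rstar} (hv : ∀ᵐ x, LevyConvergesAt s (fnH1 v) x)
    (hw : ∀ᵐ x, LevyConvergesAt s (fnH1 w) x) :
    levyOp s (fnH1 (v + w)) =ᵐ[volume] levyOp s (fnH1 v) + levyOp s (fnH1 w) := by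
  filter_upwards [levyOp_congr_ae (s := s) (fnH1_add v w), hv, hw] with x hx h1 h2
  rw [hx, levyOp_add h1 h2, Pi.add_apply]

theorem levyOp_fnH1_smul (s c : ℝ) (v : H1Rstar) :
    levyOp s (fnH1 (c • v)) =ᵐ[volume] c • levyOp s (fnH1 v) := by
  filter_upwards [levyOp_congr_ae (s := s) (fnH1_smul c v)] with x hx
  rw [hx, levyOp_smul, Pi.smul_apply, smul_eq_mul]

theorem memLp_levyOp_half_fnH1 {s : ℝ} (hs0 : 0 < s) (hs1 : s < 1) (v : H1Rstar) :
    MemLp (levyOp (s / 2) (fnH1 v)) 2 volume := by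
  obtain ⟨K, hK⟩ := levyOp_half_fnH1 hs0 hs1
  exact ⟨(stronglyMeasurable_levyOp_fnH1 _ v).aestronglyMeasurable,
    (hK v).2.trans_lt ENNReal.ofReal_lt_top⟩

theorem memLp_levyOp_fnH1_Ioo {s : ℝ} (hs0 : 0 < s) (hs1 : s < 1) (v : H1Rstar) {R : ℝ}
    (hR : 0 < R) : MemLp (levyOp s (fnH1 v)) 1 (volume.restrict (Ioo (-R) R)) := by
  obtain ⟨K, hK⟩ := levyOp_fnH1_Ioo hs0 hs1 hR
  exact ⟨(stronglyMeasurable_levyOp_fnH1 _ v).aestronglyMeasurable,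
    (hK v).2.trans_lt ENNReal.ofReal_lt_top⟩

theorem memLp_levyOp_fnH1_compl_Icc {s : ℝ} (hs0 : 0 < s) (hs1 : s < 1) (v : H1Rstar) {R : ℝ}
    (hR : 0 < R) : MemLp (levyOp s (fnH1 v)) 2 (volume.restrict (Icc (-R) R)ᶜ) := by
  obtain ⟨K, hK⟩ := levyOp_fnH1_compl_Icc hs0 hs1 hR
  exact ⟨(stronglyMeasurable_levyOp_fnH1 _ v).aestronglyMeasurable,
    (hK v).2.trans_lt ENNReal.ofReal_lt_top⟩

theorem exists_levyL2 {s : ℝ} (hs0 : 0 < s) (hs1 : s < 1) :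
    ∃ T : H1Rstar →L[ℝ] Lp ℝ 2 (volume : Measure ℝ), ∀ v : H1Rstar,
      (∀ᵐ x, LevyConvergesAt (s / 2) (fnH1 v) x) ∧ T v =ᵐ[volume] levyOp (s / 2) (fnH1 v) := by
  obtain ⟨K, hK⟩ := levyOp_half_fnH1 hs0 hs1
  let T₀ : H1Rstar →ₗ[ℝ] Lp ℝ 2 (volume : Measure ℝ) :=
    { toFun := fun v => (memLp_levyOp_half_fnH1 hs0 hs1 v).toLp
      map_add' := fun v w => by
        rw [← MemLp.toLp_add]
        exact MemLp.toLp_congr _ _ (levyOp_fnH1_add (hK v).1 (hK w).1)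
      map_smul' := fun c v => by
        rw [RingHom.id_apply, ← MemLp.toLp_const_smul]
        exact MemLp.toLp_congr _ _ (levyOp_fnH1_smul _ c v) }
  have hT : ∀ v, ‖T₀ v‖ ≤ |K| * ‖v‖ := by
    intro v
    refine (Lp.norm_toLp _ (memLp_levyOp_half_fnH1 hs0 hs1 v)).trans_le ?_
    refine ENNReal.toReal_le_of_le_ofReal (by positivity) ((hK v).2.trans ?_)
    exact ENNReal.ofReal_le_ofReal (by gcongr; exact le_abs_self K)
  exact ⟨T₀.mkContinuous |K| hT, fun v =>
    ⟨(hK v).1, MemLp.coeFn_toLp (memLp_levyOp_half_fnH1 hs0 hs1 v)⟩⟩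

/-- The operator on `H¹(ℝ∖{0})`, with values in `L¹_loc(ℝ) ∩ L²_loc(ℝ̄∖{0})`. -/
noncomputable def levyLoc {s : ℝ} (hs0 : 0 < s) (hs1 : s < 1) : H1Rstar →ₗ[ℝ] LocSpace where
  toFun v := ⟨AEEqFun.mk (levyOp s (fnH1 v))
      (stronglyMeasurable_levyOp_fnH1 s v).aestronglyMeasurable, fun R => by
    have h := AEEqFun.coeFn_mk (μ := volume) (levyOp s (fnH1 v))
      (stronglyMeasurable_levyOp_fnH1 s v).aestronglyMeasurable
    exact ⟨(memLp_levyOp_fnH1_Ioo hs0 hs1 v R.2).ae_eq (ae_restrict_of_ae h.symm),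
      (memLp_levyOp_fnH1_compl_Icc hs0 hs1 v R.2).ae_eq (ae_restrict_of_ae h.symm)⟩⟩
  map_add' v w := by
    refine Subtype.ext (AEEqFun.ext ?_)
    filter_upwards [AEEqFun.coeFn_mk (levyOp s (fnH1 (v + w)))
        (stronglyMeasurable_levyOp_fnH1 s _).aestronglyMeasurable,
      AEEqFun.coeFn_add (AEEqFun.mk (levyOp s (fnH1 v))
          (stronglyMeasurable_levyOp_fnH1 s v).aestronglyMeasurable)
        (AEEqFun.mk (levyOp s (fnH1 w))
          (stronglyMeasurable_levyOp_fnH1 s w).aestronglyMeasurable),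
      AEEqFun.coeFn_mk (levyOp s (fnH1 v))
        (stronglyMeasurable_levyOp_fnH1 s _).aestronglyMeasurable,
      AEEqFun.coeFn_mk (levyOp s (fnH1 w))
        (stronglyMeasurable_levyOp_fnH1 s _).aestronglyMeasurable,
      levyOp_fnH1_add (levyConvergesAt_fnH1 hs0 hs1 v) (levyConvergesAt_fnH1 hs0 hs1 w)]
      with x h1 h2 h3 h4 h5
    refine h1.trans ?_
    rw [h5]
    refine Eq.trans ?_ h2.symm
    rw [Pi.add_apply, Pi.add_apply, h3, h4]
  map_smul' c v := by
    refine Subtype.ext (AEEqFun.ext ?_)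
    filter_upwards [AEEqFun.coeFn_mk (levyOp s (fnH1 (c • v)))
        (stronglyMeasurable_levyOp_fnH1 s _).aestronglyMeasurable,
      AEEqFun.coeFn_smul c (AEEqFun.mk (levyOp s (fnH1 v))
          (stronglyMeasurable_levyOp_fnH1 s v).aestronglyMeasurable),
      AEEqFun.coeFn_mk (levyOp s (fnH1 v))
        (stronglyMeasurable_levyOp_fnH1 s _).aestronglyMeasurable,
      levyOp_fnH1_smul s c v] with x h1 h2 h3 h4
    refine h1.trans ?_
    rw [h4]
    refine Eq.trans ?_ h2.symm
    rw [Pi.smul_apply, Pi.smul_apply, h3]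

theorem coeFn_levyLoc {s : ℝ} (hs0 : 0 < s) (hs1 : s < 1) (v : H1Rstar) :
    (levyLoc hs0 hs1 v).1 =ᵐ[volume] levyOp s (fnH1 v) :=
  AEEqFun.coeFn_mk (levyOp s (fnH1 v)) (stronglyMeasurable_levyOp_fnH1 s v).aestronglyMeasurable

/-- The topology of the target is induced by the restrictions, so continuity is tested on each of
them, where the composite is a bounded linear map between normed spaces. -/
theorem continuous_of_eLpNorm_sub_le {s : ℝ} (hs0 : 0 < s) (hs1 : s < 1) {S : Set ℝ}
    {p : ENNReal} [Fact (1 ≤ p)] (hT : ∀ v : H1Rstar,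
      MemLp ((levyLoc hs0 hs1 v).1 : ℝ → ℝ) p (volume.restrict S)) {K : ℝ}
    (hK : ∀ v : H1Rstar, eLpNorm (levyOp s (fnH1 v)) p (volume.restrict S) ≤
      ENNReal.ofReal (K * ‖v‖)) : Continuous fun v => (hT v).toLp := by
  let T₀ : H1Rstar →ₗ[ℝ] Lp ℝ p (volume.restrict S) :=
    { toFun := fun v => (hT v).toLp
      map_add' := fun v w => by
        rw [← MemLp.toLp_add]
        refine MemLp.toLp_congr _ _ ?_
        rw [map_add]
        exact ae_restrict_of_ae (AEEqFun.coeFn_add _ _)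
      map_smul' := fun c v => by
        rw [RingHom.id_apply, ← MemLp.toLp_const_smul]
        refine MemLp.toLp_congr _ _ ?_
        rw [map_smul]
        exact ae_restrict_of_ae (AEEqFun.coeFn_smul _ _) }
  refine (T₀.mkContinuous |K| fun v => ?_).continuous
  refine (Lp.norm_toLp _ (hT v)).trans_le ?_
  rw [eLpNorm_congr_ae (ae_restrict_of_ae (coeFn_levyLoc hs0 hs1 v))]
  refine ENNReal.toReal_le_of_le_ofReal (by positivity) ((hK v).trans ?_)
  exact ENNReal.ofReal_le_ofReal (by gcongr; exact le_abs_self K)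

theorem continuous_levyLoc {s : ℝ} (hs0 : 0 < s) (hs1 : s < 1) :
    Continuous (levyLoc hs0 hs1) := by
  refine continuous_iInf_rng.2 fun R => continuous_inf_rng.2
    ⟨continuous_induced_rng.2 ?_, continuous_induced_rng.2 ?_⟩
  · obtain ⟨K, hK⟩ := levyOp_fnH1_Ioo hs0 hs1 R.2
    exact continuous_of_eLpNorm_sub_le hs0 hs1 (fun v => ((levyLoc hs0 hs1 v).2 R).1)
      fun v => (hK v).2
  · obtain ⟨K, hK⟩ := levyOp_fnH1_compl_Icc hs0 hs1 R.2
    exact continuous_of_eLpNorm_sub_le hs0 hs1 (fun v => ((levyLoc hs0 hs1 v).2 R).2)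
      fun v => (hK v).2

/-! ### The operator on bounded `C¹` functions on the punctured line -/

instance : LocallyCompactSpace Rstar := isOpen_compl_singleton.locallyCompactSpace

/-- Dominated convergence with a parameter in this space needs countably generated neighbourhood
filters. -/
instance : FirstCountableTopology CbC1 := Topology.IsInducing.subtypeVal.firstCountableTopology

theorem extendZero_coe (f : Rstar → ℝ) (x : Rstar) : extendZero f x = f x :=
  Subtype.val_injective.extend_apply _ _ _

theorem extendZero_apply_zero (f : Rstar → ℝ) : extendZero f 0 = 0 :=
  Function.extend_apply' _ _ _ (by rintro ⟨⟨a, ha⟩, h⟩; exact ha h)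

theorem abs_fnCbC1_sub_le (v w : CbC1) (y : ℝ) :
    |fnCbC1 v y - fnCbC1 w y| ≤ ‖v.1.1 - w.1.1‖ := by
  rcases eq_or_ne y 0 with rfl | hy
  · simp [fnCbC1, extendZero_apply_zero]
  · have h1 := extendZero_coe v.1.1 ⟨y, hy⟩
    have h2 := extendZero_coe w.1.1 ⟨y, hy⟩
    simp only [fnCbC1]
    rw [h1, h2]
    exact (v.1.1 - w.1.1).norm_coe_le_norm ⟨y, hy⟩

theorem abs_fnCbC1_le (v : CbC1) (y : ℝ) : |fnCbC1 v y| ≤ ‖v.1.1‖ := by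
  rcases eq_or_ne y 0 with rfl | hy
  · simp [fnCbC1, extendZero_apply_zero]
  · have h1 := extendZero_coe v.1.1 ⟨y, hy⟩
    simp only [fnCbC1]
    rw [h1]
    exact v.1.1.norm_coe_le_norm ⟨y, hy⟩

theorem measurable_fnCbC1 (v : CbC1) : Measurable (fnCbC1 v) :=
  (MeasurableEmbedding.subtype_coe (measurableSet_singleton (0 : ℝ)).compl).measurable_extend
    v.1.1.continuous.measurable measurable_zero

theorem hasDerivAt_fnCbC1 (v : CbC1) {x : ℝ} (hx : x ≠ 0) :
    HasDerivAt (fnCbC1 v) (extendZero v.1.2 x) x := by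
  have h := v.2 ⟨x, hx⟩
  have h1 := extendZero_coe v.1.2 ⟨x, hx⟩
  simp only at h1
  rw [h1]
  exact h

/-- Joint continuity of evaluation off the origin: the change of function is controlled uniformly,
the change of point by the continuity of `v₀`. -/
theorem continuousAt_fnCbC1 (v₀ : CbC1) {X : Type*} [TopologicalSpace X] {V : X → CbC1} {g : X → ℝ}
    {a : X} (hV : ContinuousAt V a) (hVa : V a = v₀) (hg : ContinuousAt g a) (hga : g a ≠ 0) :
    ContinuousAt (fun p => fnCbC1 (V p) (g p)) a := by
  have h1 : ContinuousAt (fun p => fnCbC1 v₀ (g p)) a :=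
    ContinuousAt.comp (f := g) (hasDerivAt_fnCbC1 v₀ hga).continuousAt hg
  have hn : ContinuousAt (fun p => ‖(V p).1.1 - v₀.1.1‖) a :=
    (((continuous_fst.comp continuous_subtype_val).continuousAt.comp hV).sub
      continuousAt_const).norm
  have h2 : Tendsto (fun p => fnCbC1 (V p) (g p) - fnCbC1 v₀ (g p)) (𝓝 a) (𝓝 0) := by
    refine squeeze_zero_norm (fun p => abs_fnCbC1_sub_le _ _ _) ?_
    have := hn.tendsto
    simpa only [hVa, sub_self, norm_zero] using this
  have h3 := h2.add h1.tendsto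
  simp only [sub_add_cancel, zero_add] at h3
  subst hVa
  exact h3

/-- Nearness for the compact-open topology bounds the derivatives on a fixed ball around `x₀` that
avoids the origin, so the mean value inequality controls small increments. Large increments are
controlled by the sup norm. -/
theorem exists_bound_levyIntegrand_fnCbC1 (s : ℝ) (v₀ : CbC1) (x₀ : Rstar) :
    ∃ C : ℝ, ∀ᶠ p : CbC1 × Rstar in 𝓝 (v₀, x₀), ∀ z : ℝ,
      ‖levyIntegrand s (fnCbC1 p.1) p.2 z‖ ≤ C * (min (|z| ^ (1 : ℝ)) 1 / |z| ^ (1 + s)) := by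
  have hx₀ : (x₀ : ℝ) ≠ 0 := x₀.2
  -- The point moves by at most `ρ` and the increment adds at most `ρ`, so both end points stay in
  -- the ball of radius `2 * ρ`, half the distance to the origin.
  set ρ := |(x₀ : ℝ)| / 4 with hρ
  have hρ0 : 0 < ρ := by positivity
  set B := Metric.closedBall (x₀ : ℝ) (2 * ρ) with hB
  have hB0 : ∀ y ∈ B, y ≠ 0 := by
    rintro y hy rfl
    rw [hB, Metric.mem_closedBall, Real.dist_eq, zero_sub, abs_neg] at hy
    linarith [abs_pos.2 hx₀]
  set K : Set Rstar := Subtype.val ⁻¹' B with hK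
  have hKc : IsCompact K := by
    refine (Topology.IsInducing.subtypeVal.isCompact_preimage_iff ?_).2 (isCompact_closedBall _ _)
    intro y hy
    exact ⟨⟨y, hB0 y hy⟩, rfl⟩
  obtain ⟨C₀, hC₀⟩ := hKc.exists_bound_of_continuousOn v₀.1.2.continuous.continuousOn
  have hopen : IsOpen {v : CbC1 | MapsTo v.1.2 K (Metric.ball 0 (|C₀| + 1))} :=
    (ContinuousMap.isOpen_setOfPred_mapsTo hKc Metric.isOpen_ball).preimage
      (continuous_snd.comp continuous_subtype_val)
  have hmem : v₀ ∈ {v : CbC1 | MapsTo v.1.2 K (Metric.ball 0 (|C₀| + 1))} := by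
    intro x hx
    rw [mem_ball_zero_iff]
    exact (hC₀ x hx).trans_lt ((le_abs_self C₀).trans_lt (lt_add_one _))
  have hev1 : ∀ᶠ p : CbC1 × Rstar in 𝓝 (v₀, x₀), MapsTo p.1.1.2 K (Metric.ball 0 (|C₀| + 1)) :=
    continuousAt_fst.eventually (hopen.mem_nhds hmem)
  have hev2 : ∀ᶠ p : CbC1 × Rstar in 𝓝 (v₀, x₀), ‖p.1.1.1‖ < ‖v₀.1.1‖ + 1 := by
    have hc : Continuous fun p : CbC1 × Rstar => ‖p.1.1.1‖ :=
      (continuous_fst.comp (continuous_subtype_val.comp continuous_fst)).norm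
    exact (isOpen_lt hc continuous_const).mem_nhds (lt_add_one ‖v₀.1.1‖)
  have hev3 : ∀ᶠ p : CbC1 × Rstar in 𝓝 (v₀, x₀), (p.2 : ℝ) ∈ Metric.closedBall (x₀ : ℝ) ρ :=
    (continuous_subtype_val.comp continuous_snd).continuousAt.eventually
      (Metric.closedBall_mem_nhds _ hρ0)
  -- `A` dominates both the derivative bound and the oscillation bound. The term with `1 / ρ` makes
  -- `A * ρ` dominate the latter too, as needed when `ρ ≤ |z| ≤ 1`.
  set A := |C₀| + 1 + 2 * (‖v₀.1.1‖ + 1) * (1 + 1 / ρ) with hA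
  have hA0 : 0 ≤ 2 * (‖v₀.1.1‖ + 1) := by positivity
  have hρi : 0 < 1 / ρ := by positivity
  refine ⟨A * (1 + ρ), ?_⟩
  filter_upwards [hev1, hev2, hev3] with p h1 h2 h3 z
  rw [levyIntegrand, norm_div, Real.norm_of_nonneg (by positivity : 0 ≤ |z| ^ (1 + s)),
    ← mul_div_assoc, Real.rpow_one]
  gcongr
  have hbig : ‖fnCbC1 p.1 (p.2 + z) - fnCbC1 p.1 p.2‖ ≤ 2 * (‖v₀.1.1‖ + 1) := by
    refine (norm_sub_le _ _).trans ?_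
    have e1 := abs_fnCbC1_le p.1 (p.2 + z)
    have e2 := abs_fnCbC1_le p.1 p.2
    rw [Real.norm_eq_abs, Real.norm_eq_abs]
    linarith
  have hA1 : |C₀| + 1 ≤ A := by
    have : 0 ≤ 2 * (‖v₀.1.1‖ + 1) * (1 + 1 / ρ) := by positivity
    linarith
  have hA2 : 2 * (‖v₀.1.1‖ + 1) ≤ A := by nlinarith [abs_nonneg C₀]
  have hA3 : 2 * (‖v₀.1.1‖ + 1) ≤ A * ρ := by
    have e : A * ρ = (|C₀| + 1) * ρ + 2 * (‖v₀.1.1‖ + 1) * ρ + 2 * (‖v₀.1.1‖ + 1) := by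
      rw [hA]
      field_simp
      ring
    have : 0 ≤ (|C₀| + 1) * ρ := by positivity
    have : 0 ≤ 2 * (‖v₀.1.1‖ + 1) * ρ := by positivity
    linarith
  have hA00 : 0 ≤ A := hA0.trans hA2
  rcases le_total |z| ρ with hz | hz
  · have hmv : ‖fnCbC1 p.1 (p.2 + z) - fnCbC1 p.1 p.2‖ ≤ (|C₀| + 1) * ‖(p.2 : ℝ) + z - p.2‖ := by
      rw [Metric.mem_closedBall, Real.dist_eq] at h3
      refine (convex_closedBall (x₀ : ℝ) (2 * ρ)).norm_image_sub_le_of_norm_hasDerivWithin_le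
        (f' := extendZero p.1.1.2)
        (fun y hy => (hasDerivAt_fnCbC1 p.1 (hB0 y hy)).hasDerivWithinAt) (fun y hy => ?_) ?_ ?_
      · have e := extendZero_coe p.1.1.2 ⟨y, hB0 y hy⟩
        simp only at e
        rw [e]
        have := h1 (show (⟨y, hB0 y hy⟩ : Rstar) ∈ K from hy)
        rw [mem_ball_zero_iff] at this
        exact this.le
      · rw [Metric.mem_closedBall, Real.dist_eq]
        linarith
      · rw [Metric.mem_closedBall, Real.dist_eq]
        have : |(p.2 : ℝ) + z - x₀| ≤ |(p.2 : ℝ) - x₀| + |z| := by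
          rw [show (p.2 : ℝ) + z - x₀ = (p.2 - x₀) + z by ring]
          exact abs_add_le _ _
        linarith
    rw [add_sub_cancel_left, Real.norm_eq_abs z] at hmv
    rcases le_total |z| 1 with hz1 | hz1
    · rw [min_eq_left hz1]
      have e1 := mul_le_mul_of_nonneg_right hA1 (abs_nonneg z)
      have e2 : 0 ≤ A * ρ * |z| := by positivity
      linarith
    · rw [min_eq_right hz1]
      have : 0 ≤ A * ρ := by positivity
      linarith
  · rcases le_total |z| 1 with hz1 | hz1
    · rw [min_eq_left hz1]
      have e1 := mul_le_mul_of_nonneg_left hz hA00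
      have e2 : 0 ≤ A * ρ * |z| := by positivity
      nlinarith
    · rw [min_eq_right hz1]
      have : 0 ≤ A * ρ := by positivity
      linarith

theorem levyConvergesAt_fnCbC1 {s : ℝ} (hs0 : 0 < s) (hs1 : s < 1) (v : CbC1) (x : Rstar) :
    LevyConvergesAt s (fnCbC1 v) x := by
  obtain ⟨C, hC⟩ := exists_bound_levyIntegrand_fnCbC1 s v x
  exact ((integrable_min_rpow_div hs0 hs1).const_mul C).mono'
    (measurable_levyIntegrand s (measurable_fnCbC1 v)).of_uncurry_left.aestronglyMeasurable
    (Eventually.of_forall hC.self_of_nhds)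

/-- Dominated convergence; the integrand is continuous at `(v₀, x₀)` for every `z` except `-x₀`,
where the translate meets the origin. Joint continuity yields, by currying, continuity into the
compact-open topology. -/
theorem continuous_levyOp_fnCbC1 {s : ℝ} (hs0 : 0 < s) (hs1 : s < 1) :
    Continuous fun p : CbC1 × Rstar => levyOp s (fnCbC1 p.1) p.2 := by
  refine continuous_iff_continuousAt.2 fun ⟨v₀, x₀⟩ => ?_
  obtain ⟨C, hC⟩ := exists_bound_levyIntegrand_fnCbC1 s v₀ x₀
  refine continuousAt_const.mul (continuousAt_of_dominated
    (bound := fun z => C * (min (|z| ^ (1 : ℝ)) 1 / |z| ^ (1 + s)))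
    (Eventually.of_forall fun p =>
      (measurable_levyIntegrand s (measurable_fnCbC1 p.1)).of_uncurry_left.aestronglyMeasurable)
    (hC.mono fun p hp => Eventually.of_forall hp)
    ((integrable_min_rpow_div hs0 hs1).const_mul C) ?_)
  have hne : ∀ᵐ z : ℝ, z ≠ -x₀ := by simp [ae_iff]
  filter_upwards [hne] with z hz
  have hcx : ContinuousAt (fun p : CbC1 × Rstar => (p.2 : ℝ)) (v₀, x₀) :=
    (continuous_subtype_val.comp continuous_snd).continuousAt
  refine ((continuousAt_fnCbC1 v₀ continuousAt_fst rfl (hcx.add continuousAt_const) ?_).sub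
    (continuousAt_fnCbC1 v₀ continuousAt_fst rfl hcx x₀.2)).div_const _
  intro h
  have h' : (x₀ : ℝ) + z = 0 := h
  exact hz (by linarith)

theorem exists_levyCbC1 {s : ℝ} (hs0 : 0 < s) (hs1 : s < 1) :
    ∃ T : CbC1 →L[ℝ] C(Rstar, ℝ), ∀ (v : CbC1) (x : Rstar),
      LevyConvergesAt s (fnCbC1 v) x ∧ T v x = levyOp s (fnCbC1 v) x := by
  have hc := continuous_levyOp_fnCbC1 hs0 hs1
  let T : CbC1 → C(Rstar, ℝ) := fun v =>
    ⟨fun x => levyOp s (fnCbC1 v) x, hc.comp (Continuous.prodMk_right v)⟩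
  refine ⟨{ toFun := T, map_add' := fun v w => ?_, map_smul' := fun c v => ?_, cont := ?_ },
    fun v x => ⟨levyConvergesAt_fnCbC1 hs0 hs1 v x, rfl⟩⟩
  · ext x
    have : fnCbC1 (v + w) = fnCbC1 v + fnCbC1 w := extendZero_add v.1.1 w.1.1
    simp only [T, ContinuousMap.coe_mk, ContinuousMap.add_apply, this]
    exact levyOp_add (levyConvergesAt_fnCbC1 hs0 hs1 v x) (levyConvergesAt_fnCbC1 hs0 hs1 w x)
  · ext x
    have : fnCbC1 (c • v) = c • fnCbC1 v := extendZero_smul c v.1.1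
    simp only [T, ContinuousMap.coe_mk, ContinuousMap.smul_apply, this, RingHom.id_apply, smul_eq_mul]
    exact levyOp_smul s c _ _
  · exact ContinuousMap.continuous_of_continuous_uncurry T hc

/-! ### Parity and the strict maximum principle -/

theorem levyOp_odd_of_ae {s : ℝ} {v : ℝ → ℝ} (h : ∀ᵐ x, v (-x) = -v x) :
    ∀ᵐ x, levyOp s v (-x) = -levyOp s v x := by
  have h' : (fun x => v (-x)) =ᵐ[volume] (-1 : ℝ) • v := by
    filter_upwards [h] with x hx
    simp [hx]
  filter_upwards [levyOp_congr_ae (s := s) h'] with x hx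
  rw [← levyOp_comp_neg, hx, levyOp_smul, neg_one_mul]

theorem levyOp_even_of_ae {s : ℝ} {v : ℝ → ℝ} (h : ∀ᵐ x, v (-x) = v x) :
    ∀ᵐ x, levyOp s v (-x) = levyOp s v x := by
  have h' : (fun x => v (-x)) =ᵐ[volume] v := h
  filter_upwards [levyOp_congr_ae (s := s) h'] with x hx
  rw [← levyOp_comp_neg, hx]

/-- Centred at `x₀` and folded onto `y > 0` by oddness, the integrand becomes `(m - f y)/|y -
x₀|^(1+s) + (m + f y)/(y + x₀)^(1+s)`. It is nonnegative because the first kernel is the larger. It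
is positive off `x₀` wherever `f y < m`, and everywhere off `x₀` if `m > 0`; if `m = 0`, a point
with `f y < m` exists because `f` is odd and not zero. -/
theorem levyOp_pos_of_isMaxOn {s : ℝ} (hs0 : 0 < s) (hs1 : s < 1) {f : ℝ → ℝ} {x₀ : ℝ}
    (hx₀ : 0 < x₀) (hconv : LevyConvergesAt s f x₀) (hfc : ContinuousOn f (Ioi 0)) (hf : f ≠ 0)
    (hodd : Function.Odd f) (hmax : IsMaxOn f (Ioi 0) x₀) (h0 : 0 ≤ f x₀) :
    0 < levyOp s f x₀ := by
  set m := f x₀ with hm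
  set φ : ℝ → ℝ := fun y => (m - f y) / |y - x₀| ^ (1 + s) with hφ
  have hφi : Integrable φ := by
    have := (hconv.neg).comp_sub_right x₀
    refine this.congr (Eventually.of_forall fun y => ?_)
    simp only [levyIntegrand, Pi.neg_apply, hφ]
    rw [add_sub_cancel, ← neg_div, neg_sub]
  have hop : levyOp s f x₀ = levyConst s * ∫ y, φ y := by
    rw [levyOp, neg_mul, ← mul_neg, ← integral_neg,
      ← integral_sub_right_eq_self (fun z => -levyIntegrand s f x₀ z) x₀]
    congr 2
    ext y
    simp only [levyIntegrand, hφ]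
    rw [add_sub_cancel, ← neg_div, neg_sub]
  have hφn : IntegrableOn (fun y => φ (-y)) (Ioi 0) := hφi.comp_neg.integrableOn
  have hsplit : ∫ y, φ y = ∫ y in Ioi 0, (φ y + φ (-y)) := by
    rw [integral_add hφi.integrableOn hφn, integral_comp_neg_Ioi, neg_zero, add_comm,
      ← setIntegral_union (Iic_disjoint_Ioi le_rfl) measurableSet_Ioi hφi.integrableOn
        hφi.integrableOn, Iic_union_Ioi, setIntegral_univ]
  have hval : ∀ y ∈ Ioi (0 : ℝ), φ y + φ (-y) =
      (m - f y) / |y - x₀| ^ (1 + s) + (m + f y) / (y + x₀) ^ (1 + s) := by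
    intro y hy
    have hy' : 0 < y := hy
    have : |-y - x₀| = y + x₀ := by
      rw [show -y - x₀ = -(y + x₀) by ring, abs_neg, abs_of_pos (by linarith)]
    simp only [hφ]
    rw [this, hodd y, sub_neg_eq_add]
  -- With `k = |·|^(-1-s)` the sum is `(m - t)(k(y - x₀) - k(y + x₀)) + 2 m k(y + x₀)`, and `|y -
  -- x₀| < y + x₀` since both points are positive.
  have hker : ∀ y ∈ Ioi (0 : ℝ), y ≠ x₀ → ∀ t, 0 ≤ m - t → (0 < m ∨ 0 < m - t) →
      0 < (m - t) / |y - x₀| ^ (1 + s) + (m + t) / (y + x₀) ^ (1 + s) := by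
    intro y hy hyx t ht hpos
    have hy' : 0 < y := hy
    have h1 : 0 < |y - x₀| := abs_pos.2 (sub_ne_zero.2 hyx)
    have h2 : |y - x₀| < y + x₀ := abs_lt.2 ⟨by linarith, by linarith⟩
    have h3 : |y - x₀| ^ (1 + s) < (y + x₀) ^ (1 + s) :=
      Real.rpow_lt_rpow h1.le h2 (by linarith)
    have h4 : 0 < |y - x₀| ^ (1 + s) := Real.rpow_pos_of_pos h1 _
    have h5 : 1 / (y + x₀) ^ (1 + s) < 1 / |y - x₀| ^ (1 + s) := one_div_lt_one_div_of_lt h4 h3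
    have h6 : 0 < 1 / (y + x₀) ^ (1 + s) := one_div_pos.2 (h4.trans h3)
    have e : (m - t) / |y - x₀| ^ (1 + s) + (m + t) / (y + x₀) ^ (1 + s) =
        (m - t) * (1 / |y - x₀| ^ (1 + s) - 1 / (y + x₀) ^ (1 + s)) +
          2 * m * (1 / (y + x₀) ^ (1 + s)) := by ring
    rw [e]
    rcases hpos with hp | hp
    · have := mul_nonneg ht (sub_pos.2 h5).le
      have := mul_pos (mul_pos two_pos hp) h6
      linarith
    · have := mul_pos hp (sub_pos.2 h5)
      have := mul_nonneg (mul_nonneg zero_le_two h0) h6.le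
      linarith
  have hle : ∀ y ∈ Ioi (0 : ℝ), 0 ≤ m - f y := fun y hy => sub_nonneg.2 (hmax hy)
  have hnn : ∀ y ∈ Ioi (0 : ℝ), 0 ≤ φ y + φ (-y) := by
    intro y hy
    have hy' : 0 < y := hy
    rw [hval y hy]
    rcases eq_or_ne y x₀ with rfl | hyx
    · simp only [← hm, sub_self, zero_div, zero_add]
      positivity
    · rcases h0.eq_or_lt with hm0 | hm0
      · rcases (hle y hy).eq_or_lt with h | h
        · rw [← h, zero_div, zero_add]
          have : m + f y = 0 := by linarith
          rw [this, zero_div]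
        · exact (hker y hy hyx _ (hle y hy) (Or.inr h)).le
      · exact (hker y hy hyx _ (hle y hy) (Or.inl hm0)).le
  obtain ⟨y₁, hy₁, hpos₁⟩ : ∃ y₁ ∈ Ioi (0 : ℝ), 0 < m ∨ 0 < m - f y₁ := by
    rcases h0.eq_or_lt with hm0 | hm0
    · obtain ⟨y, hy⟩ := Function.ne_iff.1 hf
      simp only [Pi.zero_apply] at hy
      rcases lt_trichotomy y 0 with h | rfl | h
      · refine ⟨-y, neg_pos.2 h, Or.inr ?_⟩
        have h1 := hle (-y) (neg_pos.2 h)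
        refine lt_of_le_of_ne h1 fun h2 => hy ?_
        rw [hodd y] at h2
        linarith
      · exact absurd hodd.map_zero hy
      · refine ⟨y, h, Or.inr (lt_of_le_of_ne (hle y h) fun h2 => hy ?_)⟩
        linarith
    · exact ⟨1, mem_Ioi.2 one_pos, Or.inl hm0⟩
  -- An open nonempty set, hence of positive measure, on which the folded integrand is positive
  -- except possibly at `x₀`.
  set U : Set ℝ := {y | y ∈ Ioi (0 : ℝ) ∧ (0 < m ∨ 0 < m - f y)} with hU
  have hUo : IsOpen U := by
    by_cases hm0 : 0 < m
    · have : U = Ioi 0 := by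
        ext y
        simp [hU, hm0]
      rw [this]
      exact isOpen_Ioi
    · have : U = Ioi 0 ∩ f ⁻¹' Iio m := by
        ext y
        simp [hU, hm0]
      rw [this]
      exact hfc.isOpen_inter_preimage isOpen_Ioi isOpen_Iio
  have hUpos : 0 < volume U := hUo.measure_pos volume ⟨y₁, hy₁, hpos₁⟩
  rw [hop]
  refine mul_pos (levyConst_pos hs0 (by linarith)) ?_
  rw [hsplit, setIntegral_pos_iff_support_of_nonneg_ae
    ((ae_restrict_iff' measurableSet_Ioi).2 (Eventually.of_forall hnn))
    (hφi.integrableOn.add hφn)]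
  refine lt_of_lt_of_le ?_ (measure_mono (s := U \ {x₀}) ?_)
  · rwa [measure_sdiff_null (Real.volume_singleton)]
  · rintro y ⟨⟨hy, hp⟩, hyx⟩
    refine ⟨?_, hy⟩
    rw [Function.mem_support, hval y hy]
    exact (hker y hy hyx _ (hle y hy) hp).ne'

theorem levyOp_neg_of_isMinOn {s : ℝ} (hs0 : 0 < s) (hs1 : s < 1) {f : ℝ → ℝ} {x₀ : ℝ}
    (hx₀ : 0 < x₀) (hconv : LevyConvergesAt s f x₀) (hfc : ContinuousOn f (Ioi 0)) (hf : f ≠ 0)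
    (hodd : Function.Odd f) (hmin : IsMinOn f (Ioi 0) x₀) (h0 : f x₀ ≤ 0) :
    levyOp s f x₀ < 0 := by
  have hconv' : LevyConvergesAt s ((-1 : ℝ) • f) x₀ := by
    rw [LevyConvergesAt, levyIntegrand_smul]
    exact Integrable.smul _ hconv
  have e : (-1 : ℝ) • f = -f := by simp
  have := levyOp_pos_of_isMaxOn hs0 hs1 hx₀ hconv' (hfc.const_smul _)
    (by rw [e]; exact neg_ne_zero.2 hf)
    (by rw [e]; intro x; simp [hodd x]) (by rw [e]; exact hmin.neg)
    (by rw [e]; simpa using h0)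
  rw [levyOp_smul] at this
  linarith

open scoped ComplexConjugate

/-! ### Plancherel's formula for translates -/

theorem integral_schwartz_mul_fourier (a : Lp ℂ 2 (volume : Measure ℝ)) (φ : 𝓢(ℝ, ℂ)) :
    ∫ ξ, φ ξ * (𝓕 a : Lp ℂ 2 (volume : Measure ℝ)) ξ = ∫ x, (𝓕 φ) x * a x := by
  have h := congrArg (fun T : 𝓢'(ℝ, ℂ) => T φ) (Lp.fourier_toTemperedDistribution_eq a)
  simp only [TemperedDistribution.fourier_apply, Lp.toTemperedDistribution_apply, smul_eq_mul] at h
  exact h.symm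

theorem locallyIntegrable_Lp_two (a : Lp ℂ 2 (volume : Measure ℝ)) : LocallyIntegrable a volume :=
  (Lp.memLp a).locallyIntegrable one_le_two

/-- Two locally integrable functions with the same integrals against Schwartz functions are
equal. -/
theorem ae_eq_of_forall_integral_schwartz_mul_eq {f g : ℝ → ℂ} (hf : LocallyIntegrable f)
    (hg : LocallyIntegrable g)
    (h : ∀ φ : 𝓢(ℝ, ℂ), HasCompactSupport φ → ∫ x, φ x * f x = ∫ x, φ x * g x) :
    f =ᵐ[volume] g := by
  refine ae_eq_of_integral_contDiff_smul_eq hf hg fun φ hφ hφc => ?_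
  have hc : HasCompactSupport (Complex.ofRealCLM ∘ φ) := hφc.comp_left rfl
  have hs : ContDiff ℝ ∞ (Complex.ofRealCLM ∘ φ) := by fun_prop
  have := h (hc.toSchwartzMap hs) hc
  simpa using this

/-- Tested against `φ`: the phase times `φ` is again a test function, and its transform is the
translate of that of `φ` by `z`. Compact support makes the product Schwartz at once. -/
theorem fourier_translate {a a' : Lp ℂ 2 (volume : Measure ℝ)} {z : ℝ}
    (h : (a' : ℝ → ℂ) =ᵐ[volume] fun x => a (x + z)) :
    (𝓕 a' : Lp ℂ 2 (volume : Measure ℝ)) =ᵐ[volume] fun ξ =>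
      Complex.exp ((2 * Real.pi * z * ξ : ℝ) * Complex.I) *
        (𝓕 a : Lp ℂ 2 (volume : Measure ℝ)) ξ := by
  have hcs : ContDiff ℝ ∞ fun ξ : ℝ => Complex.exp ((2 * Real.pi * z * ξ : ℝ) * Complex.I) := by
    have : (fun ξ : ℝ => Complex.exp ((2 * Real.pi * z * ξ : ℝ) * Complex.I)) =
        fun ξ : ℝ => Complex.exp (2 * Real.pi * z * Complex.ofRealCLM ξ * Complex.I) := by
      ext ξ
      simp
    rw [this]
    fun_prop
  refine ae_eq_of_forall_integral_schwartz_mul_eq (locallyIntegrable_Lp_two _) ?_ ?_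
  · refine (locallyIntegrable_Lp_two (𝓕 a)).mono
      (hcs.continuous.aestronglyMeasurable.mul (Lp.aestronglyMeasurable _))
      (Eventually.of_forall fun ξ => ?_)
    rw [norm_mul, Complex.norm_exp_ofReal_mul_I, one_mul]
  intro φ hφc
  have hc : HasCompactSupport fun ξ : ℝ =>
      Complex.exp ((2 * Real.pi * z * ξ : ℝ) * Complex.I) * φ ξ := hφc.mul_left
  have hs : ContDiff ℝ ∞ fun ξ : ℝ =>
      Complex.exp ((2 * Real.pi * z * ξ : ℝ) * Complex.I) * φ ξ := hcs.mul (φ.smooth ⊤)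
  set ψ := hc.toSchwartzMap hs with hψ
  have hψv : ∀ ξ, ψ ξ = Complex.exp ((2 * Real.pi * z * ξ : ℝ) * Complex.I) * φ ξ := fun _ => rfl
  have hF : ∀ x, (𝓕 ψ) x = (𝓕 φ) (x - z) := by
    intro x
    rw [SchwartzMap.fourier_coe, SchwartzMap.fourier_coe, Real.fourier_eq', Real.fourier_eq']
    congr 1
    ext ξ
    simp only [hψv, smul_eq_mul]
    rw [← mul_assoc, ← Complex.exp_add]
    congr 2
    simp
    ring
  have e2 := integral_schwartz_mul_fourier a ψ
  simp only [hψv, hF] at e2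
  rw [integral_schwartz_mul_fourier]
  calc ∫ x, (𝓕 φ) x * a' x = ∫ x, (𝓕 φ) x * a (x + z) := by
        refine integral_congr_ae ?_
        filter_upwards [h] with x hx
        rw [hx]
    _ = ∫ x, (𝓕 φ) (x - z) * a x := by
        refine Eq.trans (integral_congr_ae (Eventually.of_forall fun x => ?_))
          (integral_add_right_eq_self (μ := volume) (fun x => (𝓕 φ) (x - z) * a x) z)
        change (𝓕 φ) x * a (x + z) = (𝓕 φ) (x + z - z) * a (x + z)
        rw [add_sub_cancel_right]
    _ = _ := by
        rw [← e2]
        congr 1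
        ext ξ
        ring

theorem integral_conj_mul_eq_fourier (a b : Lp ℂ 2 (volume : Measure ℝ)) :
    ∫ x, conj (b x) * a x = ∫ ξ, conj ((𝓕 b : Lp ℂ 2 (volume : Measure ℝ)) ξ) *
      (𝓕 a : Lp ℂ 2 (volume : Measure ℝ)) ξ := by
  have h := Lp.inner_fourier_eq b a
  rw [L2.inner_def, L2.inner_def] at h
  simp only [RCLike.inner_apply'] at h
  exact h.symm

theorem conj_exp_sub_one_mul (t : ℝ) :
    conj (Complex.exp (t * Complex.I) - 1) * (Complex.exp (t * Complex.I) - 1) =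
      ((2 * (1 - Real.cos t) : ℝ) : ℂ) := by
  rw [mul_comm, Complex.mul_conj, Complex.exp_mul_I, ← Complex.ofReal_cos, ← Complex.ofReal_sin]
  congr 1
  simp only [Complex.normSq_apply, Complex.sub_re, Complex.add_re, Complex.ofReal_re,
    Complex.mul_re, Complex.I_re, Complex.I_im, Complex.ofReal_im, Complex.one_re, Complex.sub_im,
    Complex.add_im, Complex.mul_im, Complex.one_im]
  nlinarith [Real.sin_sq_add_cos_sq t]

/-- Translation minus the identity is the multiplier `exp(2iπzξ) - 1`, whose squared modulus is `2(1
- cos(2πzξ))`. -/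
theorem integral_conj_translate_sub_mul (a b : Lp ℂ 2 (volume : Measure ℝ)) (z : ℝ) :
    ∫ x, conj (b (x + z) - b x) * (a (x + z) - a x) =
      ∫ ξ, ((2 * (1 - Real.cos (2 * Real.pi * z * ξ)) : ℝ) : ℂ) *
        (conj ((𝓕 b : Lp ℂ 2 (volume : Measure ℝ)) ξ) *
          (𝓕 a : Lp ℂ 2 (volume : Measure ℝ)) ξ) := by
  have hmp := measurePreserving_add_right (volume : Measure ℝ) z
  set τ : Lp ℂ 2 (volume : Measure ℝ) → Lp ℂ 2 (volume : Measure ℝ) :=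
    fun a => Lp.compMeasurePreserving (fun x => x + z) hmp a with hτ
  have hτv : ∀ a : Lp ℂ 2 (volume : Measure ℝ), (τ a : ℝ → ℂ) =ᵐ[volume] fun x => a (x + z) :=
    fun a => Lp.coeFn_compMeasurePreserving a hmp
  have hd : ∀ a : Lp ℂ 2 (volume : Measure ℝ), (τ a - a : Lp ℂ 2 (volume : Measure ℝ)) =ᵐ[volume]
      fun x => a (x + z) - a x := by
    intro a
    filter_upwards [Lp.coeFn_sub (τ a) a, hτv a] with x h1 h2
    rw [h1, Pi.sub_apply, h2]
  have hFd : ∀ a : Lp ℂ 2 (volume : Measure ℝ),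
      (𝓕 (τ a - a) : Lp ℂ 2 (volume : Measure ℝ)) =ᵐ[volume] fun ξ =>
        (Complex.exp ((2 * Real.pi * z * ξ : ℝ) * Complex.I) - 1) *
          (𝓕 a : Lp ℂ 2 (volume : Measure ℝ)) ξ := by
    intro a
    have hs : (𝓕 (τ a - a) : Lp ℂ 2 (volume : Measure ℝ)) = 𝓕 (τ a) - 𝓕 a :=
      map_sub (Lp.fourierTransformₗᵢ ℝ ℂ) (τ a) a
    rw [hs]
    filter_upwards [Lp.coeFn_sub (𝓕 (τ a) : Lp ℂ 2 (volume : Measure ℝ)) (𝓕 a),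
      fourier_translate (hτv a)] with ξ h1 h2
    rw [h1, Pi.sub_apply, h2]
    ring
  have key := integral_conj_mul_eq_fourier (τ a - a) (τ b - b)
  have e : ∫ x, conj (b (x + z) - b x) * (a (x + z) - a x) =
      ∫ x, conj ((τ b - b : Lp ℂ 2 (volume : Measure ℝ)) x) *
        (τ a - a : Lp ℂ 2 (volume : Measure ℝ)) x :=
    integral_congr_ae (by filter_upwards [hd a, hd b] with x h1 h2; rw [h1, h2])
  rw [e, key]
  refine integral_congr_ae ?_
  filter_upwards [hFd a, hFd b] with ξ h1 h2
  rw [h1, h2, map_mul, ← conj_exp_sub_one_mul]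
  ring

/-! ### The bilinear form of the operator -/

theorem lintegral_enorm_mul_enorm_le {f : ℝ → ℂ} {h : ℝ → ℝ} (hf : AEStronglyMeasurable f volume)
    (hh : AEStronglyMeasurable h volume) :
    ∫⁻ x, ‖f x‖ₑ * ‖h x‖ₑ ≤ eLpNorm f 2 volume * eLpNorm h 2 volume := by
  have := ENNReal.lintegral_mul_le_Lp_mul_Lq volume Real.HolderConjugate.two_two hf.enorm hh.enorm
  rw [eLpNorm_eq_lintegral_rpow_enorm_toReal two_ne_zero ENNReal.ofNat_ne_top,
    eLpNorm_eq_lintegral_rpow_enorm_toReal two_ne_zero ENNReal.ofNat_ne_top]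
  simpa using this

/-- The regular part is paired in L² with `b`, the jump in L¹ with the bound on `b`. Boundedness of
`b` thus yields the full order `|z|`, where L² alone would give `|z|^(1/2)`. -/
theorem lintegral_mul_translate_sub_fnH1_le (v : H1Rstar) (b : Lp ℂ 2 (volume : Measure ℝ)) {B : ℝ}
    (hB0 : 0 ≤ B) (hB : ∀ᵐ x, ‖b x‖ ≤ B) (z : ℝ) :
    ∫⁻ x, ‖b x‖ₑ * ‖fnH1 v (x + z) - fnH1 v x‖ₑ ≤
      ENNReal.ofReal ((2 * ‖b‖ * ‖v‖ + 4 * ‖v‖ * B) * min (|z| ^ (1 : ℝ)) 1) := by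
  have hb := Lp.aestronglyMeasurable b
  have hb2 : eLpNorm b 2 volume = ENNReal.ofReal ‖b‖ := by rw [← Lp.enorm_def, ofReal_norm]
  have hm := measurable_fnH1 v
  have hdm : AEStronglyMeasurable (fun x => fnH1 v (x + z) - fnH1 v x) volume :=
    ((hm.comp (measurable_add_const z)).sub hm).aestronglyMeasurable
  rw [Real.rpow_one]
  rcases le_total |z| 1 with hz | hz
  · rw [min_eq_left hz]
    obtain ⟨J, hJ, h⟩ := exists_translate_sub_fnH1_ae_eq v
    have ha := aestronglyMeasurable_integral_derivH1 v z
    have h1 : ∫⁻ x, ‖b x‖ₑ * ‖∫ t in x..(x + z), derivH1 v t‖ₑ ≤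
        ENNReal.ofReal (‖b‖ * (|z| * ‖v‖)) := by
      refine (lintegral_enorm_mul_enorm_le hb ha).trans ?_
      rw [hb2, ENNReal.ofReal_mul (norm_nonneg b)]
      gcongr
      exact eLpNorm_integral_derivH1_le v z
    have h2 : ∫⁻ x, ‖b x‖ₑ * ‖J * jumpFn z x‖ₑ ≤ ENNReal.ofReal (B * (4 * ‖v‖ * |z|)) := by
      calc _ ≤ ∫⁻ x, ENNReal.ofReal B * (ENNReal.ofReal (4 * ‖v‖) * ‖jumpFn z x‖ₑ) := by
            refine lintegral_mono_ae ?_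
            filter_upwards [hB] with x hx
            rw [enorm_mul, ← ofReal_norm, Real.enorm_eq_ofReal_abs J]
            gcongr
        _ = ENNReal.ofReal B * (ENNReal.ofReal (4 * ‖v‖) * eLpNorm (jumpFn z) 1 volume) := by
            rw [lintegral_const_mul' _ _ ENNReal.ofReal_ne_top,
              lintegral_const_mul' _ _ ENNReal.ofReal_ne_top, eLpNorm_one_eq_lintegral_enorm]
        _ ≤ _ := by
            have hj : eLpNorm (jumpFn z) 1 volume ≤ ENNReal.ofReal |z| := by
              simpa using eLpNorm_jumpFn_le z one_ne_zero ENNReal.one_ne_top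
            rw [ENNReal.ofReal_mul hB0, ENNReal.ofReal_mul (p := 4 * ‖v‖) (by positivity)]
            exact mul_le_mul_right (mul_le_mul_right hj _) _
    calc ∫⁻ x, ‖b x‖ₑ * ‖fnH1 v (x + z) - fnH1 v x‖ₑ
        ≤ ∫⁻ x, (‖b x‖ₑ * ‖∫ t in x..(x + z), derivH1 v t‖ₑ + ‖b x‖ₑ * ‖J * jumpFn z x‖ₑ) := by
          refine lintegral_mono_ae ?_
          filter_upwards [h z] with x hx
          rw [hx, ← mul_add]
          gcongr
          exact enorm_add_le _ _
      _ = _ := lintegral_add_left' (hb.enorm.mul ha.enorm) _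
      _ ≤ _ := add_le_add h1 h2
      _ ≤ _ := by
          rw [← ENNReal.ofReal_add (by positivity) (by positivity)]
          refine ENNReal.ofReal_le_ofReal ?_
          have : 0 ≤ ‖b‖ * (|z| * ‖v‖) := by positivity
          linarith
  · rw [min_eq_right hz]
    refine (lintegral_enorm_mul_enorm_le hb hdm).trans ?_
    rw [hb2]
    refine (mul_le_mul_right (eLpNorm_translate_sub_fnH1_le_two v z) _).trans ?_
    rw [← ENNReal.ofReal_mul (norm_nonneg b)]
    refine ENNReal.ofReal_le_ofReal ?_
    have : 0 ≤ 4 * ‖v‖ * B := by positivity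
    linarith

theorem integrable_conj_mul_levyIntegrand {s : ℝ} (hs0 : 0 < s) (hs1 : s < 1) (v : H1Rstar)
    (b : Lp ℂ 2 (volume : Measure ℝ)) {B : ℝ} (hB : ∀ᵐ x, ‖b x‖ ≤ B) :
    Integrable (fun p : ℝ × ℝ => conj (b p.1) * (levyIntegrand s (fnH1 v) p.1 p.2 : ℂ))
      (volume.prod volume) := by
  have hbm : Measurable b := (Lp.stronglyMeasurable b).measurable
  have hlm : Measurable fun p : ℝ × ℝ => levyIntegrand s (fnH1 v) p.1 p.2 :=
    measurable_levyIntegrand s (measurable_fnH1 v)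
  have hm : Measurable fun p : ℝ × ℝ => conj (b p.1) * (levyIntegrand s (fnH1 v) p.1 p.2 : ℂ) :=
    (Complex.continuous_conj.measurable.comp (hbm.comp measurable_fst)).mul
      (Complex.measurable_ofReal.comp hlm)
  refine ⟨hm.aestronglyMeasurable, ?_⟩
  have hB' : ∀ᵐ x, ‖b x‖ ≤ |B| := by
    filter_upwards [hB] with x hx using hx.trans (le_abs_self B)
  have hi := (integrable_min_rpow_div hs0 hs1).const_mul (2 * ‖b‖ * ‖v‖ + 4 * ‖v‖ * |B|)
  rw [hasFiniteIntegral_iff_enorm, lintegral_prod_symm _ hm.enorm.aemeasurable]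
  refine lt_of_le_of_lt (lintegral_mono fun z => ?_) hi.lintegral_lt_top
  have e : ∀ x, ‖conj (b x) * (levyIntegrand s (fnH1 v) x z : ℂ)‖ₑ =
      ENNReal.ofReal ((|z| ^ (1 + s))⁻¹) * (‖b x‖ₑ * ‖fnH1 v (x + z) - fnH1 v x‖ₑ) := by
    intro x
    rw [← ofReal_norm, norm_mul, RCLike.norm_conj, Complex.norm_real, levyIntegrand, norm_div,
      Real.norm_of_nonneg (by positivity : 0 ≤ |z| ^ (1 + s)), ← ofReal_norm, ← ofReal_norm,
      ← ENNReal.ofReal_mul (norm_nonneg _), ← ENNReal.ofReal_mul (by positivity)]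
    congr 1
    ring
  simp only [e]
  rw [lintegral_const_mul' _ _ ENNReal.ofReal_ne_top]
  refine (mul_le_mul_right (lintegral_mul_translate_sub_fnH1_le v b (abs_nonneg B) hB' z) _).trans
    (le_of_eq ?_)
  rw [← ENNReal.ofReal_mul (by positivity)]
  congr 1
  ring

theorem coeFn_toL2CH1 (v : H1Rstar) : toL2CH1 v =ᵐ[volume] fun x => (fnH1 v x : ℂ) :=
  ContinuousLinearMap.coeFn_compLp _ _

/-- The map `(x, z) ↦ (x + z, -z)` preserves the measure and the kernel and changes the sign of the
difference of `v`. Adding the two expressions replaces `b(x)` by minus the difference of `b`, and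
Plancherel applies for each fixed `z`. -/
theorem integral_conj_mul_levyIntegrand {s : ℝ} (hs0 : 0 < s) (hs1 : s < 1) (v : H1Rstar)
    (b : Lp ℂ 2 (volume : Measure ℝ)) {B : ℝ} (hB : ∀ᵐ x, ‖b x‖ ≤ B) :
    ∫ p : ℝ × ℝ, conj (b p.1) * (levyIntegrand s (fnH1 v) p.1 p.2 : ℂ) ∂(volume.prod volume) =
      -∫ z : ℝ, ∫ ξ, (((1 - Real.cos (2 * Real.pi * z * ξ)) / |z| ^ (1 + s) : ℝ) : ℂ) *
        (conj ((𝓕 b : Lp ℂ 2 (volume : Measure ℝ)) ξ) *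
          (𝓕 (toL2CH1 v) : Lp ℂ 2 (volume : Measure ℝ)) ξ) := by
  have hF := integrable_conj_mul_levyIntegrand hs0 hs1 v b hB
  set F : ℝ × ℝ → ℂ := fun p => conj (b p.1) * (levyIntegrand s (fnH1 v) p.1 p.2 : ℂ) with hFdef
  -- Pairs are read as `(z, x)` here, so that the inner integral is the one over `x`.
  have hmp : MeasurePreserving (fun p : ℝ × ℝ => (p.2 + p.1, -p.1)) (volume.prod volume)
      (volume.prod volume) := measurePreserving_add_prod_neg _ _
  have h1 : ∫ p : ℝ × ℝ, F p.swap ∂(volume.prod volume) = ∫ p, F p ∂(volume.prod volume) :=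
    integral_prod_swap F
  have h2 : ∫ p : ℝ × ℝ, F (p.2 + p.1, -p.1) ∂(volume.prod volume) =
      ∫ p, F p ∂(volume.prod volume) := by
    have h := hmp.map_eq
    have h' := integral_map (f := F) hmp.measurable.aemeasurable
      (by rw [h]; exact hF.aestronglyMeasurable)
    rw [h] at h'
    exact h'.symm
  have hF1 : Integrable (fun p : ℝ × ℝ => F p.swap) (volume.prod volume) := hF.swap
  have hF2 : Integrable (fun p : ℝ × ℝ => F (p.2 + p.1, -p.1)) (volume.prod volume) :=
    hmp.integrable_comp_of_integrable hF
  have hsum := integral_add hF1 hF2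
  rw [h1, h2] at hsum
  have hF3 := hF1.add hF2
  have hsum' : ∫ p : ℝ × ℝ, (F p.swap + F (p.2 + p.1, -p.1)) ∂(volume.prod volume) =
      ∫ z, ∫ x, (F (x, z) + F (x + z, -z)) := integral_prod _ hF3
  have hpt : ∀ z x, F (x, z) + F (x + z, -z) = -((|z| ^ (1 + s))⁻¹ : ℝ) *
      (conj (b (x + z) - b x) * ((fnH1 v (x + z) : ℂ) - fnH1 v x)) := by
    intro z x
    simp only [hFdef, levyIntegrand, abs_neg, add_neg_cancel_right, map_sub]
    push_cast
    ring
  have hz : ∀ z, ∫ x, (F (x, z) + F (x + z, -z)) =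
      -(2 * ∫ ξ, (((1 - Real.cos (2 * Real.pi * z * ξ)) / |z| ^ (1 + s) : ℝ) : ℂ) *
        (conj ((𝓕 b : Lp ℂ 2 (volume : Measure ℝ)) ξ) *
          (𝓕 (toL2CH1 v) : Lp ℂ 2 (volume : Measure ℝ)) ξ)) := by
    intro z
    have hv := coeFn_toL2CH1 v
    have hvz : ∀ᵐ x, toL2CH1 v (x + z) = (fnH1 v (x + z) : ℂ) :=
      (measurePreserving_add_right volume z).quasiMeasurePreserving.ae hv
    have e : ∫ x, (F (x, z) + F (x + z, -z)) = ∫ x, -((|z| ^ (1 + s))⁻¹ : ℝ) *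
        (conj (b (x + z) - b x) * (toL2CH1 v (x + z) - toL2CH1 v x)) := by
      refine integral_congr_ae ?_
      filter_upwards [hv, hvz] with x h3 h4
      rw [hpt, h3, h4]
    rw [e, integral_const_mul, integral_conj_translate_sub_mul, ← integral_const_mul,
      ← integral_const_mul, ← integral_neg]
    congr 1
    ext ξ
    push_cast
    ring
  rw [hsum'] at hsum
  simp_rw [hz] at hsum
  rw [integral_neg, integral_const_mul] at hsum
  -- The two copies of the form add up to minus twice the Fourier side.
  linear_combination -(1 / 2 : ℂ) * hsum

/-- The kernel is nonnegative, so integrating the modulus in `z` gives `|ξ|^s ‖c ξ‖` divided by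
`levyConst s`; Tonelli concludes. -/
theorem integrable_one_sub_cos_div_mul {s : ℝ} (hs0 : 0 < s) (hs1 : s < 2) {c : ℝ → ℂ}
    (hcm : AEStronglyMeasurable c volume) (hc : Integrable fun ξ : ℝ => ((|ξ| ^ s : ℝ) : ℂ) * c ξ) :
    Integrable (fun p : ℝ × ℝ => (((1 - Real.cos (2 * Real.pi * p.1 * p.2)) / |p.1| ^ (1 + s) : ℝ) : ℂ)
      * c p.2) (volume.prod volume) := by
  have hkm : Measurable fun p : ℝ × ℝ =>
      (1 - Real.cos (2 * Real.pi * p.1 * p.2)) / |p.1| ^ (1 + s) := by fun_prop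
  have hm : AEStronglyMeasurable (fun p : ℝ × ℝ =>
      (((1 - Real.cos (2 * Real.pi * p.1 * p.2)) / |p.1| ^ (1 + s) : ℝ) : ℂ) * c p.2)
      (volume.prod volume) :=
    (Complex.measurable_ofReal.comp hkm).aestronglyMeasurable.mul hcm.comp_snd
  have hnn : ∀ z ξ : ℝ, 0 ≤ (1 - Real.cos (2 * Real.pi * z * ξ)) / |z| ^ (1 + s) := by
    intro z ξ
    have : 0 ≤ 1 - Real.cos (2 * Real.pi * z * ξ) := by
      linarith [Real.cos_le_one (2 * Real.pi * z * ξ)]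
    positivity
  have hG := levyConst_pos hs0 hs1
  refine (integrable_prod_iff' hm).2 ⟨Eventually.of_forall fun ξ => ?_, ?_⟩
  · exact ((integrable_one_sub_cos_div hs0 hs1 ξ).ofReal (𝕜 := ℂ)).mul_const (c ξ)
  · refine (hc.norm.const_mul (levyConst s)⁻¹).congr (Eventually.of_forall fun ξ => ?_)
    simp only [norm_mul, Complex.norm_real, Real.norm_of_nonneg (hnn _ _)]
    rw [integral_mul_const, Real.norm_of_nonneg (by positivity : 0 ≤ |ξ| ^ s),
      ← levyConst_mul_integral_one_sub_cos hs0 hs1 ξ, mul_assoc, inv_mul_cancel_left₀ hG.ne']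

theorem integral_integral_one_sub_cos_mul {s : ℝ} (hs0 : 0 < s) (hs1 : s < 2) {c : ℝ → ℂ}
    (hcm : AEStronglyMeasurable c volume) (hc : Integrable fun ξ : ℝ => ((|ξ| ^ s : ℝ) : ℂ) * c ξ) :
    levyConst s * ∫ z : ℝ, ∫ ξ, (((1 - Real.cos (2 * Real.pi * z * ξ)) / |z| ^ (1 + s) : ℝ) : ℂ) *
      c ξ = ∫ ξ : ℝ, ((|ξ| ^ s : ℝ) : ℂ) * c ξ := by
  rw [integral_integral_swap (integrable_one_sub_cos_div_mul hs0 hs1 hcm hc), ← integral_const_mul]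
  congr 1
  ext ξ
  rw [integral_mul_const, integral_complex_ofReal, ← mul_assoc, ← Complex.ofReal_mul,
    levyConst_mul_integral_one_sub_cos hs0 hs1 ξ]

theorem integrable_conj_mul_levyOp {s : ℝ} (hs0 : 0 < s) (hs1 : s < 1) (v : H1Rstar)
    (b : Lp ℂ 2 (volume : Measure ℝ)) {B : ℝ} (hB : ∀ᵐ x, ‖b x‖ ≤ B) :
    Integrable fun x => conj (b x) * (levyOp s (fnH1 v) x : ℂ) := by
  have := (integrable_conj_mul_levyIntegrand hs0 hs1 v b hB).integral_prod_left.const_mul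
    (-levyConst s : ℂ)
  refine this.congr (Eventually.of_forall fun x => ?_)
  simp only [levyOp]
  rw [integral_const_mul, integral_complex_ofReal]
  push_cast
  ring

/-- The form of the operator in terms of the Fourier transform. -/
theorem integral_conj_mul_levyOp {s : ℝ} (hs0 : 0 < s) (hs1 : s < 1) (v : H1Rstar)
    (b : Lp ℂ 2 (volume : Measure ℝ)) {B : ℝ} (hB : ∀ᵐ x, ‖b x‖ ≤ B)
    (hc : Integrable fun ξ : ℝ => ((|ξ| ^ s : ℝ) : ℂ) *
      (conj ((𝓕 b : Lp ℂ 2 (volume : Measure ℝ)) ξ) *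
        (𝓕 (toL2CH1 v) : Lp ℂ 2 (volume : Measure ℝ)) ξ)) :
    ∫ x, conj (b x) * (levyOp s (fnH1 v) x : ℂ) = ∫ ξ : ℝ, ((|ξ| ^ s : ℝ) : ℂ) *
      (conj ((𝓕 b : Lp ℂ 2 (volume : Measure ℝ)) ξ) *
        (𝓕 (toL2CH1 v) : Lp ℂ 2 (volume : Measure ℝ)) ξ) := by
  have hcm : AEStronglyMeasurable (fun ξ => conj ((𝓕 b : Lp ℂ 2 (volume : Measure ℝ)) ξ) *
      (𝓕 (toL2CH1 v) : Lp ℂ 2 (volume : Measure ℝ)) ξ) volume :=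
    (Complex.continuous_conj.comp_aestronglyMeasurable (Lp.aestronglyMeasurable _)).mul
      (Lp.aestronglyMeasurable _)
  rw [← integral_integral_one_sub_cos_mul hs0 (by linarith) hcm hc]
  have h1 := integral_conj_mul_levyIntegrand hs0 hs1 v b hB
  rw [integral_prod _ (integrable_conj_mul_levyIntegrand hs0 hs1 v b hB)] at h1
  have h2 : ∀ x, conj (b x) * (levyOp s (fnH1 v) x : ℂ) =
      -(levyConst s : ℂ) * ∫ z, conj (b x) * (levyIntegrand s (fnH1 v) x z : ℂ) := by
    intro x
    rw [integral_const_mul, levyOp, integral_complex_ofReal]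
    push_cast
    ring
  simp_rw [h2]
  rw [integral_const_mul, h1]
  ring

/-! ### The operator as a Fourier multiplier -/

theorem Real.rpow_abs_le_one_add_sq {t : ℝ} (ht0 : 0 < t) (ht1 : t < 1) (ξ : ℝ) :
    |ξ| ^ t ≤ 1 + ξ ^ 2 := by
  rcases le_total |ξ| 1 with h | h
  · exact (Real.rpow_le_one (abs_nonneg _) h ht0.le).trans (by nlinarith [sq_nonneg ξ])
  · calc |ξ| ^ t ≤ |ξ| ^ (2 : ℝ) := Real.rpow_le_rpow_of_exponent_le h (by linarith)
      _ = ξ ^ 2 := by rw [Real.rpow_two, sq_abs]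
      _ ≤ _ := by linarith

/-- The complex conjugate of a Schwartz function. -/
noncomputable def SchwartzMap.conjugate (φ : 𝓢(ℝ, ℂ)) : 𝓢(ℝ, ℂ) :=
  φ.postcompCLM (Complex.conjCLE : ℂ →L[ℝ] ℂ)

theorem SchwartzMap.conjugate_apply (φ : 𝓢(ℝ, ℂ)) (x : ℝ) : φ.conjugate x = conj (φ x) := rfl

/-- Conjugation exchanges the transform and its inverse. -/
theorem SchwartzMap.fourier_conjugate_fourier (φ : 𝓢(ℝ, ℂ)) :
    𝓕 (𝓕 φ).conjugate = φ.conjugate := by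
  ext ξ
  have h : 𝓕⁻ (𝓕 φ) = φ := FourierTransform.fourierInv_fourier_eq φ
  rw [conjugate_apply]
  nth_rewrite 2 [← h]
  rw [SchwartzMap.fourier_coe, SchwartzMap.fourierInv_coe, Real.fourier_eq', Real.fourierInv_eq',
    ← integral_conj]
  congr 1
  ext x
  rw [conjugate_apply, smul_eq_mul, smul_eq_mul, map_mul, ← Complex.exp_conj]
  congr 2
  simp [Complex.conj_ofNat]

/-- The multiplier is not smooth at the origin, so it is dominated by `1 + ξ²`, which maps Schwartz
functions to Schwartz functions. -/
theorem integrable_schwartz_mul_rpow_mul {t : ℝ} (ht0 : 0 < t) (ht1 : t < 1) (φ : 𝓢(ℝ, ℂ))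
    (a : Lp ℂ 2 (volume : Measure ℝ)) :
    Integrable fun ξ : ℝ => φ ξ * (((|ξ| ^ t : ℝ) : ℂ) * a ξ) := by
  have hg : Function.HasTemperateGrowth fun ξ : ℝ => 1 + (ξ : ℂ) ^ 2 := by fun_prop
  have h := ((SchwartzMap.smulLeftCLM ℂ (fun ξ : ℝ => 1 + (ξ : ℂ) ^ 2) φ).memLp 2
    volume).integrable_mul (Lp.memLp a)
  have hc : Continuous fun ξ : ℝ => ((|ξ| ^ t : ℝ) : ℂ) :=
    Complex.continuous_ofReal.comp (continuous_abs.rpow_const fun _ => Or.inr ht0.le)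
  refine h.mono (φ.continuous.aestronglyMeasurable.mul
    (hc.aestronglyMeasurable.mul (Lp.aestronglyMeasurable a))) (Eventually.of_forall fun ξ => ?_)
  have e : (1 + (ξ : ℂ) ^ 2) = ((1 + ξ ^ 2 : ℝ) : ℂ) := by push_cast; ring
  rw [Pi.mul_apply, SchwartzMap.smulLeftCLM_apply_apply hg, smul_eq_mul, e, norm_mul, norm_mul,
    norm_mul, norm_mul, Complex.norm_real, Complex.norm_real,
    Real.norm_of_nonneg (by positivity : 0 ≤ |ξ| ^ t),
    Real.norm_of_nonneg (by positivity : 0 ≤ 1 + ξ ^ 2), mul_left_comm, ← mul_assoc]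
  gcongr
  exact Real.rpow_abs_le_one_add_sq ht0 ht1 ξ

/-- The bilinear formula with `b` the conjugate of `𝓕 φ`, a bounded L² function whose transform is
the conjugate of `φ`. -/
theorem integral_fourier_mul_levyOp {t : ℝ} (ht0 : 0 < t) (ht1 : t < 1) (v : H1Rstar)
    (φ : 𝓢(ℝ, ℂ)) :
    Integrable (fun x => (𝓕 φ) x * (levyOp t (fnH1 v) x : ℂ)) ∧
    ∫ x, (𝓕 φ) x * (levyOp t (fnH1 v) x : ℂ) =
      ∫ ξ : ℝ, φ ξ * (((|ξ| ^ t : ℝ) : ℂ) *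
        (𝓕 (toL2CH1 v) : Lp ℂ 2 (volume : Measure ℝ)) ξ) := by
  set b : Lp ℂ 2 (volume : Measure ℝ) := (𝓕 φ).conjugate.toLp 2 with hb
  have hbx : b =ᵐ[volume] fun x => conj ((𝓕 φ) x) := by
    filter_upwards [SchwartzMap.coeFn_toLp (𝓕 φ).conjugate 2 volume] with x hx
    rw [hb, hx, SchwartzMap.conjugate_apply]
  have hFb : (𝓕 b : Lp ℂ 2 (volume : Measure ℝ)) =ᵐ[volume] fun ξ => conj (φ ξ) := by
    rw [hb, SchwartzMap.toLp_fourier_eq, SchwartzMap.fourier_conjugate_fourier]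
    filter_upwards [SchwartzMap.coeFn_toLp φ.conjugate 2 volume] with x hx
    rw [hx, SchwartzMap.conjugate_apply]
  have hB : ∀ᵐ x, ‖b x‖ ≤ ‖(𝓕 φ).toBoundedContinuousFunction‖ := by
    filter_upwards [hbx] with x hx
    rw [hx, RCLike.norm_conj]
    exact (𝓕 φ).toBoundedContinuousFunction.norm_coe_le_norm x
  have e1 : (fun x => conj (b x) * (levyOp t (fnH1 v) x : ℂ)) =ᵐ[volume]
      fun x => (𝓕 φ) x * (levyOp t (fnH1 v) x : ℂ) := by
    filter_upwards [hbx] with x hx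
    rw [hx, Complex.conj_conj]
  have e2 : (fun ξ : ℝ => ((|ξ| ^ t : ℝ) : ℂ) * (conj ((𝓕 b : Lp ℂ 2 (volume : Measure ℝ)) ξ) *
      (𝓕 (toL2CH1 v) : Lp ℂ 2 (volume : Measure ℝ)) ξ)) =ᵐ[volume]
      fun ξ : ℝ => φ ξ * (((|ξ| ^ t : ℝ) : ℂ) *
        (𝓕 (toL2CH1 v) : Lp ℂ 2 (volume : Measure ℝ)) ξ) := by
    filter_upwards [hFb] with x hx
    rw [hx, Complex.conj_conj, mul_left_comm]
  refine ⟨(integrable_conj_mul_levyOp ht0 ht1 v b hB).congr e1, ?_⟩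
  rw [← integral_congr_ae e1, ← integral_congr_ae e2]
  exact integral_conj_mul_levyOp ht0 ht1 v b hB
    ((integrable_schwartz_mul_rpow_mul ht0 ht1 φ _).congr e2.symm)

theorem integrable_schwartz_mul_levyOp {t : ℝ} (ht0 : 0 < t) (ht1 : t < 1) (v : H1Rstar)
    (φ : 𝓢(ℝ, ℂ)) : Integrable fun x => φ x * (levyOp t (fnH1 v) x : ℂ) := by
  have h := (integral_fourier_mul_levyOp ht0 ht1 v (𝓕⁻ φ)).1
  rwa [FourierTransform.fourier_fourierInv_eq] at h

theorem isTemperedFunction_fourier_levyOp {s : ℝ} (hs0 : 0 < s) (hs1 : s < 1) (v : H1Rstar)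
    {A : 𝓢'(ℝ, ℂ)} (hA : IsTemperedFunction A fun x => (levyOp s (fnH1 v) x : ℂ)) :
    IsTemperedFunction (𝓕 A) fun ξ => ((|ξ| ^ s : ℝ) : ℂ) *
      (𝓕 (toL2CH1 v) : Lp ℂ 2 (volume : Measure ℝ)) ξ := by
  intro φ
  refine ⟨integrable_schwartz_mul_rpow_mul hs0 hs1 φ _, ?_⟩
  rw [TemperedDistribution.fourier_apply, (hA (𝓕 φ)).2,
    (integral_fourier_mul_levyOp hs0 hs1 v φ).2]

/-- Cut at `|x| = 1`, the function is the sum of an L¹ and an L² function, each of which is a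
tempered distribution. -/
theorem exists_isTemperedFunction_levyOp {s : ℝ} (hs0 : 0 < s) (hs1 : s < 1) (v : H1Rstar) :
    ∃ A : 𝓢'(ℝ, ℂ), IsTemperedFunction A fun x => (levyOp s (fnH1 v) x : ℂ) := by
  set f : ℝ → ℂ := fun x => (levyOp s (fnH1 v) x : ℂ) with hf
  have h1 : MemLp ((Ioo (-1 : ℝ) 1).indicator f) 1 volume :=
    (memLp_indicator_iff_restrict measurableSet_Ioo).2
      (memLp_levyOp_fnH1_Ioo hs0 hs1 v one_pos).ofReal
  have h2 : MemLp ((Icc (-1 : ℝ) 1)ᶜ.indicator f) 2 volume :=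
    (memLp_indicator_iff_restrict measurableSet_Icc.compl).2
      (memLp_levyOp_fnH1_compl_Icc hs0 hs1 v one_pos).ofReal
  -- The open interval and the complement of the closed one miss only the two end points.
  have hsum : ∀ᵐ x, h1.toLp _ x + h2.toLp _ x = f x := by
    filter_upwards [h1.coeFn_toLp, h2.coeFn_toLp, Ioo_ae_eq_Icc (μ := (volume : Measure ℝ))
      (a := -1) (b := 1)] with x e1 e2 e3
    have e3' : (x ∈ Ioo (-1 : ℝ) 1) = (x ∈ Icc (-1 : ℝ) 1) := e3
    rw [e1, e2]
    by_cases hx : x ∈ Icc (-1 : ℝ) 1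
    · rw [indicator_of_mem (e3' ▸ hx), indicator_of_notMem (notMem_compl_iff.2 hx), add_zero]
    · rw [indicator_of_notMem (e3' ▸ hx), indicator_of_mem (mem_compl hx), zero_add]
  refine ⟨Lp.toTemperedDistribution (h1.toLp _) +
    Lp.toTemperedDistribution (h2.toLp _), fun φ =>
    ⟨integrable_schwartz_mul_levyOp hs0 hs1 v φ, ?_⟩⟩
  have i1 : Integrable (fun x => φ x * h1.toLp _ x) := by
    have h : MemLp φ ⊤ volume := φ.memLp ⊤ volume
    exact memLp_one_iff_integrable.1 ((Lp.memLp (h1.toLp _)).mul h)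
  have i2 : Integrable (fun x => φ x * h2.toLp _ x) :=
    (φ.memLp 2 volume).integrable_mul (Lp.memLp (h2.toLp _))
  change Lp.toTemperedDistribution (h1.toLp _) φ + Lp.toTemperedDistribution (h2.toLp _) φ = _
  rw [Lp.toTemperedDistribution_apply, Lp.toTemperedDistribution_apply]
  simp only [smul_eq_mul]
  rw [← integral_add i1 i2]
  refine integral_congr_ae ?_
  filter_upwards [hsum] with x hx
  rw [← mul_add, hx]

/-! ### The symmetric form -/

theorem locallyIntegrable_rpow_mul {t : ℝ} (ht0 : 0 < t) (a : Lp ℂ 2 (volume : Measure ℝ)) :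
    LocallyIntegrable fun ξ : ℝ => ((|ξ| ^ t : ℝ) : ℂ) * a ξ := by
  have hc : Continuous fun ξ : ℝ => ((|ξ| ^ t : ℝ) : ℂ) :=
    Complex.continuous_ofReal.comp (continuous_abs.rpow_const fun _ => Or.inr ht0.le)
  rw [← locallyIntegrableOn_univ]
  exact ((locallyIntegrable_Lp_two a).locallyIntegrableOn univ).continuousOn_mul hc.continuousOn
    isClosed_univ.isLocallyClosed

/-- The function `L_{s/2}[v]` as a complex valued function of class `L²`. -/
noncomputable def levyHalf {s : ℝ} (hs0 : 0 < s) (hs1 : s < 1) (v : H1Rstar) :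
    Lp ℂ 2 (volume : Measure ℝ) :=
  ((memLp_levyOp_half_fnH1 hs0 hs1 v).ofReal (K := ℂ)).toLp

theorem coeFn_levyHalf {s : ℝ} (hs0 : 0 < s) (hs1 : s < 1) (v : H1Rstar) :
    levyHalf hs0 hs1 v =ᵐ[volume] fun x => (levyOp (s / 2) (fnH1 v) x : ℂ) :=
  MemLp.coeFn_toLp _

/-- Both sides agree against test functions, by the multiplier formula at order `s/2`, and local
integrability upgrades this to equality almost everywhere. -/
theorem fourier_levyHalf {s : ℝ} (hs0 : 0 < s) (hs1 : s < 1) (v : H1Rstar) :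
    (𝓕 (levyHalf hs0 hs1 v) : Lp ℂ 2 (volume : Measure ℝ)) =ᵐ[volume] fun ξ =>
      ((|ξ| ^ (s / 2) : ℝ) : ℂ) * (𝓕 (toL2CH1 v) : Lp ℂ 2 (volume : Measure ℝ)) ξ := by
  refine ae_eq_of_forall_integral_schwartz_mul_eq (locallyIntegrable_Lp_two _)
    (locallyIntegrable_rpow_mul (by linarith) _) fun φ _ => ?_
  rw [integral_schwartz_mul_fourier,
    ← (integral_fourier_mul_levyOp (by linarith : 0 < s / 2) (by linarith) v φ).2]
  refine integral_congr_ae ?_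
  filter_upwards [coeFn_levyHalf hs0 hs1 v] with x hx
  rw [hx]

theorem ae_norm_toL2CH1_le (v : H1Rstar) : ∀ᵐ x, ‖toL2CH1 v x‖ ≤ 2 * ‖v‖ := by
  filter_upwards [coeFn_toL2CH1 v, ae_abs_fnH1_le v] with x h1 h2
  rwa [h1, Complex.norm_real]

theorem integrable_fnH1_mul_levyOp {s : ℝ} (hs0 : 0 < s) (hs1 : s < 1) (v w : H1Rstar) :
    Integrable fun x => fnH1 w x * levyOp s (fnH1 v) x := by
  have h := (integrable_conj_mul_levyOp hs0 hs1 v (toL2CH1 w) (ae_norm_toL2CH1_le w)).re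
  refine h.congr ?_
  filter_upwards [coeFn_toL2CH1 w] with x hx
  rw [hx, Complex.conj_ofReal, ← Complex.ofReal_mul]
  exact Complex.ofReal_re _

/-- The bilinear formula with `b = w`, allowed because `w` is bounded. Its integrability hypothesis
holds because `|ξ|^s` splits into two factors `|ξ|^(s/2)`, each of which makes an L² function of one
transform. Plancherel then returns to the order `s/2` operators. -/
theorem integral_fnH1_mul_levyOp {s : ℝ} (hs0 : 0 < s) (hs1 : s < 1) (v w : H1Rstar) :
    ∫ x, fnH1 w x * levyOp s (fnH1 v) x =
      ∫ x, levyOp (s / 2) (fnH1 w) x * levyOp (s / 2) (fnH1 v) x := by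
  have hF : (fun ξ => conj ((𝓕 (levyHalf hs0 hs1 w) : Lp ℂ 2 (volume : Measure ℝ)) ξ) *
      (𝓕 (levyHalf hs0 hs1 v) : Lp ℂ 2 (volume : Measure ℝ)) ξ) =ᵐ[volume] fun ξ : ℝ =>
      ((|ξ| ^ s : ℝ) : ℂ) * (conj ((𝓕 (toL2CH1 w) : Lp ℂ 2 (volume : Measure ℝ)) ξ) *
        (𝓕 (toL2CH1 v) : Lp ℂ 2 (volume : Measure ℝ)) ξ) := by
    filter_upwards [fourier_levyHalf hs0 hs1 v, fourier_levyHalf hs0 hs1 w] with ξ h1 h2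
    have e : |ξ| ^ s = |ξ| ^ (s / 2) * |ξ| ^ (s / 2) := by
      rw [← Real.rpow_add_of_nonneg (abs_nonneg _) (by linarith) (by linarith), add_halves]
    rw [h1, h2, e, map_mul, Complex.conj_ofReal]
    push_cast
    ring
  have hi := (MemLp.integrable_mul
    (Lp.memLp (𝓕 (levyHalf hs0 hs1 w) : Lp ℂ 2 (volume : Measure ℝ))).star
    (Lp.memLp (𝓕 (levyHalf hs0 hs1 v) : Lp ℂ 2 (volume : Measure ℝ)))).congr hF
  have h := integral_conj_mul_levyOp hs0 hs1 v (toL2CH1 w) (ae_norm_toL2CH1_le w) hi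
  rw [← integral_congr_ae hF, ← integral_conj_mul_eq_fourier] at h
  have e1 : ∫ x, conj (toL2CH1 w x) * (levyOp s (fnH1 v) x : ℂ) =
      ((∫ x, fnH1 w x * levyOp s (fnH1 v) x : ℝ) : ℂ) := by
    rw [← integral_complex_ofReal]
    refine integral_congr_ae ?_
    filter_upwards [coeFn_toL2CH1 w] with x hx
    rw [hx, Complex.conj_ofReal, ← Complex.ofReal_mul]
  have e2 : ∫ x, conj (levyHalf hs0 hs1 w x) * levyHalf hs0 hs1 v x =
      ((∫ x, levyOp (s / 2) (fnH1 w) x * levyOp (s / 2) (fnH1 v) x : ℝ) : ℂ) := by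
    rw [← integral_complex_ofReal]
    refine integral_congr_ae ?_
    filter_upwards [coeFn_levyHalf hs0 hs1 w, coeFn_levyHalf hs0 hs1 v] with x hx hy
    rw [hx, hy, Complex.conj_ofReal, ← Complex.ofReal_mul]
  rw [e1, e2] at h
  exact Complex.ofReal_injective h

/-! ### The full lemma -/

theorem lemma4p1 (s : ℝ) (hs0 : 0 < s) (hs1 : s < 1) :
    -- (i)(a): continuity from `C_b(ℝ∖{0}) ∩ C¹(ℝ∖{0})` to `C(ℝ∖{0})`
    (∃ T : CbC1 →L[ℝ] C(Rstar, ℝ), ∀ (v : CbC1) (x : Rstar),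
      LevyConvergesAt s (fnCbC1 v) x ∧ T v x = levyOp s (fnCbC1 v) x) ∧
    -- (i)(b): continuity from `H¹(ℝ∖{0})` to `L¹_loc(ℝ) ∩ L²_loc(ℝ̄∖{0})`
    (∃ T : H1Rstar →L[ℝ] LocSpace, ∀ v : H1Rstar,
      (∀ᵐ x, LevyConvergesAt s (fnH1 v) x) ∧ (T v).1 =ᵐ[volume] levyOp s (fnH1 v)) ∧
    -- (i)(c): continuity of `L_{s/2}` from `H¹(ℝ∖{0})` to `L²(ℝ)`
    (∃ T : H1Rstar →L[ℝ] Lp ℝ 2 (volume : Measure ℝ), ∀ v : H1Rstar,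
      (∀ᵐ x, LevyConvergesAt (s / 2) (fnH1 v) x) ∧ T v =ᵐ[volume] levyOp (s / 2) (fnH1 v)) ∧
    -- (i)(d): sequential continuity from `L¹(ℝ) ∩ BV(ℝ)` with weak-⋆ topology to `L¹(ℝ)`
    (∃ T : L1BV →ₗ[ℝ] Lp ℝ 1 (volume : Measure ℝ), SeqContinuous T ∧ ∀ v : L1BV,
      (∀ᵐ x, LevyConvergesAt s (fnL1BV v) x) ∧ T v =ᵐ[volume] levyOp s (fnL1BV v)) ∧
    -- (ii): agreement with the Fourier multiplier in `𝓢'(ℝ)`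
    (∀ v : H1Rstar, ∃ A B : 𝓢'(ℝ, ℂ),
      IsTemperedFunction A (fun x => (levyOp s (fnH1 v) x : ℂ)) ∧
      IsTemperedFunction B (fun ξ => ((|ξ| ^ s : ℝ) : ℂ) *
        (𝓕 (toL2CH1 v) : Lp ℂ 2 (volume : Measure ℝ)) ξ) ∧
      A = 𝓕⁻ B) ∧
    -- (iii): symmetry
    (∀ v w : H1Rstar,
      Integrable (fun x => levyOp s (fnH1 v) x * fnH1 w x) ∧
      Integrable (fun x => fnH1 v x * levyOp s (fnH1 w) x) ∧
      Integrable (fun x => levyOp (s / 2) (fnH1 v) x * levyOp (s / 2) (fnH1 w) x) ∧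
      ∫ x, levyOp s (fnH1 v) x * fnH1 w x = ∫ x, fnH1 v x * levyOp s (fnH1 w) x ∧
      ∫ x, fnH1 v x * levyOp s (fnH1 w) x =
        ∫ x, levyOp (s / 2) (fnH1 v) x * levyOp (s / 2) (fnH1 w) x) ∧
    -- (iv): parity
    (∀ v : H1Rstar,
      ((∀ᵐ x, fnH1 v (-x) = -fnH1 v x) → ∀ᵐ x, levyOp s (fnH1 v) (-x) = -levyOp s (fnH1 v) x) ∧
      ((∀ᵐ x, fnH1 v (-x) = fnH1 v x) → ∀ᵐ x, levyOp s (fnH1 v) (-x) = levyOp s (fnH1 v) x)) ∧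
    -- (v): strict reverse maximum principle for odd functions
    (∀ v : CbC1, fnCbC1 v ≠ 0 → Function.Odd (fnCbC1 v) → ∀ x₀ : ℝ, 0 < x₀ →
      (IsMaxOn (fnCbC1 v) (Ioi 0) x₀ → 0 ≤ fnCbC1 v x₀ → 0 < levyOp s (fnCbC1 v) x₀) ∧
      (IsMinOn (fnCbC1 v) (Ioi 0) x₀ → fnCbC1 v x₀ ≤ 0 → levyOp s (fnCbC1 v) x₀ < 0)) := by
  have hcont : ∀ v : CbC1, ContinuousOn (fnCbC1 v) (Ioi 0) := fun v x hx =>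
    (hasDerivAt_fnCbC1 v (ne_of_gt hx)).continuousAt.continuousWithinAt
  refine ⟨exists_levyCbC1 hs0 hs1,
    ⟨⟨levyLoc hs0 hs1, continuous_levyLoc hs0 hs1⟩, fun v =>
      ⟨levyConvergesAt_fnH1 hs0 hs1 v, coeFn_levyLoc hs0 hs1 v⟩⟩,
    exists_levyL2 hs0 hs1,
    ⟨levyL1BV hs0 hs1, seqContinuous_levyL1BV hs0 hs1, fun v =>
      ⟨levyConvergesAt_fnL1BV hs0 hs1 v, coeFn_levyL1BV hs0 hs1 v⟩⟩,
    fun v => ?_, fun v w => ⟨?_, integrable_fnH1_mul_levyOp hs0 hs1 w v,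
      (memLp_levyOp_half_fnH1 hs0 hs1 v).integrable_mul (memLp_levyOp_half_fnH1 hs0 hs1 w), ?_,
      integral_fnH1_mul_levyOp hs0 hs1 w v⟩,
    fun v => ⟨levyOp_odd_of_ae, levyOp_even_of_ae⟩, fun v hv hodd x₀ hx₀ => ?_⟩
  · obtain ⟨A, hA⟩ := exists_isTemperedFunction_levyOp hs0 hs1 v
    exact ⟨A, 𝓕 A, hA, isTemperedFunction_fourier_levyOp hs0 hs1 v hA,
      (FourierTransform.fourierInv_fourier_eq A).symm⟩
  · simpa only [mul_comm] using integrable_fnH1_mul_levyOp hs0 hs1 v w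
  -- Both pairings equal the form of order `s/2`, which is visibly symmetric.
  · rw [integral_fnH1_mul_levyOp hs0 hs1 w v]
    simpa only [mul_comm] using integral_fnH1_mul_levyOp hs0 hs1 v w
  · have hconv := levyConvergesAt_fnCbC1 hs0 hs1 v ⟨x₀, hx₀.ne'⟩
    exact ⟨levyOp_pos_of_isMaxOn hs0 hs1 hx₀ hconv (hcont v) hv hodd,
      levyOp_neg_of_isMinOn hs0 hs1 hx₀ hconv (hcont v) hv hodd⟩
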